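/- Let $M$ be a smooth (Hausdorff, $\sigma$-compact) manifold of dimension $n=p+q\ge 3$ with a conformal structure of signature $(p,q)$, and let $g$ be any metric in the conformal class, with Levi-Civita connection $D$ and Schouten tensor $P=\frac1{n-2}\bigl(\mathrm{Ric}-\frac{\mathrm{Sc}}{2(n-1)}g\bigr)$. In the splitting given by $g$ (which trivialises densities), the standard tractor bundle is $\mathcal S=\mathbb R\oplus TM\oplus\mathbb R\ni(\rho,\mu,\sigma)$. It carries the tractor metric $2\rho\sigma+g(\mu,\mu)$, the filtration $\mathcal S=\mathcal S^{-1}\supset\mathcal S^0=\{\sigma=0\}\supset\mathcal S^1=\{\sigma=0,\mu=0\}$, the tractor connection $$\nabla_v(\rho,\mu,\sigma)=\bigl(D_v\rho-P(v,\mu),\ D_v\mu+\sigma P(v)+\rho v,\ D_v\sigma-g(v,\mu)\bigr),$$ and the action of covectors $\eta\bullet(\rho,\mu,\sigma)=(-\eta(\mu),\sigma\eta^\sharp,0)$. Let $T\subset\bigotimes^{\ell}\mathcal S$ be a tractor bundle, i.e. the subbundle associated to an $SO(p+1,q+1)$-invariant subspace of $\bigotimes^\ell\mathbb R^{p+1,q+1}$,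 with the induced connection $\nabla$, action $\bullet$ and filtration. Let $\mathcal C_k$ be the space of smooth $T$-valued $k$-forms (so $\mathcal C_0=\Gamma(T)$), and let $\partial^*:\mathcal C_{k+1}\to\mathcal C_k$ be given by $\partial^*(Z_0\wedge\dots\wedge Z_k\otimes t)=\sum_j(-1)^{j+1}Z_0\wedge\cdots\widehat{Z_j}\cdots\wedge Z_k\otimes Z_j\bullet t$. Put $\mathcal Z_k=\ker\partial^*\subset\mathcal C_k$ (with $\mathcal Z_0=\mathcal C_0$), $\mathcal B_k=\mathrm{im}\,\partial^*\subset\mathcal C_k$, $\mathcal H_k=\mathcal Z_k/\mathcal B_k$, and let $\Pi_k:\mathcal Z_k\to\mathcal H_k$ be the projection. Let $\mathfrak{gl}(T)^1$ denote the endomorphisms of $T$ that raise the filtration degree by at least one. For a smooth one-form $\Psi$ with values in $\mathfrak{gl}(T)^1$ put $\tilde\nabla=\nabla+\Psi$. The BGG splitting operator $\tilde L_k:\mathcal H_k\to\mathcal Z_k$ of $\tilde\nabla$ sends $\sigma$ to the unique $s\in\mathcal Z_k$ with $\Pi_k s=\sigma$ and $d^{\tilde\nabla}s\in\mathcal Z_{k+1}$,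 and $\tilde\Theta_0=\Pi_1\circ\tilde\nabla\circ\tilde L_0$ is its first BGG operator. For $\Psi=0$ write $L_k$, $\Theta_0$. Suppose that $\Psi s\in\mathcal B_1$ for all $s\in\Gamma(T)$, and that the curvature $R$ of $\tilde\nabla$ satisfies $\partial^*(Rs)=0$ for all $s\in\Gamma(T)$. Then: 1. The operators $L_0$, $\tilde L_0$ and $\tilde L_1$ are well defined (the lifts exist and are unique), $\tilde L_0=L_0$ and $\tilde\Theta_0=\Theta_0$. 2. $d^{\tilde\nabla}(\tilde\nabla s)\in\mathcal Z_2$ for every $s\in\Gamma(T)$, and $\tilde\nabla\circ L_0=\tilde L_1\circ\Theta_0$. More precisely, for $s\in\Gamma(T)$ one has $\tilde\nabla s=\tilde L_1\Theta_0\Pi_0(s)$ if and only if $\partial^*(\tilde\nabla s)=0$; in particular this holds whenever $s$ lies in the image of $L_0$. 3. $\Pi_0$ and $L_0$ restrict to mutually inverse linear isomorphisms between the space of $\tilde\nabla$-parallel sections of $T$ and $\ker\Theta_0$; that is, $(T,\tilde\nabla,\Pi_0,L_0)$ is a geometric prolongation of $\Theta_0$. -/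

import Mathlib

open Set Filter Topology Manifold ContDiff Bundle

noncomputable section

namespace ConfTractor

/-! ## Pseudo-Riemannian geometry of a metric in the conformal class -/

/-- The model space `ℝ^(p+q)` of the manifold. -/
abbrev Model (p q : ℕ) : Type := EuclideanSpace ℝ (Fin (p + q))

/-- The diagonal entries of the standard inner product of signature `(p, q)` on `ℝ^(p+q)`. -/
def sign (p q : ℕ) (i : Fin (p + q)) : ℝ := if (i : ℕ) < p then 1 else -1

/-- A smooth pseudo-Riemannian metric of signature `(p, q)`. -/
structure Metric (p q : ℕ) (M : Type*) [TopologicalSpace M] [ChartedSpace (Model p q) M]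
    [IsManifold (𝓡 (p + q)) ∞ M] where
  /-- The bilinear form on each tangent space. -/
  inner (x : M) : TangentSpace (𝓡 (p + q)) x →L[ℝ] TangentSpace (𝓡 (p + q)) x →L[ℝ] ℝ
  symm (x : M) (v w : TangentSpace (𝓡 (p + q)) x) : inner x v w = inner x w v
  signature (x : M) : ∃ e : Fin (p + q) → TangentSpace (𝓡 (p + q)) x,
    ∀ i j, inner x (e i) (e j) = if i = j then sign p q i else 0
  contMDiff : ContMDiff (𝓡 (p + q))
    ((𝓡 (p + q)).prod 𝓘(ℝ, Model p q →L[ℝ] Model p q →L[ℝ] ℝ)) ∞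
    (fun x ↦ TotalSpace.mk' (Model p q →L[ℝ] Model p q →L[ℝ] ℝ) x (inner x))

variable {p q : ℕ} {M : Type*} [TopologicalSpace M] [ChartedSpace (Model p q) M]

/-- The directional derivative of `f` at `x` along `v`. -/
def dd (f : M → ℝ) (x : M) (v : TangentSpace (𝓡 (p + q)) x) : ℝ := mvfderiv (𝓡 (p + q)) f x v

/-- The `i`-th coordinate vector at `x` (in the preferred chart at `x`). It is only used to write
contractions, which do not depend on the basis. -/
def bas (x : M) (i : Fin (p + q)) : TangentSpace (𝓡 (p + q)) x :=
  (EuclideanSpace.single i (1 : ℝ) : Model p q)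

/-- The `i`-th coordinate of a tangent vector in the basis `bas x`. -/
def coord (x : M) (v : TangentSpace (𝓡 (p + q)) x) (i : Fin (p + q)) : ℝ :=
  (show Model p q from v) i

variable [IsManifold (𝓡 (p + q)) ∞ M]

/-- An extension of the tangent vector `v` at `x` to a vector field, smooth near `x`. All uses
below are tensorial in `v`, so that the chosen extension does not matter. -/
def ext {x : M} (v : TangentSpace (𝓡 (p + q)) x) : Π y : M, TangentSpace (𝓡 (p + q)) y :=
  FiberBundle.extend (Model p q) v

/-- Smoothness of a vector field at a point. -/
def VecSmoothAt (X : Π y : M, TangentSpace (𝓡 (p + q)) y) (x : M) : Prop :=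
  ContMDiffAt (𝓡 (p + q)) (𝓡 (p + q)).tangent ∞
    (fun y ↦ (⟨y, X y⟩ : TangentBundle (𝓡 (p + q)) M)) x

/-- The Lie bracket of vector fields. -/
def bracket (X Y : Π y : M, TangentSpace (𝓡 (p + q)) y) : Π y : M, TangentSpace (𝓡 (p + q)) y :=
  VectorField.mlieBracket (𝓡 (p + q)) X Y

namespace Metric

variable (g : Metric p q M)

/-- The coefficients `g^{ij}` of the inverse metric in the basis `bas x`. -/
def inv (x : M) : Matrix (Fin (p + q)) (Fin (p + q)) ℝ :=
  (Matrix.of fun i j ↦ g.inner x (bas x i) (bas x j))⁻¹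

/-- The Koszul expression `2 g(D_X Y, Z)` at `x`. -/
def koszul (X Y Z : Π y : M, TangentSpace (𝓡 (p + q)) y) (x : M) : ℝ :=
  dd (fun y ↦ g.inner y (Y y) (Z y)) x (X x) + dd (fun y ↦ g.inner y (Z y) (X y)) x (Y x)
    - dd (fun y ↦ g.inner y (X y) (Y y)) x (Z x) + g.inner x (bracket X Y x) (Z x)
    - g.inner x (bracket X Z x) (Y x) - g.inner x (bracket Y Z x) (X x)

/-- The Levi-Civita connection: `g.lc Y x v` is `D_v Y` at `x`. -/
def lc (Y : Π y : M, TangentSpace (𝓡 (p + q)) y) (x : M) (v : TangentSpace (𝓡 (p + q)) x) :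
    TangentSpace (𝓡 (p + q)) x :=
  ∑ i, ∑ j, (g.inv x i j * (1 / 2 * g.koszul (ext v) Y (ext (bas x i)) x)) • bas x j

/-- The Riemann curvature `R(u, v) w = D_u D_v w - D_v D_u w - D_{[u,v]} w`. -/
def riem (x : M) (u v w : TangentSpace (𝓡 (p + q)) x) : TangentSpace (𝓡 (p + q)) x :=
  g.lc (fun y ↦ g.lc (ext w) y (ext v y)) x u - g.lc (fun y ↦ g.lc (ext w) y (ext u y)) x v
    - g.lc (ext w) x (bracket (ext u) (ext v) x)

/-- The Ricci curvature: the trace of `u ↦ R(u, v) w`. -/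
def ricci (x : M) (v w : TangentSpace (𝓡 (p + q)) x) : ℝ :=
  ∑ i, coord x (g.riem x (bas x i) v w) i

/-- The scalar curvature. -/
def scal (x : M) : ℝ := ∑ i, ∑ j, g.inv x i j * g.ricci x (bas x i) (bas x j)

/-- The Schouten tensor `P = (Ric - Sc / (2 (n - 1)) g) / (n - 2)`, `n = p + q`. -/
def schouten (x : M) (v w : TangentSpace (𝓡 (p + q)) x) : ℝ :=
  (g.ricci x v w - g.scal x / (2 * ((p + q : ℕ) - 1 : ℝ)) * g.inner x v w)
    / ((p + q : ℕ) - 2 : ℝ)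

/-- The Schouten tensor with its second index raised: `v^a ↦ v^a P_a^b`. -/
def schoutenUp (x : M) (v : TangentSpace (𝓡 (p + q)) x) : TangentSpace (𝓡 (p + q)) x :=
  ∑ i, ∑ j, (g.inv x i j * g.schouten x v (bas x i)) • bas x j

end Metric

/-! ## The standard tractor bundle in the splitting given by the metric -/

/-- The fibre at `x` of the standard tractor bundle; an element is the column `(ρ, μ, σ)`. The
middle slot is written with its index raised, and densities are trivialised by the metric. -/
abbrev Std (x : M) : Type := ℝ × TangentSpace (𝓡 (p + q)) x × ℝ

/-- The typical fibre `ℝ^{p+1,q+1}` of the standard tractor bundle. -/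
abbrev StdModel (p q : ℕ) : Type := ℝ × Model p q × ℝ

/-- The standard inner product of signature `(p+1, q+1)` on the typical fibre. -/
def stdForm (a b : StdModel p q) : ℝ :=
  a.1 * b.2.2 + a.2.2 * b.1 + ∑ i, sign p q i * (a.2.1 i * b.2.1 i)

/-- The group `SO(p+1, q+1)`. -/
def IsSO (A : StdModel p q →ₗ[ℝ] StdModel p q) : Prop :=
  (∀ a b, stdForm (A a) (A b) = stdForm a b) ∧ LinearMap.det A = 1

/-- Smoothness of a standard tractor field at a point. -/
def StdSmoothAt (s : Π y : M, Std (p := p) (q := q) y) (x : M) : Prop :=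
  ContMDiffAt (𝓡 (p + q)) 𝓘(ℝ, ℝ) ∞ (fun y ↦ (s y).1) x ∧ VecSmoothAt (fun y ↦ (s y).2.1) x ∧
    ContMDiffAt (𝓡 (p + q)) 𝓘(ℝ, ℝ) ∞ (fun y ↦ (s y).2.2) x

/-- An extension of a standard tractor at `x` to a tractor field, smooth near `x`. -/
def stdExt {x : M} (w : Std (p := p) (q := q) x) : Π y : M, Std (p := p) (q := q) y :=
  fun y ↦ (w.1, ext w.2.1 y, w.2.2)

/-- The filtration `S = S^{-1} ⊃ S^0 ⊃ S^1 ⊃ S^2 = 0` of the standard tractor bundle. -/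
def stdFil (k : ℤ) {x : M} (w : Std (p := p) (q := q) x) : Prop :=
  (0 ≤ k → w.2.2 = 0) ∧ (1 ≤ k → w.2.1 = 0) ∧ (2 ≤ k → w.1 = 0)

namespace Metric

variable (g : Metric p q M)

/-- The tractor metric. -/
def form (x : M) (a b : Std (p := p) (q := q) x) : ℝ :=
  a.1 * b.2.2 + a.2.2 * b.1 + g.inner x a.2.1 b.2.1

/-- The action of the tangent vector `v`, as an element of the adjoint tractor bundle. -/
def down (x : M) (v : TangentSpace (𝓡 (p + q)) x) (a : Std (p := p) (q := q) x) :
    Std (p := p) (q := q) x :=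
  (0, a.1 • v, - g.inner x v a.2.1)

/-- The action of the covector `g(v, ·)`, as an element of the adjoint tractor bundle. -/
def up (x : M) (v : TangentSpace (𝓡 (p + q)) x) (a : Std (p := p) (q := q) x) :
    Std (p := p) (q := q) x :=
  (- g.inner x v a.2.1, a.2.2 • v, 0)

/-- The standard tractor connection
`∇_v (ρ, μ, σ) = (D_v ρ - P(v, μ), D_v μ + σ P(v) + ρ v, D_v σ - g(v, μ))`. -/
def stdNabla (s : Π y : M, Std (p := p) (q := q) y) (x : M) (v : TangentSpace (𝓡 (p + q)) x) :
    Std (p := p) (q := q) x :=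
  (dd (fun y ↦ (s y).1) x v, g.lc (fun y ↦ (s y).2.1) x v, dd (fun y ↦ (s y).2.2) x v)
    + g.down x v (s x) + g.up x (g.schoutenUp x v) (s x)

end Metric

/-! ## Tensor powers

Elements of `⊗^l S` are written as `l`-linear forms on `S`, by means of the tractor metric
`S ≅ S^*`. Multilinearity is not part of the type `Tens`; it is part of the definition of a tractor
bundle below. -/

/-- Functions of `l` standard tractors at `x`; the fibres of tensor bundles lie in here. -/
abbrev Tens (p q l : ℕ) {M : Type*} [TopologicalSpace M] [ChartedSpace (Model p q) M]
    (x : M) : Type :=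
  (Fin l → Std (p := p) (q := q) x) → ℝ

/-- The same for the typical fibre. -/
abbrev TensModel (p q l : ℕ) : Type := (Fin l → StdModel p q) → ℝ

variable {l : ℕ}

/-- The action on `⊗^l S` of an endomorphism `A` of `S` that is skew for the tractor metric. -/
def tensAct {x : M} (A : Std (p := p) (q := q) x → Std (p := p) (q := q) x) (t : Tens p q l x) :
    Tens p q l x :=
  fun w ↦ - ∑ j, t (Function.update w j (A (w j)))

/-- Smoothness at a point of a tensor field. -/
def TensSmoothAt (t : Π y : M, Tens p q l y) (x : M) : Prop :=
  ∀ w : Fin l → Π y : M, Std (p := p) (q := q) y, (∀ j, StdSmoothAt (w j) x) →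
    ContMDiffAt (𝓡 (p + q)) 𝓘(ℝ, ℝ) ∞ (fun y ↦ t y (fun j ↦ w j y)) x

/-- The filtration on `⊗^l S` induced by the one on `S`. Since `S^{1-k}` is the annihilator of
`S^k`, a tensor has degree at least `i` when it vanishes on arguments of total degree
greater than `-i`. -/
def tensFil (i : ℤ) {x : M} (t : Tens p q l x) : Prop :=
  ∀ (k : Fin l → ℤ) (w : Fin l → Std (p := p) (q := q) x),
    (∀ j, stdFil (k j) (w j)) → -i < ∑ j, k j → t w = 0

/-- The tractor connection on `⊗^l S`, induced by the one on `S`. -/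
def Metric.nabla (g : Metric p q M) (t : Π y : M, Tens p q l y) (x : M)
    (v : TangentSpace (𝓡 (p + q)) x) : Tens p q l x :=
  fun w ↦ dd (fun y ↦ t y (fun j ↦ stdExt (w j) y)) x v
    - ∑ j, t x (Function.update w j (g.stdNabla (stdExt (w j)) x v))

/-- `T ⊂ ⊗^l S` is a tractor bundle: it is associated to an `SO(p+1, q+1)`-invariant subspace `V`
of `⊗^l ℝ^{p+1,q+1}`, that is, every point has a neighbourhood with a smooth isometric frame `u` of
`S` in which `T` is the constant subspace `V`. -/
def IsTractorBundle (g : Metric p q M) (T : Π x : M, Submodule ℝ (Tens p q l x)) : Prop :=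
  ∃ V : Submodule ℝ (TensModel p q l),
    (∀ t ∈ V, ∃ m : MultilinearMap ℝ (fun _ : Fin l ↦ StdModel p q) ℝ, ⇑m = t) ∧
    (∀ A : StdModel p q →ₗ[ℝ] StdModel p q, IsSO A →
      ∀ t ∈ V, (fun w : Fin l → StdModel p q ↦ t (fun j ↦ A (w j))) ∈ V) ∧
    ∀ x₀ : M, ∃ u : Π x : M, StdModel p q →ₗ[ℝ] Std (p := p) (q := q) x, ∀ᶠ x in 𝓝 x₀,
      (∀ a, StdSmoothAt (fun y ↦ u y a) x) ∧
      (∀ a b, g.form x (u x a) (u x b) = stdForm a b) ∧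
      ∀ t : Tens p q l x,
        t ∈ T x ↔ (fun w : Fin l → StdModel p q ↦ t (fun j ↦ u x (w j))) ∈ V

/-! ## Chains -/

/-- Families of functions that contain the sections of `T`. -/
abbrev Raw0 (p q l : ℕ) (M : Type*) [TopologicalSpace M] [ChartedSpace (Model p q) M] : Type _ :=
  Π x : M, Tens p q l x

/-- Families of functions that contain the `T`-valued one-forms. -/
abbrev Raw1 (p q l : ℕ) (M : Type*) [TopologicalSpace M] [ChartedSpace (Model p q) M] : Type _ :=
  Π x : M, TangentSpace (𝓡 (p + q)) x → Tens p q l x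

/-- Families of functions that contain the `T`-valued two-forms. -/
abbrev Raw2 (p q l : ℕ) (M : Type*) [TopologicalSpace M] [ChartedSpace (Model p q) M] : Type _ :=
  Π x : M, TangentSpace (𝓡 (p + q)) x → TangentSpace (𝓡 (p + q)) x → Tens p q l x

theorem TensSmoothAt.zero (x : M) : TensSmoothAt (p := p) (q := q) (l := l) (fun _ ↦ 0) x :=
  fun _ _ ↦ contMDiffAt_const

theorem TensSmoothAt.add {s t : Π y : M, Tens p q l y} {x : M} (hs : TensSmoothAt s x)
    (ht : TensSmoothAt t x) : TensSmoothAt (fun y ↦ s y + t y) x :=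
  fun w hw ↦ (hs w hw).add (ht w hw)

theorem TensSmoothAt.smul {t : Π y : M, Tens p q l y} {x : M} (c : ℝ)
    (ht : TensSmoothAt t x) : TensSmoothAt (fun y ↦ c • t y) x :=
  fun w hw ↦ contMDiffAt_const.mul (ht w hw)

variable (T : Π x : M, Submodule ℝ (Tens p q l x))

/-- `Γ(T) = C_0`: smooth sections of `T`. -/
def C0 : Submodule ℝ (Raw0 p q l M) where
  carrier := {s | (∀ x, s x ∈ T x) ∧ ∀ x, TensSmoothAt s x}
  zero_mem' := ⟨fun x ↦ (T x).zero_mem, fun x ↦ .zero x⟩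
  add_mem' ha hb := ⟨fun x ↦ (T x).add_mem (ha.1 x) (hb.1 x), fun x ↦ (ha.2 x).add (hb.2 x)⟩
  smul_mem' c _ ha := ⟨fun x ↦ (T x).smul_mem c (ha.1 x), fun x ↦ (ha.2 x).smul c⟩

/-- `C_1`: smooth one-forms with values in `T`. -/
def C1 : Submodule ℝ (Raw1 p q l M) where
  carrier := {φ | (∀ x, IsLinearMap ℝ (φ x)) ∧ (∀ x v, φ x v ∈ T x) ∧
    ∀ x X, VecSmoothAt X x → TensSmoothAt (fun y ↦ φ y (X y)) x}
  zero_mem' := ⟨fun _ ↦ (0 : _ →ₗ[ℝ] _).isLinear, fun x _ ↦ (T x).zero_mem, fun x _ _ ↦ .zero x⟩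
  add_mem' ha hb := ⟨fun x ↦ ((ha.1 x).mk' _ + (hb.1 x).mk' _).isLinear,
    fun x v ↦ (T x).add_mem (ha.2.1 x v) (hb.2.1 x v),
    fun x X hX ↦ (ha.2.2 x X hX).add (hb.2.2 x X hX)⟩
  smul_mem' c _ ha := ⟨fun x ↦ (c • (ha.1 x).mk' _).isLinear,
    fun x v ↦ (T x).smul_mem c (ha.2.1 x v), fun x X hX ↦ (ha.2.2 x X hX).smul c⟩

/-- `C_2`: smooth two-forms with values in `T`. -/
def C2 : Submodule ℝ (Raw2 p q l M) where
  carrier := {φ | (∀ x w, IsLinearMap ℝ (fun v ↦ φ x v w)) ∧ (∀ x v w, φ x v w = - φ x w v) ∧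
    (∀ x v w, φ x v w ∈ T x) ∧
    ∀ x X Y, VecSmoothAt X x → VecSmoothAt Y x → TensSmoothAt (fun y ↦ φ y (X y) (Y y)) x}
  zero_mem' := ⟨fun _ _ ↦ (0 : _ →ₗ[ℝ] _).isLinear, fun _ _ _ ↦ by simp,
    fun x _ _ ↦ (T x).zero_mem, fun x _ _ _ _ ↦ .zero x⟩
  add_mem' {a b} ha hb := ⟨fun x w ↦ ((ha.1 x w).mk' _ + (hb.1 x w).mk' _).isLinear,
    fun x v w ↦ by
      change a x v w + b x v w = -(a x w v + b x w v)
      rw [ha.2.1 x v w, hb.2.1 x v w, neg_add],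
    fun x v w ↦ (T x).add_mem (ha.2.2.1 x v w) (hb.2.2.1 x v w),
    fun x X Y hX hY ↦ (ha.2.2.2 x X Y hX hY).add (hb.2.2.2 x X Y hX hY)⟩
  smul_mem' c a ha := ⟨fun x w ↦ (c • (ha.1 x w).mk' _).isLinear,
    fun x v w ↦ by
      change c • a x v w = -(c • a x w v)
      rw [ha.2.1 x v w, smul_neg],
    fun x v w ↦ (T x).smul_mem c (ha.2.2.1 x v w),
    fun x X Y hX hY ↦ (ha.2.2.2 x X Y hX hY).smul c⟩

section Bgg

variable (g : Metric p q M)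

/-- The contraction `- ∑ e^i • φ(e_i)` at `x`, for dual bases `e_i`, `e^i`. -/
def contr (x : M) : (TangentSpace (𝓡 (p + q)) x → Tens p q l x) →ₗ[ℝ] Tens p q l x where
  toFun φ := - ∑ i, ∑ j, g.inv x i j • tensAct (g.up x (bas x i)) (φ (bas x j))
  map_add' a b := by
    simp only [Pi.add_apply, ← neg_add, ← Finset.sum_add_distrib, ← smul_add]
    congr 1; refine Finset.sum_congr rfl fun i _ ↦ Finset.sum_congr rfl fun j _ ↦ ?_
    congr 1; funext w; simp [tensAct, Finset.sum_add_distrib]; ring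
  map_smul' c a := by
    simp only [Pi.smul_apply, RingHom.id_apply, smul_neg, Finset.smul_sum]
    congr 1; refine Finset.sum_congr rfl fun i _ ↦ Finset.sum_congr rfl fun j _ ↦ ?_
    rw [smul_comm c]
    congr 1; funext w; simp [tensAct, Finset.mul_sum]

/-- `∂^* : C_1 → C_0`, `∂^* (Z ⊗ t) = - Z • t`, that is `∂^* φ = - ∑ e^i • φ(e_i)`. -/
def delStar1 : Raw1 p q l M →ₗ[ℝ] Raw0 p q l M where
  toFun φ x := contr g x (φ x)
  map_add' a b := funext fun x ↦ (contr g x).map_add (a x) (b x)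
  map_smul' c a := funext fun x ↦ (contr g x).map_smul c (a x)

/-- `∂^* : C_2 → C_1`, `∂^* (Z ∧ W ⊗ t) = - W ⊗ (Z • t) + Z ⊗ (W • t)`, that is
`(∂^* φ)(v) = - ∑ e^i • φ(e_i, v)`. -/
def delStar2 : Raw2 p q l M →ₗ[ℝ] Raw1 p q l M where
  toFun φ x v := contr g x (fun w ↦ φ x w v)
  map_add' a b := funext fun x ↦ funext fun v ↦
    (contr g x).map_add (fun w ↦ a x w v) (fun w ↦ b x w v)
  map_smul' c a := funext fun x ↦ funext fun v ↦ (contr g x).map_smul c (fun w ↦ a x w v)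

/-- `B_0 = im ∂^*` in degree `0`. -/
def B0 : Submodule ℝ (Raw0 p q l M) := (C1 T).map (delStar1 g)

/-- `B_1 = im ∂^*` in degree `1`. -/
def B1 : Submodule ℝ (Raw1 p q l M) := (C2 T).map (delStar2 g)

/-- `Z_1 = ker ∂^*` in degree `1`. (`Z_0` is all of `C_0`.) -/
def Z1 : Submodule ℝ (Raw1 p q l M) := C1 T ⊓ LinearMap.ker (delStar1 g)

/-- `Z_2 = ker ∂^*` in degree `2`. -/
def Z2 : Submodule ℝ (Raw2 p q l M) := C2 T ⊓ LinearMap.ker (delStar2 g)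

/-- `H_0 = Z_0 / B_0`. -/
abbrev H0 : Type _ := C0 T ⧸ (B0 T g).submoduleOf (C0 T)

/-- `H_1 = Z_1 / B_1`. -/
abbrev H1 : Type _ := Z1 T g ⧸ (B1 T g).submoduleOf (Z1 T g)

/-- The projection `Π_0 : Z_0 → H_0`. -/
def Pi0 : C0 T →ₗ[ℝ] H0 T g := ((B0 T g).submoduleOf (C0 T)).mkQ

/-- The projection `Π_1 : Z_1 → H_1`. -/
def Pi1 : Z1 T g →ₗ[ℝ] H1 T g := ((B1 T g).submoduleOf (Z1 T g)).mkQ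

/-! ## Connections `∇ + Ψ` and their BGG operators -/

variable {T}

open Classical in
/-- The value `Ψ(v) t` of an endomorphism valued one-form on `T`, for `t` in `T_x`. -/
def psiApply (Ψ : Π x : M, TangentSpace (𝓡 (p + q)) x →ₗ[ℝ] Module.End ℝ (T x)) (x : M)
    (v : TangentSpace (𝓡 (p + q)) x) (t : Tens p q l x) : Tens p q l x :=
  if h : t ∈ T x then (Ψ x v ⟨t, h⟩ : T x) else 0

/-- `Ψ` is a smooth section of `T^*M ⊗ gl(T)^1`: it is smooth, and all `Ψ(v)` raise the filtration
degree by at least one. -/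
def IsGlOne (Ψ : Π x : M, TangentSpace (𝓡 (p + q)) x →ₗ[ℝ] Module.End ℝ (T x)) : Prop :=
  (∀ (x : M) (X : Π y : M, TangentSpace (𝓡 (p + q)) y) (s : Π y : M, Tens p q l y),
    VecSmoothAt X x → (∀ y, s y ∈ T y) → TensSmoothAt s x →
      TensSmoothAt (fun y ↦ psiApply Ψ y (X y) (s y)) x) ∧
  ∀ (x : M) (v : TangentSpace (𝓡 (p + q)) x) (i : ℤ) (t : T x),
    tensFil i (t : Tens p q l x) → tensFil (i + 1) (Ψ x v t : Tens p q l x)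

/-- The deformed connection `∇ + Ψ` on `T`. -/
def conn (Ψ : Π x : M, TangentSpace (𝓡 (p + q)) x →ₗ[ℝ] Module.End ℝ (T x))
    (s : Raw0 p q l M) : Raw1 p q l M :=
  fun x v ↦ g.nabla s x v + psiApply Ψ x v (s x)

/-- The covariant exterior derivative of one-forms, for the connection `∇ + Ψ`:
`(dφ)(v, w) = (∇ + Ψ)_v (φ(w)) - (∇ + Ψ)_w (φ(v)) - φ([v, w])`. -/
def dOne (Ψ : Π x : M, TangentSpace (𝓡 (p + q)) x →ₗ[ℝ] Module.End ℝ (T x))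
    (φ : Raw1 p q l M) : Raw2 p q l M :=
  fun x v w ↦ conn g Ψ (fun y ↦ φ y (ext w y)) x v - conn g Ψ (fun y ↦ φ y (ext v y)) x w
    - φ x (bracket (ext v) (ext w) x)

/-- The curvature of `∇ + Ψ`, applied to `s`: with `N = ∇ + Ψ`,
`R(v, w) s = N_v N_w s - N_w N_v s - N_{[v,w]} s`. -/
def curv (Ψ : Π x : M, TangentSpace (𝓡 (p + q)) x →ₗ[ℝ] Module.End ℝ (T x))
    (s : Raw0 p q l M) : Raw2 p q l M :=
  fun x v w ↦ conn g Ψ (fun y ↦ conn g Ψ s y (ext w y)) x v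
    - conn g Ψ (fun y ↦ conn g Ψ s y (ext v y)) x w - conn g Ψ s x (bracket (ext v) (ext w) x)

variable (Ψ : Π x : M, TangentSpace (𝓡 (p + q)) x →ₗ[ℝ] Module.End ℝ (T x))

/-- `s` is the lift of `σ` that defines the splitting operator `L_0` of `∇ + Ψ`. -/
def IsLift0 (σ : H0 T g) (s : C0 T) : Prop :=
  Pi0 T g s = σ ∧ conn g Ψ (s : Raw0 p q l M) ∈ Z1 T g

/-- `φ` is the lift of `τ` that defines the splitting operator `L_1` of `∇ + Ψ`. -/
def IsLift1 (τ : H1 T g) (φ : Z1 T g) : Prop :=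
  Pi1 T g φ = τ ∧ dOne g Ψ (φ : Raw1 p q l M) ∈ Z2 T g

/-- The BGG splitting operator `L_0 : H_0 → Z_0` of `∇ + Ψ`: the lift of `σ`. -/
def L0 (σ : H0 T g) : C0 T := Classical.epsilon (IsLift0 g Ψ σ)

/-- The BGG splitting operator `L_1 : H_1 → Z_1` of `∇ + Ψ`: the lift of `τ`. -/
def L1 (τ : H1 T g) : Z1 T g := Classical.epsilon (IsLift1 g Ψ τ)

open Classical in
/-- The first BGG operator `Θ_0 = Π_1 ∘ (∇ + Ψ) ∘ L_0 : H_0 → H_1` of `∇ + Ψ`. -/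
def Theta0 (σ : H0 T g) : H1 T g :=
  if h : conn g Ψ (L0 g Ψ σ : Raw0 p q l M) ∈ Z1 T g then Pi1 T g ⟨_, h⟩ else 0

/-- `(T, N, P, L)` is a geometric prolongation of `Θ : H_0 → H_1`: the maps `P` and `L` restrict to
inverse linear isomorphisms between the space of `N`-parallel sections of `T` and `ker Θ`. -/
def IsGeometricProlongation (N : Raw0 p q l M → Raw1 p q l M) (P : C0 T → H0 T g)
    (L : H0 T g → C0 T) (Θ : H0 T g → H1 T g) : Prop :=
  ∃ (par : Submodule ℝ (C0 T)) (sol : Submodule ℝ (H0 T g)) (e : par ≃ₗ[ℝ] sol),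
    (∀ s : C0 T, s ∈ par ↔ N (s : Raw0 p q l M) = 0) ∧ (∀ σ : H0 T g, σ ∈ sol ↔ Θ σ = 0) ∧
    (∀ s : par, (e s : H0 T g) = P s) ∧ ∀ σ : sol, (e.symm σ : C0 T) = L σ

end Bgg

end ConfTractor

set_option linter.unusedSectionVars false

/-! Existence and uniqueness of the splitting operators. Two lifts of the same class differ by some
`∂*ψ`, so both claims follow once `∂* ∘ d^∇̃` is bijective on the image of `∂*`. Let `∂` be the
algebraic (Kostant) differential built from the action of tangent vectors on tractors. It lowers the
filtration degree by one, `∂*` raises it by one, and `d^∇̃ - ∂` does not lower it. Thus `∂* d^∇̃ =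
∂*∂ + N`, where `∂*∂` preserves the filtration and `N` raises it. Degrees on `⊗^l S` lie between
`-l` and `l`, so if `∂*∂` has a filtration-preserving inverse on the image of `∂*`, a finite Neumann
series inverts the sum (`bijective_of_filtration`).

Inverting `∂*∂`. In an orthonormal adapted frame at a point, `∂*` is the adjoint of `∂` for the
Euclidean inner product of components, whatever the signature (`upMat_transpose`, `coordForm_act`).
Hence `∂*∂` is injective on the finite-dimensional image of `∂*`, and its minimal polynomial
exhibits the inverse as a polynomial in `∂*∂` (`exists_polynomial_of_adjoint`). That polynomial
depends only on `p`, `q`, `l`. It therefore acts on smooth sections, keeps values in `T`, and gives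
the inverse globally (`exists_polynomial_zero`, `exists_polynomial_one`).

All operators have to preserve smooth `T`-valued forms. For `T` this rests on
`IsTractorBundle.isInvariant`: an `SO(p+1,q+1)`-invariant subspace is invariant under skew
endomorphisms, hence under the actions of vectors and covectors, and under the connection, whose
matrix in an isometric frame is skew. Much of the file supplies the geometry behind this:
tensoriality, the Leibniz rule and smoothness for the Levi-Civita connection, its curvature and the
tractor connections.

The deformation. Since `Ψ s` lies in `B_1 ⊂ Z_1` (by `∂*∂* = 0`), the conditions `∂*(∇ s) = 0` and
`∂*(∇̃ s) = 0` agree, so `L_0` is unchanged; `∇̃ s` and `∇ s` differ by an element of `B_1`, so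
`Θ_0` is unchanged. Since `d^∇̃ ∇̃ s = R s`, the curvature hypothesis says that `∇̃ L_0 σ`, an
element of `Z_1` over `Θ_0 σ`, satisfies the condition that characterises `L̃_1 Θ_0 σ`. A parallel
section is trivially the lift of its own projection, and `Θ_0 σ = 0` forces `∇̃ L_0 σ = L̃_1 0 = 0`;
this is the prolongation statement. -/

namespace ConfTractor

/-! ## Linear algebra -/

section LinearAlgebra

open Polynomial

variable {E E' : Type*} [AddCommGroup E] [Module ℝ E] [AddCommGroup E'] [Module ℝ E']

/-- A polynomial in an endomorphism preserves the subspaces that the endomorphism preserves. -/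
theorem aeval_mem_of_forall_mem {A : Module.End ℝ E} {W : Submodule ℝ E}
    (hA : ∀ x ∈ W, A x ∈ W) (Q : ℝ[X]) : ∀ x ∈ W, aeval A Q x ∈ W := by
  induction Q using Polynomial.induction_on' with
  | add p q hp hq =>
    intro x hx
    simpa using W.add_mem (hp x hx) (hq x hx)
  | monomial n a =>
    intro x hx
    have : ∀ n : ℕ, (A ^ n) x ∈ W := by
      intro n
      induction n with
      | zero => simpa using hx
      | succ k ih => rw [pow_succ', Module.End.mul_apply]; exact hA _ ih
    simpa [aeval_monomial, Module.algebraMap_end_apply] using W.smul_mem a (this n)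

/-- Used for two maps `L`: the inclusion of `range del`, and the components at a point. Through the
latter a polynomial identity in finite dimension becomes an identity of sections. -/
theorem aeval_intertwine {A : Module.End ℝ E} {B : Module.End ℝ E'} (L : E →ₗ[ℝ] E')
    (h : ∀ x, L (A x) = B (L x)) (Q : ℝ[X]) (x : E) : L (aeval A Q x) = aeval B Q (L x) := by
  induction Q using Polynomial.induction_on' generalizing x with
  | add p q hp hq => simp [hp, hq]
  | monomial n a =>
    have : ∀ n : ℕ, L ((A ^ n) x) = (B ^ n) (L x) := by
      intro n
      induction n with
      | zero => simp
      | succ k ih => rw [pow_succ', Module.End.mul_apply, h, ih, pow_succ', Module.End.mul_apply]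
    simp [aeval_monomial, Module.algebraMap_end_apply, this]

/-- If `del ∘ bd` is invertible on the range of `del` by means of a polynomial, and `d` is a
perturbation of `bd` that is of higher order for a finite filtration, then `del ∘ d` is bijective
on the range of `del`. -/
theorem bijective_of_filtration (del : E' →ₗ[ℝ] E) (bd d : E →ₗ[ℝ] E') (Q : ℝ[X])
    (hQ : ∀ e, aeval (del ∘ₗ bd : Module.End ℝ E) Q (del (bd (del e))) = del e)
    (F : ℕ → Submodule ℝ E) (hF : F 0 = ⊤) (m : ℕ) (hm : F m = ⊥)
    (hstep : ∀ i, ∀ e ∈ F i, del (d e - bd e) ∈ F (i + 1))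
    (hbox : ∀ i, ∀ e ∈ F i, del (bd e) ∈ F i) :
    (∀ e, ∃ b, del (d (del b)) = del e) ∧ ∀ b, del (d (del b)) = 0 → del b = 0 := by
  set A : Module.End ℝ E := del ∘ₗ bd with hA
  set R : Module.End ℝ E := aeval A Q with hR
  set N : Module.End ℝ E := del ∘ₗ (d - bd) with hN
  have hRA : ∀ x, R (A x) = A (R x) := by
    intro x
    have : Commute R A := by
      have h := (Polynomial.commute_X Q).symm.map (aeval A (R := ℝ))
      simpa using h
    have := congrArg (fun f : Module.End ℝ E ↦ f x) this.eq
    simpa using this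
  have hRdel : ∀ e, R (del e) ∈ LinearMap.range del := fun e ↦
    aeval_mem_of_forall_mem (A := A) (W := LinearMap.range del)
      (fun x _ ↦ ⟨bd x, rfl⟩) Q _ ⟨e, rfl⟩
  have hRF : ∀ i, ∀ x ∈ F i, R x ∈ F i := fun i ↦ aeval_mem_of_forall_mem (hbox i) Q
  set K : Module.End ℝ E := -(R * N) with hK
  have hKF : ∀ i, ∀ x ∈ F i, K x ∈ F (i + 1) := fun i x hx ↦
    (F (i + 1)).neg_mem (hRF _ _ (hstep i x hx))
  have hKpow : ∀ x, (K ^ m) x = 0 := by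
    intro x
    have : ∀ k, (K ^ k) x ∈ F k := by
      intro k
      induction k with
      | zero => simp [hF]
      | succ k ih => rw [pow_succ', Module.End.mul_apply]; exact hKF _ _ ih
    simpa [hm] using this m
  have hd : ∀ x, del (d x) = A x + N x := fun x ↦ by simp [hA, hN]
  have hRAdel : ∀ e, R (A (del e)) = del e := hQ
  refine ⟨fun e ↦ ?_, fun b hb ↦ ?_⟩
  · set c := del e with hc
    set b := ∑ k ∈ Finset.range m, (K ^ k) (R c) with hb
    have hKrange : ∀ x ∈ LinearMap.range del, K x ∈ LinearMap.range del := by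
      intro x _
      exact (LinearMap.range del).neg_mem (hRdel _)
    have hpow : ∀ k : ℕ, (K ^ k) (R c) ∈ LinearMap.range del := by
      intro k
      induction k with
      | zero => simpa using hRdel e
      | succ k ih => rw [pow_succ', Module.End.mul_apply]; exact hKrange _ ih
    have hbr : b ∈ LinearMap.range del := Submodule.sum_mem _ fun k _ ↦ hpow k
    have hgeom : b - K b = R c := by
      have h1 : (1 - K) * ∑ k ∈ Finset.range m, K ^ k = 1 - K ^ m := mul_neg_geom_sum K m
      have := congrArg (fun f : Module.End ℝ E ↦ f (R c)) h1
      simpa [hb, LinearMap.sum_apply, hKpow] using this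
    obtain ⟨b', hb'⟩ := hbr
    refine ⟨b', ?_⟩
    -- Back from `b - K b = R c` by applying `A`: the operators `A` and `R` commute, so `A R` is the
    -- identity on `range del`, which contains `c` and `N b`.
    have h2 : A b + A (R (N b)) = A (R c) := by
      rw [← hgeom]
      simp [hK]
    have h3 : A (R c) = c := by rw [← hRA]; exact hRAdel e
    have h4 : A (R (N b)) = N b := by rw [← hRA]; exact hRAdel (d b - bd b)
    rw [hb', hd, ← h4, h2, h3]
  -- A solution of the homogeneous equation is a fixed point of the nilpotent operator `K`.
  · have h1 : del b = K (del b) := by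
      have : R (A (del b)) + R (N (del b)) = 0 := by rw [← map_add, ← hd, hb, map_zero]
      rw [hRAdel] at this
      rw [hK]
      simpa using eq_neg_of_add_eq_zero_left this
    have h2 : ∀ k, (K ^ k) (del b) = del b := by
      intro k
      induction k with
      | zero => simp
      | succ k ih => rw [pow_succ', Module.End.mul_apply, ih, ← h1]
    rw [← h2 m, hKpow]

/-- If `bd` is adjoint to `del` for definite forms, then `del ∘ bd` is invertible on the range of
`del`, by means of a polynomial. -/
theorem exists_polynomial_of_adjoint [FiniteDimensional ℝ E] (del : E' →ₗ[ℝ] E) (bd : E →ₗ[ℝ] E')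
    (B : E →ₗ[ℝ] E →ₗ[ℝ] ℝ) (B' : E' →ₗ[ℝ] E' →ₗ[ℝ] ℝ) (hB : ∀ e, B e e = 0 → e = 0)
    (hB' : ∀ e, B' e e = 0 → e = 0) (hadj : ∀ e' e, B (del e') e = B' e' (bd e)) :
    ∃ Q : ℝ[X], ∀ e, aeval (del ∘ₗ bd : Module.End ℝ E) Q (del (bd (del e))) = del e := by
  set A : Module.End ℝ E := del ∘ₗ bd with hA
  have hmaps : ∀ x ∈ LinearMap.range del, A x ∈ LinearMap.range del := fun x _ ↦ ⟨bd x, rfl⟩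
  set A' : Module.End ℝ (LinearMap.range del) := A.restrict hmaps with hA'
  -- If `del (bd (del e)) = 0`, then `B'` vanishes on the pair `(bd (del e), bd (del e))` by
  -- adjointness, so `bd (del e) = 0`; a second use of adjointness gives `B (del e) (del e) = 0`.
  have hinj : Function.Injective A' := by
    rw [injective_iff_map_eq_zero]
    rintro ⟨_, e, rfl⟩ h
    have h0 : del (bd (del e)) = 0 := congrArg Subtype.val h
    have h1 : bd (del e) = 0 := hB' _ (by rw [← hadj, h0]; simp)
    have h2 : del e = 0 := hB _ (by rw [hadj, h1]; simp)
    exact Subtype.ext h2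
  set p := minpoly ℝ A' with hp
  have hp0 : p.coeff 0 ≠ 0 := LinearMap.minpoly_coeff_zero_of_injective hinj
  -- Write `p = X * divX p + p(0)`. As `p(A') = 0` and `p(0) ≠ 0` by injectivity, the inverse of
  -- `A'` is `-p(0)⁻¹ (divX p)(A')`.
  refine ⟨C (-(p.coeff 0)⁻¹) * p.divX, fun e ↦ ?_⟩
  have h1 : aeval A' p = 0 := minpoly.aeval ℝ A'
  rw [← Polynomial.divX_mul_X_add p] at h1
  set y : LinearMap.range del := ⟨del e, e, rfl⟩ with hy
  have h2 : aeval A' p.divX (A' y) + p.coeff 0 • y = 0 := by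
    have := congrArg (fun f : Module.End ℝ (LinearMap.range del) ↦ f y) h1
    simpa [Module.algebraMap_end_apply] using this
  have h3 := aeval_intertwine (A := A') (B := A) (LinearMap.range del).subtype
    (fun x ↦ rfl) p.divX (A' y)
  have h4 : aeval A p.divX (A (del e)) = - (p.coeff 0 • del e) := by
    have := congrArg Subtype.val h2
    rw [eq_neg_iff_add_eq_zero]
    rw [Submodule.coe_add, Submodule.coe_smul] at this
    rw [show A (del e) = (LinearMap.range del).subtype (A' y) from rfl, ← h3]
    exact this
  change aeval A (C (-(p.coeff 0)⁻¹) * p.divX) (A (del e)) = del e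
  rw [map_mul, Module.End.mul_apply, h4, aeval_C, Module.algebraMap_end_apply, smul_neg,
    neg_smul, neg_neg, smul_smul, inv_mul_cancel₀ hp0, one_smul]

/-- The sum of copies of a bilinear form. -/
def formPi (ι : Type*) [Fintype ι] (B : E →ₗ[ℝ] E →ₗ[ℝ] ℝ) : (ι → E) →ₗ[ℝ] (ι → E) →ₗ[ℝ] ℝ :=
  ∑ i, B.compl₁₂ (LinearMap.proj i) (LinearMap.proj i)

theorem formPi_apply {ι : Type*} [Fintype ι] (B : E →ₗ[ℝ] E →ₗ[ℝ] ℝ) (x y : ι → E) :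
    formPi ι B x y = ∑ i, B (x i) (y i) := by
  simp [formPi, LinearMap.sum_apply]

/-- Positive definiteness of a bilinear form. -/
def IsPosDefForm (B : E →ₗ[ℝ] E →ₗ[ℝ] ℝ) : Prop := ∀ x, 0 ≤ B x x ∧ (B x x = 0 → x = 0)

theorem IsPosDefForm.pi {B : E →ₗ[ℝ] E →ₗ[ℝ] ℝ} (hB : IsPosDefForm B) (ι : Type*) [Fintype ι] :
    IsPosDefForm (formPi ι B) := by
  intro x
  rw [formPi_apply]
  refine ⟨Finset.sum_nonneg fun i _ ↦ (hB _).1, fun h ↦ funext fun i ↦ (hB _).2 ?_⟩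
  exact (Finset.sum_eq_zero_iff_of_nonneg fun i _ ↦ (hB (x i)).1).1 h i (Finset.mem_univ i)

end LinearAlgebra

/-! ## Tractor-valued forms in coordinates -/

section Coordinates

variable {n l : ℕ}

/-- Indices of an adapted basis of `ℝ ⊕ ℝ^n ⊕ ℝ`: `none` stands for `(1, 0, 0)` and `some none`
for `(0, 0, 1)`. -/
abbrev StdIdx (n : ℕ) : Type := Option (Option (Fin n))

/-- Coordinates of a tensor of degree `l`. -/
abbrev Coords (n l : ℕ) : Type := (Fin l → StdIdx n) → ℝ

/-- The matrix of the action of the `i`-th basis covector. -/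
def upMat (ε : Fin n → ℝ) (i : Fin n) : Matrix (StdIdx n) (StdIdx n) ℝ
  | none, some (some k) => if k = i then - ε i else 0
  | some (some k), some none => if k = i then 1 else 0
  | _, _ => 0

/-- The matrix of the action of the `i`-th basis vector. -/
def downMat (ε : Fin n → ℝ) (i : Fin n) : Matrix (StdIdx n) (StdIdx n) ℝ
  | some (some k), none => if k = i then 1 else 0
  | some none, some (some k) => if k = i then - ε i else 0
  | _, _ => 0

/-- The covector dual to `e_i` is `ε i` times `g(e_i, ·)`. This compensation of signs makes the
Euclidean form on components, rather than the indefinite tractor metric, the one for which covectors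
and vectors act adjointly. -/
theorem upMat_transpose {ε : Fin n → ℝ} (hε : ∀ i, ε i * ε i = 1) (i : Fin n) :
    ε i • (upMat ε i).transpose = - downMat ε i := by
  ext a b
  rcases a with _ | _ | a <;> rcases b with _ | _ | b <;> simp [upMat, downMat]
  all_goals split_ifs <;> simp [hε]

/-- The action of a matrix on tensors. -/
def coordAct (A : Matrix (StdIdx n) (StdIdx n) ℝ) : Coords n l →ₗ[ℝ] Coords n l where
  toFun c J := - ∑ j, ∑ b, A b (J j) * c (Function.update J j b)
  map_add' c d := by
    funext J
    simp only [Pi.add_apply, mul_add, Finset.sum_add_distrib, neg_add]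
  map_smul' r c := by
    funext J
    simp only [Pi.smul_apply, smul_eq_mul, RingHom.id_apply, Finset.mul_sum, mul_neg,
      mul_left_comm r]

theorem coordAct_smul (r : ℝ) (A : Matrix (StdIdx n) (StdIdx n) ℝ) (c : Coords n l) :
    coordAct (r • A) c = r • coordAct A c := by
  funext J
  simp [coordAct, Finset.mul_sum, mul_assoc, -Fintype.sum_option]

theorem coordAct_neg (A : Matrix (StdIdx n) (StdIdx n) ℝ) (c : Coords n l) :
    coordAct (-A) c = - coordAct A c := by
  funext J
  simp [coordAct, -Fintype.sum_option]

/-- The Euclidean inner product on coordinates. -/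
def coordForm (n l : ℕ) : Coords n l →ₗ[ℝ] Coords n l →ₗ[ℝ] ℝ :=
  formPi _ (LinearMap.mul ℝ ℝ)

theorem coordForm_posDef : IsPosDefForm (coordForm n l) :=
  IsPosDefForm.pi (fun x ↦ ⟨mul_self_nonneg x, fun h ↦ mul_self_eq_zero.1 h⟩) _

theorem coordForm_act (A : Matrix (StdIdx n) (StdIdx n) ℝ) (c d : Coords n l) :
    coordForm n l (coordAct A c) d = coordForm n l c (coordAct A.transpose d) := by
  simp only [coordForm, formPi_apply, LinearMap.mul_apply', coordAct, LinearMap.coe_mk,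
    AddHom.coe_mk, neg_mul, mul_neg, Finset.sum_neg_distrib, Finset.sum_mul, Finset.mul_sum,
    Matrix.transpose_apply]
  congr 1
  rw [Finset.sum_comm]
  conv_rhs => rw [Finset.sum_comm]
  refine Finset.sum_congr rfl fun j _ ↦ ?_
  rw [← Finset.sum_product', ← Finset.sum_product']
  -- Transposition exchanges the index in slot `j` with the summation index `b`; this exchange is an
  -- involution on pairs `(J, b)`.
  refine Finset.sum_nbij' (fun p ↦ (Function.update p.1 j p.2, p.1 j))
    (fun p ↦ (Function.update p.1 j p.2, p.1 j)) (by simp) (by simp) (by simp) (by simp) ?_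
  rintro ⟨J, b⟩ -
  simp
  ring

variable (ε : Fin n → ℝ)

/-- `∂^*` on one-forms, in coordinates. -/
def coordDel1 : (Fin n → Coords n l) →ₗ[ℝ] Coords n l :=
  - ∑ i, ε i • (coordAct (upMat ε i) ∘ₗ LinearMap.proj i)

theorem coordDel1_apply (φ : Fin n → Coords n l) :
    coordDel1 ε φ = - ∑ i, ε i • coordAct (upMat ε i) (φ i) := by
  simp [coordDel1, LinearMap.sum_apply]

/-- `∂` on tensors, in coordinates. -/
def coordBd0 : Coords n l →ₗ[ℝ] (Fin n → Coords n l) :=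
  LinearMap.pi fun i ↦ coordAct (downMat ε i)

/-- Two-forms in coordinates. -/
def coordAlt (n l : ℕ) : Submodule ℝ (Fin n → Fin n → Coords n l) where
  carrier := {φ | ∀ i k, φ i k = - φ k i}
  zero_mem' := by simp
  add_mem' ha hb i k := by
    simp only [Pi.add_apply] at *
    rw [ha i k, hb i k, neg_add]
  smul_mem' c _ ha i k := by
    simp only [Pi.smul_apply]
    rw [ha i k, smul_neg]

/-- `∂^*` on two-forms, in coordinates. -/
def coordDel2 : coordAlt n l →ₗ[ℝ] (Fin n → Coords n l) :=
  (LinearMap.pi fun k ↦ coordDel1 ε ∘ₗ LinearMap.pi fun i ↦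
    LinearMap.proj k ∘ₗ LinearMap.proj i) ∘ₗ (coordAlt n l).subtype

theorem coordDel2_apply (φ : coordAlt n l) (k : Fin n) :
    coordDel2 ε φ k = coordDel1 ε fun i ↦ (φ : Fin n → Fin n → Coords n l) i k := rfl

/-- `∂` on one-forms, in coordinates. -/
def coordBd1 : (Fin n → Coords n l) →ₗ[ℝ] coordAlt n l :=
  LinearMap.codRestrict _ (LinearMap.pi fun i ↦ LinearMap.pi fun k ↦
    coordAct (downMat ε i) ∘ₗ LinearMap.proj k - coordAct (downMat ε k) ∘ₗ LinearMap.proj i)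
    fun φ i k ↦ by simp

variable {ε}

/-- The sign in the definition of `∂*` cancels the one in `upMat_transpose`, so `∂*` and `∂` are
adjoint without a sign. -/
theorem coordForm_del1 (hε : ∀ i, ε i * ε i = 1) (φ : Fin n → Coords n l) (t : Coords n l) :
    coordForm n l (coordDel1 ε φ) t = formPi (Fin n) (coordForm n l) φ (coordBd0 ε t) := by
  rw [coordDel1_apply, formPi_apply]
  simp only [map_neg, map_sum, map_smul, LinearMap.neg_apply, LinearMap.sum_apply,
    LinearMap.smul_apply, coordForm_act]
  rw [← Finset.sum_neg_distrib]
  refine Finset.sum_congr rfl fun i _ ↦ ?_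
  rw [← map_smul, ← coordAct_smul, upMat_transpose hε, coordAct_neg, map_neg, neg_neg]
  rfl

/-- The polynomial is found on the whole tensor power, not on a fibre of `T`, so that it depends on
neither the point nor the bundle. -/
theorem exists_polynomial_coord0 (hε : ∀ i, ε i * ε i = 1) : ∃ Q : Polynomial ℝ,
    ∀ e : Fin n → Coords n l, Polynomial.aeval (coordDel1 ε ∘ₗ coordBd0 ε :
      Module.End ℝ (Coords n l)) Q (coordDel1 ε (coordBd0 ε (coordDel1 ε e))) = coordDel1 ε e :=
  exists_polynomial_of_adjoint _ _ (coordForm n l) (formPi (Fin n) (coordForm n l))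
    (fun e ↦ (coordForm_posDef e).2) (fun e ↦ (coordForm_posDef.pi _ e).2) (coordForm_del1 hε)

theorem exists_polynomial_coord1 (hε : ∀ i, ε i * ε i = 1) : ∃ Q : Polynomial ℝ,
    ∀ e : coordAlt n l, Polynomial.aeval (coordDel2 ε ∘ₗ coordBd1 ε :
      Module.End ℝ (Fin n → Coords n l)) Q (coordDel2 ε (coordBd1 ε (coordDel2 ε e)))
        = coordDel2 ε e := by
  refine exists_polynomial_of_adjoint _ _ (formPi (Fin n) (coordForm n l))
    -- The double sum counts each pair `{i, k}` twice; with the factor `1 / 2` the two terms of `∂`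
    -- together reproduce the form on one-forms.
    ((1 / 2 : ℝ) • (formPi (Fin n) (formPi (Fin n) (coordForm n l))).compl₁₂
      (coordAlt n l).subtype (coordAlt n l).subtype)
    (fun e ↦ (coordForm_posDef.pi _ e).2) (fun e he ↦ ?_) fun φ ψ ↦ ?_
  · refine Subtype.ext (((coordForm_posDef.pi _).pi _ _).2 ?_)
    simpa using he
  · have h1 : formPi (Fin n) (coordForm n l) (coordDel2 ε φ) ψ
        = ∑ k, ∑ i, coordForm n l ((φ : Fin n → Fin n → Coords n l) i k)
            (coordAct (downMat ε i) (ψ k)) := by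
      rw [formPi_apply]
      refine Finset.sum_congr rfl fun k _ ↦ ?_
      rw [coordDel2_apply, coordForm_del1 hε, formPi_apply]
      rfl
    have h2 : ((1 / 2 : ℝ) • (formPi (Fin n) (formPi (Fin n) (coordForm n l))).compl₁₂
        (coordAlt n l).subtype (coordAlt n l).subtype) φ (coordBd1 ε ψ)
        = 1 / 2 * ∑ i, ∑ k, coordForm n l ((φ : Fin n → Fin n → Coords n l) i k)
            (coordAct (downMat ε i) (ψ k) - coordAct (downMat ε k) (ψ i)) := by
      simp only [LinearMap.smul_apply, LinearMap.compl₁₂_apply, formPi_apply, smul_eq_mul]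
      rfl
    rw [h1, h2]
    simp only [map_sub, Finset.sum_sub_distrib]
    -- Antisymmetry of `φ` makes the second term of `∂` contribute the same as the first.
    have h3 : ∑ i, ∑ k, coordForm n l ((φ : Fin n → Fin n → Coords n l) i k)
          (coordAct (downMat ε k) (ψ i))
        = - ∑ k, ∑ i, coordForm n l ((φ : Fin n → Fin n → Coords n l) i k)
          (coordAct (downMat ε i) (ψ k)) := by
      rw [← Finset.sum_neg_distrib]
      refine Finset.sum_congr rfl fun i _ ↦ ?_
      rw [← Finset.sum_neg_distrib]
      refine Finset.sum_congr rfl fun k _ ↦ ?_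
      rw [φ.2 i k, map_neg, LinearMap.neg_apply]
    rw [h3, Finset.sum_comm]
    ring

end Coordinates

/-! ## Vector fields and local frames -/

section Frames

variable {p q : ℕ} {M : Type*} [TopologicalSpace M] [ChartedSpace (Model p q) M]

instance (x : M) : FiniteDimensional ℝ (TangentSpace (𝓡 (p + q)) x) :=
  inferInstanceAs (FiniteDimensional ℝ (Model p q))

/-- The coordinate vectors `bas x`, as a basis of the tangent space. -/
def basBasis (x : M) : Module.Basis (Fin (p + q)) ℝ (TangentSpace (𝓡 (p + q)) x) :=
  (EuclideanSpace.basisFun (Fin (p + q)) ℝ).toBasis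

theorem basBasis_apply (x : M) (i : Fin (p + q)) : basBasis x i = bas x i := by
  change (EuclideanSpace.basisFun (Fin (p + q)) ℝ).toBasis i = EuclideanSpace.single i (1 : ℝ)
  simp

theorem basBasis_repr (x : M) (v : TangentSpace (𝓡 (p + q)) x) (i : Fin (p + q)) :
    (basBasis x).repr v i = coord x v i := rfl

theorem coord_add (x : M) (v w : TangentSpace (𝓡 (p + q)) x) (i : Fin (p + q)) :
    coord x (v + w) i = coord x v i + coord x w i := rfl

theorem coord_smul (x : M) (c : ℝ) (v : TangentSpace (𝓡 (p + q)) x) (i : Fin (p + q)) :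
    coord x (c • v) i = c * coord x v i := rfl

theorem sum_coord (x : M) (v : TangentSpace (𝓡 (p + q)) x) : ∑ i, coord x v i • bas x i = v := by
  simp_rw [← basBasis_repr, ← basBasis_apply]
  exact (basBasis x).sum_repr v

variable [IsManifold (𝓡 (p + q)) ∞ M]

/-- The preferred trivialization of the tangent bundle at `x`. -/
abbrev triv (x : M) : Trivialization (Model p q)
    (TotalSpace.proj : TotalSpace (Model p q) (TangentSpace (𝓡 (p + q)) (M := M)) → M) :=
  trivializationAt (Model p q) (TangentSpace (𝓡 (p + q)) (M := M)) x

/-- The extension of tangent vectors at `x`, evaluated at `y`, as a linear map (for `y` near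
`x`). -/
def extL (x y : M) : TangentSpace (𝓡 (p + q)) x →ₗ[ℝ] TangentSpace (𝓡 (p + q)) y :=
  (triv x).symmₗ ℝ y ∘ₗ (triv x).linearMapAt ℝ x

theorem mem_triv_baseSet (x : M) : x ∈ (triv (p := p) (q := q) x).baseSet :=
  FiberBundle.mem_baseSet_trivializationAt' x

theorem eventually_mem_triv_baseSet {x y : M} (h : y ∈ (triv (p := p) (q := q) x).baseSet) :
    ∀ᶠ z in 𝓝 y, z ∈ (triv (p := p) (q := q) x).baseSet :=
  (triv x).open_baseSet.mem_nhds h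

theorem ext_apply_of_mem {x y : M} (hy : y ∈ (triv (p := p) (q := q) x).baseSet)
    (v : TangentSpace (𝓡 (p + q)) x) : ext v y = extL x y v := by
  rw [extL, LinearMap.comp_apply, Trivialization.coe_linearMapAt_of_mem _ (mem_triv_baseSet x),
    Trivialization.coe_symmₗ _ hy]
  rfl

theorem ext_eq_extL (x : M) : ∀ᶠ y in 𝓝 x, ∀ v : TangentSpace (𝓡 (p + q)) x,
    ext v y = extL x y v := by
  filter_upwards [eventually_mem_triv_baseSet (p := p) (q := q) (mem_triv_baseSet x)] with y hy v
  exact ext_apply_of_mem hy v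

@[simp] theorem ext_self {x : M} (v : TangentSpace (𝓡 (p + q)) x) : ext v x = v :=
  FiberBundle.extend_apply_self (Model p q) v

/-- The inverse of the extension of tangent vectors at `x`: the vector at `x` whose extension has
the value `w` at `y`. -/
def ret (x y : M) : TangentSpace (𝓡 (p + q)) y →ₗ[ℝ] TangentSpace (𝓡 (p + q)) x :=
  (triv x).symmₗ ℝ x ∘ₗ (triv x).linearMapAt ℝ y

theorem ext_ret (x : M) : ∀ᶠ y in 𝓝 x, ∀ w : TangentSpace (𝓡 (p + q)) y,
    ext (ret x y w) y = w := by
  filter_upwards [eventually_mem_triv_baseSet (p := p) (q := q) (mem_triv_baseSet x)] with y hy w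
  rw [ext_apply_of_mem hy, extL, ret, LinearMap.comp_apply, LinearMap.comp_apply,
    Trivialization.linearMapAt_symmₗ _ (mem_triv_baseSet x),
    Trivialization.symmₗ_linearMapAt _ hy]

theorem ret_self (x : M) (v : TangentSpace (𝓡 (p + q)) x) : ret x x v = v := by
  rw [ret, LinearMap.comp_apply, Trivialization.symmₗ_linearMapAt _ (mem_triv_baseSet x)]

/-! ### Smoothness on a whole neighbourhood, which smoothness of order `∞` at a point does not give
-/

/-- Smoothness of a function near a point. -/
def FunNear (f : M → ℝ) (x : M) : Prop := ∀ᶠ y in 𝓝 x, ContMDiffAt (𝓡 (p + q)) 𝓘(ℝ, ℝ) ∞ f y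

/-- Smoothness of a vector field near a point. -/
def VecNear (X : Π y : M, TangentSpace (𝓡 (p + q)) y) (x : M) : Prop :=
  ∀ᶠ y in 𝓝 x, VecSmoothAt X y

theorem FunNear.self {f : M → ℝ} {x : M} (h : FunNear (p := p) (q := q) f x) :
    ContMDiffAt (𝓡 (p + q)) 𝓘(ℝ, ℝ) ∞ f x := h.self_of_nhds

theorem VecNear.self {X : Π y : M, TangentSpace (𝓡 (p + q)) y} {x : M} (h : VecNear X x) :
    VecSmoothAt X x := h.self_of_nhds

theorem VecSmoothAt.mdiff {X : Π y : M, TangentSpace (𝓡 (p + q)) y} {x : M}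
    (h : VecSmoothAt X x) : MDifferentiableAt (𝓡 (p + q)) (𝓡 (p + q)).tangent
      (fun y ↦ (⟨y, X y⟩ : TangentBundle (𝓡 (p + q)) M)) x :=
  ContMDiffAt.mdifferentiableAt h (by simp)

theorem VecSmoothAt.congr {X Y : Π y : M, TangentSpace (𝓡 (p + q)) y} {x : M}
    (h : VecSmoothAt X x) (hXY : ∀ᶠ y in 𝓝 x, Y y = X y) : VecSmoothAt Y x :=
  ContMDiffAt.congr_of_eventuallyEq h (hXY.mono fun y hy ↦ by simp only [hy])

theorem VecNear.congr {X Y : Π y : M, TangentSpace (𝓡 (p + q)) y} {x : M}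
    (h : VecNear X x) (hXY : ∀ᶠ y in 𝓝 x, Y y = X y) : VecNear Y x := by
  filter_upwards [h, hXY.eventually_nhds] with y h1 h2 using h1.congr h2

theorem FunNear.congr {f f' : M → ℝ} {x : M} (h : FunNear (p := p) (q := q) f x)
    (hf : ∀ᶠ y in 𝓝 x, f' y = f y) : FunNear (p := p) (q := q) f' x := by
  filter_upwards [h, hf.eventually_nhds] with y h1 h2 using h1.congr_of_eventuallyEq h2

theorem VecSmoothAt.add {X Y : Π y : M, TangentSpace (𝓡 (p + q)) y} {x : M}
    (hX : VecSmoothAt X x) (hY : VecSmoothAt Y x) : VecSmoothAt (X + Y) x :=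
  ContMDiffAt.add_section hX hY

theorem VecSmoothAt.zero (x : M) :
    VecSmoothAt (0 : Π y : M, TangentSpace (𝓡 (p + q)) y) x :=
  (contMDiff_zeroSection ℝ (TangentSpace (𝓡 (p + q)) (M := M))) x

theorem VecSmoothAt.smul {f : M → ℝ} {X : Π y : M, TangentSpace (𝓡 (p + q)) y} {x : M}
    (hf : ContMDiffAt (𝓡 (p + q)) 𝓘(ℝ, ℝ) ∞ f x) (hX : VecSmoothAt X x) :
    VecSmoothAt (f • X) x :=
  ContMDiffAt.smul_section hf hX

theorem VecSmoothAt.sum {ι : Type*} {s : Finset ι}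
    {X : ι → Π y : M, TangentSpace (𝓡 (p + q)) y} {x : M}
    (hX : ∀ i ∈ s, VecSmoothAt (X i) x) : VecSmoothAt (fun y ↦ ∑ i ∈ s, X i y) x :=
  ContMDiffAt.sum_section hX

theorem VecNear.add {X Y : Π y : M, TangentSpace (𝓡 (p + q)) y} {x : M}
    (hX : VecNear X x) (hY : VecNear Y x) : VecNear (X + Y) x := by
  filter_upwards [hX, hY] with y h1 h2 using h1.add h2

theorem VecNear.smul {f : M → ℝ} {X : Π y : M, TangentSpace (𝓡 (p + q)) y} {x : M}
    (hf : FunNear (p := p) (q := q) f x) (hX : VecNear X x) : VecNear (f • X) x := by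
  filter_upwards [hf, hX] with y h1 h2 using h2.smul h1

theorem VecNear.sum {ι : Type*} {s : Finset ι}
    {X : ι → Π y : M, TangentSpace (𝓡 (p + q)) y} {x : M}
    (hX : ∀ i ∈ s, VecNear (X i) x) : VecNear (fun y ↦ ∑ i ∈ s, X i y) x := by
  have : ∀ᶠ y in 𝓝 x, ∀ i ∈ s, VecSmoothAt (X i) y := (Filter.eventually_all_finset s).2 hX
  filter_upwards [this] with y hy using VecSmoothAt.sum hy

theorem vecSmoothAt_ext {x : M} (v : TangentSpace (𝓡 (p + q)) x) : VecSmoothAt (ext v) x :=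
  FiberBundle.contMDiffAt_extend (𝓡 (p + q)) (Model p q) v

theorem vecNear_ext {x : M} (v : TangentSpace (𝓡 (p + q)) x) : VecNear (ext v) x := by
  filter_upwards [eventually_mem_triv_baseSet (p := p) (q := q) (mem_triv_baseSet x)] with y hy
  refine ((triv x).contMDiffAt_section_iff (IB := 𝓡 (p + q)) (n := ∞) hy).2 ?_
  refine (contMDiffAt_const (c := (triv x).linearMapAt ℝ x v)).congr_of_eventuallyEq ?_
  filter_upwards [eventually_mem_triv_baseSet hy] with z hz
  have := (triv x).linearMapAt_symmₗ (R := ℝ) hz ((triv x).linearMapAt ℝ x v)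
  rw [Trivialization.coe_linearMapAt_of_mem _ hz] at this
  rw [ext_apply_of_mem hz]
  exact this

theorem isManifold_add_one : IsManifold (𝓡 (p + q)) (∞ + 1) M := by
  simpa using (inferInstance : IsManifold (𝓡 (p + q)) ∞ M)

theorem isManifold_minSmoothness : IsManifold (𝓡 (p + q)) (minSmoothness ℝ 2) M := by
  simpa using (inferInstance : IsManifold (𝓡 (p + q)) 2 M)

theorem VecSmoothAt.bracket {X Y : Π y : M, TangentSpace (𝓡 (p + q)) y} {x : M}
    (hX : VecSmoothAt X x) (hY : VecSmoothAt Y x) : VecSmoothAt (bracket X Y) x := by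
  have := isManifold_add_one (p := p) (q := q) (M := M)
  have := isManifold_minSmoothness (p := p) (q := q) (M := M)
  exact ContMDiffAt.mlieBracket_vectorField (n := ⊤) (m := ⊤) hX hY (by simp)

theorem VecNear.bracket {X Y : Π y : M, TangentSpace (𝓡 (p + q)) y} {x : M}
    (hX : VecNear X x) (hY : VecNear Y x) : VecNear (bracket X Y) x := by
  filter_upwards [hX, hY] with y h1 h2 using h1.bracket h2

/-- The coefficients of a vector field in the frame `ext (bas x i)`. -/
def cf (x : M) (i : Fin (p + q)) (X : Π y : M, TangentSpace (𝓡 (p + q)) y) (y : M) : ℝ :=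
  coord x (ret x y (X y)) i

theorem sum_cf (x : M) : ∀ᶠ y in 𝓝 x, ∀ X : Π y : M, TangentSpace (𝓡 (p + q)) y,
    ∑ i, cf x i X y • ext (bas x i) y = X y := by
  filter_upwards [ext_ret (p := p) (q := q) x, ext_eq_extL (p := p) (q := q) x] with y hy h2 X
  conv_rhs => rw [← hy (X y), ← sum_coord x (ret x y (X y))]
  simp only [h2, map_sum, map_smul]
  rfl

theorem contMDiffAt_cf (x : M) (i : Fin (p + q)) : ∀ᶠ y in 𝓝 x,
    ∀ X : Π y : M, TangentSpace (𝓡 (p + q)) y, VecSmoothAt X y →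
      ContMDiffAt (𝓡 (p + q)) 𝓘(ℝ, ℝ) ∞ (cf x i X) y := by
  filter_upwards [eventually_mem_triv_baseSet (p := p) (q := q) (mem_triv_baseSet x)] with y hy X hX
  have h1 := ((triv x).contMDiffAt_section_iff (IB := 𝓡 (p + q)) (n := ∞) hy).1 hX
  let c : Model p q →ₗ[ℝ] ℝ := (EuclideanSpace.basisFun (Fin (p + q)) ℝ).toBasis.coord i ∘ₗ
    (show Model p q →ₗ[ℝ] Model p q from (triv x).symmₗ ℝ x)
  have h2 : ContMDiffAt 𝓘(ℝ, Model p q) 𝓘(ℝ, ℝ) ∞ c ((triv x) ⟨y, X y⟩).2 :=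
    (LinearMap.toContinuousLinearMap c).contMDiff.contMDiffAt
  refine (h2.comp y h1).congr_of_eventuallyEq ?_
  filter_upwards [eventually_mem_triv_baseSet hy] with z hz
  simp only [cf, ret, LinearMap.comp_apply, Function.comp_apply]
  rw [Trivialization.coe_linearMapAt_of_mem _ hz]
  rfl

theorem FunNear.cf {x : M} {X : Π y : M, TangentSpace (𝓡 (p + q)) y} (hX : VecNear X x)
    (i : Fin (p + q)) : FunNear (p := p) (q := q) (cf x i X) x := by
  filter_upwards [hX, contMDiffAt_cf (p := p) (q := q) x i] with y h1 h2 using h2 X h1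

theorem cf_self (x : M) (i : Fin (p + q)) (X : Π y : M, TangentSpace (𝓡 (p + q)) y) :
    cf x i X x = coord x (X x) i := by
  rw [cf, ret_self]

/-- The tensoriality criterion, for fields that are smooth near a point. -/
theorem tensorial {A : Type*} [AddCommGroup A] [Module ℝ A] {x : M}
    (Φ : (Π y : M, TangentSpace (𝓡 (p + q)) y) → A)
    (hadd : ∀ X Y, VecNear X x → VecNear Y x → Φ (X + Y) = Φ X + Φ Y)
    (hsmul : ∀ (f : M → ℝ) X, FunNear (p := p) (q := q) f x → VecNear X x →
      Φ (f • X) = f x • Φ X)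
    (hcongr : ∀ X Y, VecNear X x → (∀ᶠ y in 𝓝 x, Y y = X y) → Φ Y = Φ X)
    {X : Π y : M, TangentSpace (𝓡 (p + q)) y} (hX : VecNear X x) : Φ X = Φ (ext (X x)) := by
  -- The expansion in the frame `ext (bas x i)` sees the coefficients of `X` only through their
  -- values at `x`, which `X` and `ext (X x)` share.
  have key : ∀ X, VecNear X x → Φ X = ∑ i, coord x (X x) i • Φ (ext (bas x i)) := by
    intro X hX
    have hs : ∀ s : Finset (Fin (p + q)),
        Φ (fun y ↦ ∑ i ∈ s, (cf x i X • ext (bas x i)) y)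
          = ∑ i ∈ s, coord x (X x) i • Φ (ext (bas x i)) := by
      intro s
      induction s using Finset.induction_on with
      | empty =>
        -- That `Φ` kills the zero field is obtained from homogeneity with the zero function.
        have h0 := hsmul (fun _ ↦ 0) (ext (0 : TangentSpace (𝓡 (p + q)) x))
          (Eventually.of_forall fun _ ↦ contMDiffAt_const) (vecNear_ext 0)
        simp only [zero_smul] at h0
        simp only [Finset.sum_empty]
        rw [← h0]
        congr 1
        funext y
        simp
      | insert i s hi ih =>
        rw [Finset.sum_insert hi, ← ih, ← cf_self, ← hsmul _ _ (FunNear.cf hX i) (vecNear_ext _),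
          ← hadd]
        · congr 1
          funext y
          rw [Finset.sum_insert hi]
          rfl
        · exact (vecNear_ext _).smul (FunNear.cf hX i)
        · exact VecNear.sum fun j _ ↦ (vecNear_ext _).smul (FunNear.cf hX j)
    rw [← hs]
    refine (hcongr _ _ hX ?_).symm
    filter_upwards [sum_cf (p := p) (q := q) x] with y hy using hy X
  rw [key X hX, key _ (vecNear_ext _), ext_self]

/-! ## Directional derivatives -/

theorem dd_congr {f f' : M → ℝ} {x : M} (h : ∀ᶠ y in 𝓝 x, f' y = f y)
    (v : TangentSpace (𝓡 (p + q)) x) : dd f' x v = dd f x v := by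
  rw [dd, dd, mvfderiv, mvfderiv, Filter.EventuallyEq.mfderiv_eq h]
  rfl

theorem dd_const (c : ℝ) (x : M) (v : TangentSpace (𝓡 (p + q)) x) :
    dd (fun _ ↦ c) x v = 0 := by
  rw [dd, mvfderiv_const]; rfl

theorem dd_add_vec (f : M → ℝ) (x : M) (v w : TangentSpace (𝓡 (p + q)) x) :
    dd f x (v + w) = dd f x v + dd f x w := map_add _ _ _

theorem dd_smul_vec (f : M → ℝ) (x : M) (c : ℝ) (v : TangentSpace (𝓡 (p + q)) x) :
    dd f x (c • v) = c * dd f x v := map_smul _ _ _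

theorem dd_add {f f' : M → ℝ} {x : M} (hf : ContMDiffAt (𝓡 (p + q)) 𝓘(ℝ, ℝ) ∞ f x)
    (hf' : ContMDiffAt (𝓡 (p + q)) 𝓘(ℝ, ℝ) ∞ f' x) (v : TangentSpace (𝓡 (p + q)) x) :
    dd (fun y ↦ f y + f' y) x v = dd f x v + dd f' x v := by
  have := mvfderiv_add (hf.mdifferentiableAt (by simp)) (hf'.mdifferentiableAt (by simp))
  exact congrArg (fun L ↦ L v) this

theorem dd_mul {f f' : M → ℝ} {x : M} (hf : ContMDiffAt (𝓡 (p + q)) 𝓘(ℝ, ℝ) ∞ f x)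
    (hf' : ContMDiffAt (𝓡 (p + q)) 𝓘(ℝ, ℝ) ∞ f' x) (v : TangentSpace (𝓡 (p + q)) x) :
    dd (fun y ↦ f y * f' y) x v = f x * dd f' x v + dd f x v * f' x := by
  have := mvfderiv_mul (hf.mdifferentiableAt (by simp)) (hf'.mdifferentiableAt (by simp))
  have h2 := congrArg (fun L ↦ L v) this
  refine h2.trans ?_
  change f x * dd f' x v + f' x * dd f x v = _
  ring

theorem dd_sum {ι : Type*} {s : Finset ι} {f : ι → M → ℝ} {x : M}
    (hf : ∀ i ∈ s, ContMDiffAt (𝓡 (p + q)) 𝓘(ℝ, ℝ) ∞ (f i) x)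
    (v : TangentSpace (𝓡 (p + q)) x) :
    dd (fun y ↦ ∑ i ∈ s, f i y) x v = ∑ i ∈ s, dd (f i) x v := by
  classical
  induction s using Finset.induction_on with
  | empty => simp [dd_const]
  | insert i s hi ih =>
    have h1 : ContMDiffAt (𝓡 (p + q)) 𝓘(ℝ, ℝ) ∞ (fun y ↦ ∑ j ∈ s, f j y) x :=
      ContMDiffAt.sum fun j hj ↦ hf j (Finset.mem_insert_of_mem hj)
    simp only [Finset.sum_insert hi]
    rw [dd_add (hf i (Finset.mem_insert_self i s)) h1,
      ih fun j hj ↦ hf j (Finset.mem_insert_of_mem hj)]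

theorem dd_const_mul (c : ℝ) {f : M → ℝ} {x : M} (hf : ContMDiffAt (𝓡 (p + q)) 𝓘(ℝ, ℝ) ∞ f x)
    (v : TangentSpace (𝓡 (p + q)) x) : dd (fun y ↦ c * f y) x v = c * dd f x v := by
  rw [dd_mul contMDiffAt_const hf, dd_const, zero_mul, add_zero]

theorem contMDiffAt_dd {f : M → ℝ} {X : Π y : M, TangentSpace (𝓡 (p + q)) y} {x : M}
    (hf : ContMDiffAt (𝓡 (p + q)) 𝓘(ℝ, ℝ) ∞ f x) (hX : VecSmoothAt X x) :
    ContMDiffAt (𝓡 (p + q)) 𝓘(ℝ, ℝ) ∞ (fun y ↦ dd f y (X y)) x := by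
  have h1 : ContMDiffAt (𝓡 (p + q)) 𝓘(ℝ, ℝ).tangent ∞
      (fun y ↦ (⟨f y, mfderiv (𝓡 (p + q)) 𝓘(ℝ, ℝ) f y (X y)⟩ : TangentBundle 𝓘(ℝ, ℝ) ℝ)) x :=
    ContMDiffAt.clm_apply_of_inCoordinates (hf.mfderiv_const (m := ∞) (by simp)) hX hf
  exact (contMDiff_snd_tangentBundle_modelSpace ℝ 𝓘(ℝ, ℝ)).contMDiffAt.comp x h1

theorem FunNear.dd {f : M → ℝ} {X : Π y : M, TangentSpace (𝓡 (p + q)) y} {x : M}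
    (hf : FunNear (p := p) (q := q) f x) (hX : VecNear X x) :
    FunNear (p := p) (q := q) (fun y ↦ dd f y (X y)) x := by
  filter_upwards [hf, hX] with y h1 h2 using contMDiffAt_dd h1 h2

theorem bracket_add_left {X Y Z : Π y : M, TangentSpace (𝓡 (p + q)) y} {x : M}
    (hX : VecSmoothAt X x) (hY : VecSmoothAt Y x) :
    bracket (X + Y) Z x = bracket X Z x + bracket Y Z x :=
  VectorField.mlieBracket_add_left hX.mdiff hY.mdiff

theorem bracket_add_right {X Y Z : Π y : M, TangentSpace (𝓡 (p + q)) y} {x : M}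
    (hX : VecSmoothAt X x) (hY : VecSmoothAt Y x) :
    bracket Z (X + Y) x = bracket Z X x + bracket Z Y x :=
  VectorField.mlieBracket_add_right hX.mdiff hY.mdiff

theorem bracket_smul_left {f : M → ℝ} {X Z : Π y : M, TangentSpace (𝓡 (p + q)) y} {x : M}
    (hf : ContMDiffAt (𝓡 (p + q)) 𝓘(ℝ, ℝ) ∞ f x) (hX : VecSmoothAt X x) :
    bracket (f • X) Z x = - dd f x (Z x) • X x + f x • bracket X Z x :=
  VectorField.mlieBracket_smul_left (hf.mdifferentiableAt (by simp)) hX.mdiff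

theorem bracket_smul_right {f : M → ℝ} {X Z : Π y : M, TangentSpace (𝓡 (p + q)) y} {x : M}
    (hf : ContMDiffAt (𝓡 (p + q)) 𝓘(ℝ, ℝ) ∞ f x) (hX : VecSmoothAt X x) :
    bracket Z (f • X) x = dd f x (Z x) • X x + f x • bracket Z X x :=
  VectorField.mlieBracket_smul_right (hf.mdifferentiableAt (by simp)) hX.mdiff

theorem bracket_congr {X X' Y Y' : Π y : M, TangentSpace (𝓡 (p + q)) y} {x : M}
    (hX : ∀ᶠ y in 𝓝 x, X' y = X y) (hY : ∀ᶠ y in 𝓝 x, Y' y = Y y) :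
    bracket X' Y' x = bracket X Y x :=
  Filter.EventuallyEq.mlieBracket_vectorField_eq hX hY

theorem bracket_swap (X Y : Π y : M, TangentSpace (𝓡 (p + q)) y) (x : M) :
    bracket X Y x = - bracket Y X x := VectorField.mlieBracket_swap_apply

end Frames

/-! ## The metric -/

section MetricAlgebra

variable {p q : ℕ} {M : Type*} [TopologicalSpace M] [ChartedSpace (Model p q) M]
  [IsManifold (𝓡 (p + q)) ∞ M] (g : Metric p q M)

theorem sign_mul_self (i : Fin (p + q)) : sign p q i * sign p q i = 1 := by
  unfold sign
  split_ifs <;> norm_num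

theorem sign_ne_zero (i : Fin (p + q)) : sign p q i ≠ 0 := by
  unfold sign
  split_ifs <;> norm_num

namespace Metric

/-- Pairing a linear relation with each `e i` isolates its coefficient, because the diagonal entries
are nonzero; the dimension count does the rest. -/
theorem exists_orthonormal (x : M) :
    ∃ e : Module.Basis (Fin (p + q)) ℝ (TangentSpace (𝓡 (p + q)) x),
      ∀ i j, g.inner x (e i) (e j) = if i = j then sign p q i else 0 := by
  obtain ⟨e, he⟩ := g.signature x
  have hli : LinearIndependent ℝ e := by
    rw [Fintype.linearIndependent_iff]
    intro c hc i
    have h1 : g.inner x (∑ j, c j • e j) (e i) = 0 := by rw [hc]; simp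
    simp only [map_sum, map_smul, sum_apply, smul_apply,
      he, smul_eq_mul, mul_ite, mul_zero, Finset.sum_ite_eq', Finset.mem_univ, if_true] at h1
    exact (mul_eq_zero.1 h1).resolve_right (sign_ne_zero i)
  have hcard : Fintype.card (Fin (p + q)) = Module.finrank ℝ (TangentSpace (𝓡 (p + q)) x) := by
    rw [Module.finrank_eq_card_basis (basBasis x)]
  refine ⟨basisOfLinearIndependentOfCardEqFinrank' e hli hcard, ?_⟩
  simpa using he

theorem eq_zero_of_inner {x : M} {v : TangentSpace (𝓡 (p + q)) x}
    (h : ∀ w, g.inner x v w = 0) : v = 0 := by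
  obtain ⟨e, he⟩ := g.exists_orthonormal x
  rw [← e.sum_repr v] at h ⊢
  refine Finset.sum_eq_zero fun i _ ↦ ?_
  have h1 := h (e i)
  simp only [map_sum, map_smul, sum_apply, smul_apply,
    he, smul_eq_mul, mul_ite, mul_zero, Finset.sum_ite_eq', Finset.mem_univ, if_true] at h1
  rw [(mul_eq_zero.1 h1).resolve_right (sign_ne_zero i), zero_smul]

theorem eq_of_inner {x : M} {v v' : TangentSpace (𝓡 (p + q)) x}
    (h : ∀ w, g.inner x v w = g.inner x v' w) : v = v' := by
  rw [← sub_eq_zero]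
  exact g.eq_zero_of_inner fun w ↦ by simp [h w]

theorem eq_of_inner_basis {x : M} {v v' : TangentSpace (𝓡 (p + q)) x}
    (e : Module.Basis (Fin (p + q)) ℝ (TangentSpace (𝓡 (p + q)) x))
    (h : ∀ i, g.inner x v (e i) = g.inner x v' (e i)) : v = v' := by
  refine g.eq_of_inner fun w ↦ ?_
  rw [← e.sum_repr w]
  simp only [map_sum, map_smul, h]

/-- The matrix of inner products of a family of tangent vectors. -/
def gram {x : M} (e : Fin (p + q) → TangentSpace (𝓡 (p + q)) x) :
    Matrix (Fin (p + q)) (Fin (p + q)) ℝ :=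
  Matrix.of fun i j ↦ g.inner x (e i) (e j)

variable {g} in
theorem gram_transpose {x : M} (e : Fin (p + q) → TangentSpace (𝓡 (p + q)) x) :
    (g.gram e).transpose = g.gram e := by
  ext i j
  exact g.symm x _ _

theorem gram_inv_symm {x : M} (e : Fin (p + q) → TangentSpace (𝓡 (p + q)) x)
    (i j : Fin (p + q)) : (g.gram e)⁻¹ i j = (g.gram e)⁻¹ j i := by
  conv_lhs => rw [← gram_transpose, ← Matrix.transpose_nonsing_inv]
  rfl

theorem gram_det {x : M} (e : Module.Basis (Fin (p + q)) ℝ (TangentSpace (𝓡 (p + q)) x)) :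
    IsUnit (g.gram e).det := by
  rw [isUnit_iff_ne_zero]
  intro h
  obtain ⟨c, hc, h⟩ := Matrix.exists_mulVec_eq_zero_iff.2 h
  have h1 : ∑ j, c j • e j = 0 := by
    refine g.eq_of_inner_basis e fun i ↦ ?_
    have h2 := congrFun h i
    simp only [Matrix.mulVec, dotProduct, gram, Matrix.of_apply, Pi.zero_apply] at h2
    rw [map_zero, zero_apply, ← h2]
    simp only [map_sum, map_smul, sum_apply, smul_apply,
      smul_eq_mul]
    exact Finset.sum_congr rfl fun j _ ↦ by rw [g.symm, mul_comm]
  exact hc (funext fun i ↦ Fintype.linearIndependent_iff.1 e.linearIndependent c h1 i)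

/-- Index raising: `g^{ij} a_i e_j` is the vector dual to the covector with components `a`. Both
`lc` and `schoutenUp` are defined by such a sum. -/
theorem sum_gram_inv {x : M} (e : Module.Basis (Fin (p + q)) ℝ (TangentSpace (𝓡 (p + q)) x))
    (a : Fin (p + q) → ℝ) (k : Fin (p + q)) :
    g.inner x (∑ i, ∑ j, ((g.gram e)⁻¹ i j * a i) • e j) (e k) = a k := by
  have h : (g.gram e)⁻¹ * g.gram e = 1 := Matrix.nonsing_inv_mul _ (g.gram_det e)
  simp only [map_sum, map_smul, sum_apply, smul_apply,
    smul_eq_mul]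
  have h1 : ∀ i, ∑ j, (g.gram e)⁻¹ i j * a i * g.inner x (e j) (e k)
      = a i * (1 : Matrix (Fin (p + q)) (Fin (p + q)) ℝ) i k := by
    intro i
    rw [← h, Matrix.mul_apply, Finset.mul_sum]
    refine Finset.sum_congr rfl fun j _ ↦ ?_
    simp only [gram, Matrix.of_apply]
    ring
  simp [h1, Matrix.one_apply]

theorem sum_gram_inv_self {x : M}
    (e : Module.Basis (Fin (p + q)) ℝ (TangentSpace (𝓡 (p + q)) x))
    (w : TangentSpace (𝓡 (p + q)) x) :
    ∑ i, ∑ j, ((g.gram e)⁻¹ i j * g.inner x w (e i)) • e j = w :=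
  g.eq_of_inner_basis e fun k ↦ g.sum_gram_inv e _ k

/-- The trace of a bilinear map with respect to the metric can be computed in any basis. -/
theorem sum_gram_inv_bilin {x : M} {W : Type*} [AddCommGroup W] [Module ℝ W]
    (B : TangentSpace (𝓡 (p + q)) x →ₗ[ℝ] TangentSpace (𝓡 (p + q)) x →ₗ[ℝ] W)
    (e e' : Module.Basis (Fin (p + q)) ℝ (TangentSpace (𝓡 (p + q)) x)) :
    ∑ i, ∑ j, (g.gram e)⁻¹ i j • B (e i) (e j)
      = ∑ i, ∑ j, (g.gram e')⁻¹ i j • B (e' i) (e' j) := by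
  -- Both traces are brought to one fourfold sum, by expanding `e' j` in the basis `e` here and `e
  -- k` in the basis `e'` at the end.
  have h1 : ∀ i j, (g.gram e')⁻¹ i j • B (e' i) (e' j)
      = ∑ k, ∑ m, (g.gram e)⁻¹ k m •
        (((g.gram e')⁻¹ j i * g.inner x (e k) (e' j)) • B (e' i) (e m)) := by
    intro i j
    conv_lhs => rw [← g.sum_gram_inv_self e (e' j)]
    simp only [map_sum, map_smul, Finset.smul_sum, smul_smul]
    refine Finset.sum_congr rfl fun k _ ↦ Finset.sum_congr rfl fun m _ ↦ ?_
    rw [g.symm x (e' j), g.gram_inv_symm e' i j]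
    congr 1
    ring
  simp only [h1]
  conv_rhs =>
    rw [Finset.sum_congr rfl fun i _ ↦ Finset.sum_comm]
    rw [Finset.sum_comm]
  refine Finset.sum_congr rfl fun k _ ↦ ?_
  conv_rhs =>
    rw [Finset.sum_congr rfl fun i _ ↦ Finset.sum_comm]
    rw [Finset.sum_comm]
  refine Finset.sum_congr rfl fun m _ ↦ ?_
  conv_lhs => rw [← g.sum_gram_inv_self e' (e k)]
  simp only [map_sum, map_smul, LinearMap.sum_apply, LinearMap.smul_apply, Finset.smul_sum]
  rw [Finset.sum_comm]

theorem gram_of_orthonormal {x : M}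
    {e : Module.Basis (Fin (p + q)) ℝ (TangentSpace (𝓡 (p + q)) x)}
    (he : ∀ i j, g.inner x (e i) (e j) = if i = j then sign p q i else 0) :
    (g.gram e)⁻¹ = Matrix.diagonal (sign p q) := by
  have h : g.gram e = Matrix.diagonal (sign p q) := by
    ext i j
    simp only [gram, Matrix.of_apply, he, Matrix.diagonal_apply]
  rw [h]
  refine Matrix.inv_eq_left_inv ?_
  rw [Matrix.diagonal_mul_diagonal]
  simp [sign_mul_self]

end Metric

end MetricAlgebra

/-! ## Smoothness of the metric -/

section MetricSmooth

variable {p q : ℕ} {M : Type*} [TopologicalSpace M] [ChartedSpace (Model p q) M]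
  [IsManifold (𝓡 (p + q)) ∞ M] (g : Metric p q M)

theorem contMDiffAt_det {m : ℕ} {A : M → Matrix (Fin m) (Fin m) ℝ} {x : M}
    (hA : ∀ i j, ContMDiffAt (𝓡 (p + q)) 𝓘(ℝ, ℝ) ∞ (fun y ↦ A y i j) x) :
    ContMDiffAt (𝓡 (p + q)) 𝓘(ℝ, ℝ) ∞ (fun y ↦ (A y).det) x := by
  simp only [Matrix.det_apply']
  exact ContMDiffAt.sum fun σ _ ↦ contMDiffAt_const.mul
    (contMDiffAt_finsetProd fun i _ ↦ hA _ _)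

namespace Metric

theorem contMDiffAt_inner {X Y : Π y : M, TangentSpace (𝓡 (p + q)) y} {x : M}
    (hX : VecSmoothAt X x) (hY : VecSmoothAt Y x) :
    ContMDiffAt (𝓡 (p + q)) 𝓘(ℝ, ℝ) ∞ (fun y ↦ g.inner y (X y) (Y y)) x := by
  have : ContMDiffAt (𝓡 (p + q)) ((𝓡 (p + q)).prod 𝓘(ℝ)) ∞
      (fun m ↦ TotalSpace.mk' ℝ (E := Bundle.Trivial M ℝ) m (g.inner m (X m) (Y m))) x := by
    apply ContMDiffAt.clm_bundle_apply₂ (F₁ := Model p q) (F₂ := Model p q)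
    · exact g.contMDiff.contMDiffAt
    · exact hX
    · exact hY
  simp only [contMDiffAt_totalSpace] at this
  exact this.2

theorem funNear_inner {X Y : Π y : M, TangentSpace (𝓡 (p + q)) y} {x : M}
    (hX : VecNear X x) (hY : VecNear Y x) :
    FunNear (p := p) (q := q) (fun y ↦ g.inner y (X y) (Y y)) x := by
  filter_upwards [hX, hY] with y h1 h2 using g.contMDiffAt_inner h1 h2

/-- The local frame `ext (bas x i)`, as a basis of the tangent spaces near `x`. -/
theorem eventually_basis (x : M) : ∀ᶠ y in 𝓝 x,
    ∃ e : Module.Basis (Fin (p + q)) ℝ (TangentSpace (𝓡 (p + q)) y),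
      ∀ i, e i = ext (bas x i) y := by
  filter_upwards [ext_ret (p := p) (q := q) x, ext_eq_extL (p := p) (q := q) x] with y h1 h2
  have hsurj : Function.Surjective (extL (p := p) (q := q) x y) := fun w ↦
    ⟨ret x y w, by rw [← h2, h1]⟩
  have hinj := (LinearMap.injective_iff_surjective_of_finrank_eq_finrank (by
    rw [Module.finrank_eq_card_basis (basBasis x),
      Module.finrank_eq_card_basis (basBasis y)])).2 hsurj
  refine ⟨(basBasis x).map (LinearEquiv.ofBijective _ ⟨hinj, hsurj⟩), fun i ↦ ?_⟩
  rw [h2, Module.Basis.map_apply, basBasis_apply]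
  rfl

/-- The basis `bas y` belongs to the preferred chart at `y` and need not vary continuously with `y`,
so contractions have to be rewritten in the frame `ext (bas x k)` before their smoothness can be
seen. There the inverse matrix is smooth by Cramer's rule. -/
theorem contMDiffAt_gram_inv (x : M) (i j : Fin (p + q)) : ∀ᶠ y in 𝓝 x,
    ContMDiffAt (𝓡 (p + q)) 𝓘(ℝ, ℝ) ∞
      (fun z ↦ (g.gram (fun k ↦ ext (bas x k) z))⁻¹ i j) y := by
  have hs : ∀ᶠ y in 𝓝 x, ∀ k : Fin (p + q), VecSmoothAt (ext (bas x k)) y :=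
    Filter.eventually_all.2 fun k ↦ vecNear_ext _
  filter_upwards [hs, eventually_basis (p := p) (q := q) x] with y hy hb
  obtain ⟨e, he⟩ := hb
  have h0 : (g.gram (fun k ↦ ext (bas x k) y)).det ≠ 0 := by
    rw [← funext he]
    exact (g.gram_det e).ne_zero
  have hg : ∀ a b, ContMDiffAt (𝓡 (p + q)) 𝓘(ℝ, ℝ) ∞
      (fun z ↦ g.gram (fun k ↦ ext (bas x k) z) a b) y := fun a b ↦
    g.contMDiffAt_inner (hy a) (hy b)
  have h1 := contMDiffAt_det hg
  have h2 : ContMDiffAt (𝓡 (p + q)) 𝓘(ℝ, ℝ) ∞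
      (fun z ↦ (g.gram (fun k ↦ ext (bas x k) z)).adjugate i j) y := by
    simp only [Matrix.adjugate_apply]
    refine contMDiffAt_det fun a b ↦ ?_
    by_cases hab : a = j
    · simp only [Matrix.updateRow_apply, hab, if_true]
      exact contMDiffAt_const
    · simp only [Matrix.updateRow_apply, hab, if_false]
      exact hg a b
  have h3 := (h1.inv₀ h0).mul h2
  refine h3.congr_of_eventuallyEq (Eventually.of_forall fun z ↦ ?_)
  simp [Matrix.inv_def]

/-- A vector field is smooth when its inner products with the local frame are. -/
theorem vecNear_of_inner {X : Π y : M, TangentSpace (𝓡 (p + q)) y} {x : M}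
    (h : ∀ i, FunNear (p := p) (q := q) (fun y ↦ g.inner y (X y) (ext (bas x i) y)) x) :
    VecNear X x := by
  have h1 : VecNear (fun y ↦ ∑ i, ∑ j, ((fun z ↦ (g.gram (fun k ↦ ext (bas x k) z))⁻¹ i j *
      g.inner z (X z) (ext (bas x i) z)) • ext (bas x j)) y) x := by
    refine VecNear.sum fun i _ ↦ VecNear.sum fun j _ ↦ (vecNear_ext _).smul ?_
    filter_upwards [h i, g.contMDiffAt_gram_inv x i j] with y h2 h3 using h3.mul h2
  refine h1.congr ?_
  filter_upwards [eventually_basis (p := p) (q := q) x] with y hy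
  obtain ⟨e, he⟩ := hy
  rw [← g.sum_gram_inv_self e (X y)]
  have : (⇑e) = fun k ↦ ext (bas x k) y := funext he
  rw [this]
  rfl

end Metric

end MetricSmooth

/-! ## The Levi-Civita connection -/

section LeviCivita

variable {p q : ℕ} {M : Type*} [TopologicalSpace M] [ChartedSpace (Model p q) M]
  [IsManifold (𝓡 (p + q)) ∞ M] (g : Metric p q M)

namespace Metric

variable {X X' Y Y' Z Z' : Π y : M, TangentSpace (𝓡 (p + q)) y} {x : M} {f : M → ℝ}

theorem dd_inner_add_left (hX : VecSmoothAt X x) (hX' : VecSmoothAt X' x) (hY : VecSmoothAt Y x)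
    (v : TangentSpace (𝓡 (p + q)) x) :
    dd (fun y ↦ g.inner y ((X + X') y) (Y y)) x v
      = dd (fun y ↦ g.inner y (X y) (Y y)) x v + dd (fun y ↦ g.inner y (X' y) (Y y)) x v := by
  rw [← dd_add (g.contMDiffAt_inner hX hY) (g.contMDiffAt_inner hX' hY)]
  refine dd_congr (Eventually.of_forall fun y ↦ ?_) v
  simp only [Pi.add_apply, map_add, add_apply]

theorem dd_inner_add_right (hX : VecSmoothAt X x) (hX' : VecSmoothAt X' x)
    (hY : VecSmoothAt Y x) (v : TangentSpace (𝓡 (p + q)) x) :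
    dd (fun y ↦ g.inner y (Y y) ((X + X') y)) x v
      = dd (fun y ↦ g.inner y (Y y) (X y)) x v + dd (fun y ↦ g.inner y (Y y) (X' y)) x v := by
  simp only [g.symm _ (Y _)]
  exact g.dd_inner_add_left hX hX' hY v

theorem dd_inner_smul_left (hf : ContMDiffAt (𝓡 (p + q)) 𝓘(ℝ, ℝ) ∞ f x) (hX : VecSmoothAt X x)
    (hY : VecSmoothAt Y x) (v : TangentSpace (𝓡 (p + q)) x) :
    dd (fun y ↦ g.inner y ((f • X) y) (Y y)) x v
      = f x * dd (fun y ↦ g.inner y (X y) (Y y)) x v + dd f x v * g.inner x (X x) (Y x) := by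
  rw [← dd_mul hf (g.contMDiffAt_inner hX hY)]
  refine dd_congr (Eventually.of_forall fun y ↦ ?_) v
  simp only [Pi.smul_apply', map_smul, smul_apply, smul_eq_mul]

theorem dd_inner_smul_right (hf : ContMDiffAt (𝓡 (p + q)) 𝓘(ℝ, ℝ) ∞ f x) (hX : VecSmoothAt X x)
    (hY : VecSmoothAt Y x) (v : TangentSpace (𝓡 (p + q)) x) :
    dd (fun y ↦ g.inner y (Y y) ((f • X) y)) x v
      = f x * dd (fun y ↦ g.inner y (Y y) (X y)) x v + dd f x v * g.inner x (Y x) (X x) := by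
  simp only [g.symm _ (Y _)]
  exact g.dd_inner_smul_left hf hX hY v

theorem koszul_congr (hX : ∀ᶠ y in 𝓝 x, X' y = X y) (hY : ∀ᶠ y in 𝓝 x, Y' y = Y y)
    (hZ : ∀ᶠ y in 𝓝 x, Z' y = Z y) : g.koszul X' Y' Z' x = g.koszul X Y Z x := by
  have h1 : ∀ {A A' B B' : Π y : M, TangentSpace (𝓡 (p + q)) y} (_ : ∀ᶠ y in 𝓝 x, A' y = A y)
      (_ : ∀ᶠ y in 𝓝 x, B' y = B y) (v : TangentSpace (𝓡 (p + q)) x),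
      dd (fun y ↦ g.inner y (A' y) (B' y)) x v = dd (fun y ↦ g.inner y (A y) (B y)) x v := by
    intro A A' B B' hA hB v
    refine dd_congr ?_ v
    filter_upwards [hA, hB] with y h1 h2
    rw [h1, h2]
  simp only [koszul, h1 hX hY, h1 hY hZ, h1 hZ hX, bracket_congr hX hY, bracket_congr hX hZ,
    bracket_congr hY hZ, hX.self_of_nhds, hY.self_of_nhds, hZ.self_of_nhds]

theorem koszul_add_left (hX : VecSmoothAt X x) (hX' : VecSmoothAt X' x) (hY : VecSmoothAt Y x)
    (hZ : VecSmoothAt Z x) :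
    g.koszul (X + X') Y Z x = g.koszul X Y Z x + g.koszul X' Y Z x := by
  simp only [koszul, g.dd_inner_add_left hX hX' hY, g.dd_inner_add_right hX hX' hZ,
    bracket_add_left hX hX']
  simp only [Pi.add_apply, map_add, add_apply, dd_add_vec]
  ring

theorem koszul_add_middle (hX : VecSmoothAt X x) (hX' : VecSmoothAt X' x) (hY : VecSmoothAt Y x)
    (hZ : VecSmoothAt Z x) :
    g.koszul Y (X + X') Z x = g.koszul Y X Z x + g.koszul Y X' Z x := by
  simp only [koszul, g.dd_inner_add_left hX hX' hZ, g.dd_inner_add_right hX hX' hY,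
    bracket_add_left hX hX', bracket_add_right hX hX']
  simp only [Pi.add_apply, map_add, add_apply, dd_add_vec]
  ring

theorem koszul_add_right (hX : VecSmoothAt X x) (hX' : VecSmoothAt X' x) (hY : VecSmoothAt Y x)
    (hZ : VecSmoothAt Z x) :
    g.koszul Y Z (X + X') x = g.koszul Y Z X x + g.koszul Y Z X' x := by
  simp only [koszul, g.dd_inner_add_left hX hX' hY, g.dd_inner_add_right hX hX' hZ,
    bracket_add_right hX hX']
  simp only [Pi.add_apply, map_add, add_apply, dd_add_vec]
  ring

theorem koszul_smul_left (hf : ContMDiffAt (𝓡 (p + q)) 𝓘(ℝ, ℝ) ∞ f x) (hX : VecSmoothAt X x)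
    (hY : VecSmoothAt Y x) (hZ : VecSmoothAt Z x) :
    g.koszul (f • X) Y Z x = f x * g.koszul X Y Z x := by
  simp only [koszul, g.dd_inner_smul_left hf hX hY, g.dd_inner_smul_right hf hX hZ,
    bracket_smul_left hf hX]
  simp only [Pi.smul_apply', map_add, add_apply, map_smul, smul_apply,
    smul_eq_mul, dd_smul_vec, g.symm x (Z x) (X x)]
  ring

/-- The middle slot is the differentiated field; the extra term is twice the Leibniz term of the
connection. -/
theorem koszul_smul_middle (hf : ContMDiffAt (𝓡 (p + q)) 𝓘(ℝ, ℝ) ∞ f x) (hX : VecSmoothAt X x)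
    (hY : VecSmoothAt Y x) (hZ : VecSmoothAt Z x) :
    g.koszul Y (f • X) Z x
      = f x * g.koszul Y X Z x + 2 * dd f x (Y x) * g.inner x (X x) (Z x) := by
  simp only [koszul, g.dd_inner_smul_left hf hX hZ, g.dd_inner_smul_right hf hX hY,
    bracket_smul_left hf hX, bracket_smul_right hf hX]
  simp only [Pi.smul_apply', map_add, add_apply,
    map_smul, smul_apply, smul_eq_mul, dd_smul_vec, g.symm x (Y x) (X x)]
  ring

theorem koszul_smul_right (hf : ContMDiffAt (𝓡 (p + q)) 𝓘(ℝ, ℝ) ∞ f x) (hX : VecSmoothAt X x)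
    (hY : VecSmoothAt Y x) (hZ : VecSmoothAt Z x) :
    g.koszul Y Z (f • X) x = f x * g.koszul Y Z X x := by
  simp only [koszul, g.dd_inner_smul_left hf hX hY, g.dd_inner_smul_right hf hX hZ,
    bracket_smul_right hf hX]
  simp only [Pi.smul_apply', map_add, add_apply,
    map_smul, smul_apply, smul_eq_mul, dd_smul_vec, g.symm x (X x) (Y x), g.symm x (Z x) (X x)]
  ring

theorem koszul_ext (hX : VecNear X x) (hY : VecNear Y x) (hZ : VecNear Z x) :
    g.koszul X Y Z x = g.koszul (ext (X x)) Y (ext (Z x)) x := by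
  rw [tensorial (x := x) (fun X ↦ g.koszul X Y Z x)
    (fun A B hA hB ↦ g.koszul_add_left hA.self hB.self hY.self hZ.self)
    (fun f A hf hA ↦ g.koszul_smul_left hf.self hA.self hY.self hZ.self)
    (fun A B _ h ↦ g.koszul_congr h (.of_forall fun _ ↦ rfl) (.of_forall fun _ ↦ rfl)) hX]
  exact tensorial (x := x) (fun Z ↦ g.koszul (ext (X x)) Y Z x)
    (fun A B hA hB ↦ g.koszul_add_right hA.self hB.self (vecSmoothAt_ext _) hY.self)
    (fun f A hf hA ↦ g.koszul_smul_right hf.self hA.self (vecSmoothAt_ext _) hY.self)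
    (fun A B _ h ↦ g.koszul_congr (.of_forall fun _ ↦ rfl) (.of_forall fun _ ↦ rfl) h) hZ

theorem inner_lc_bas (Y : Π y : M, TangentSpace (𝓡 (p + q)) y) (x : M)
    (v : TangentSpace (𝓡 (p + q)) x) (k : Fin (p + q)) :
    g.inner x (g.lc Y x v) (bas x k) = 1 / 2 * g.koszul (ext v) Y (ext (bas x k)) x := by
  have h := g.sum_gram_inv (basBasis x)
    (fun i ↦ 1 / 2 * g.koszul (ext v) Y (ext (bas x i)) x) k
  have hb : ⇑(basBasis (p := p) (q := q) x) = bas x := funext (basBasis_apply x)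
  rw [hb] at h
  exact h

/-- The definition of `lc` prescribes inner products with coordinate vectors. Both sides are linear
in `z`, the right one because `ext` is linear near `x` and the Koszul expression is tensorial in its
last slot. -/
theorem inner_lc_ext (hY : VecNear Y x) (v z : TangentSpace (𝓡 (p + q)) x) :
    g.inner x (g.lc Y x v) z = 1 / 2 * g.koszul (ext v) Y (ext z) x := by
  let L : TangentSpace (𝓡 (p + q)) x →ₗ[ℝ] ℝ :=
    { toFun := fun z ↦ 1 / 2 * g.koszul (ext v) Y (ext z) x
      map_add' := fun a b ↦ by
        rw [g.koszul_congr (X := ext v) (Y := Y) (Z := ext a + ext b)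
            (.of_forall fun _ ↦ rfl) (.of_forall fun _ ↦ rfl),
          g.koszul_add_right (vecSmoothAt_ext a) (vecSmoothAt_ext b) (vecSmoothAt_ext v) hY.self,
          mul_add]
        filter_upwards [ext_eq_extL (p := p) (q := q) x] with y hy
        simp only [Pi.add_apply, hy, map_add]
      map_smul' := fun c a ↦ by
        rw [g.koszul_congr (X := ext v) (Y := Y) (Z := (fun _ : M ↦ c) • ext a)
            (.of_forall fun _ ↦ rfl) (.of_forall fun _ ↦ rfl),
          g.koszul_smul_right contMDiffAt_const (vecSmoothAt_ext a) (vecSmoothAt_ext v) hY.self]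
        · simp only [RingHom.id_apply, smul_eq_mul]
          ring
        filter_upwards [ext_eq_extL (p := p) (q := q) x] with y hy
        simp only [Pi.smul_apply', hy, map_smul] }
  have h : (g.inner x (g.lc Y x v)).toLinearMap = L := by
    refine (basBasis x).ext fun k ↦ ?_
    rw [basBasis_apply]
    exact g.inner_lc_bas Y x v k
  exact congrArg (fun L ↦ L z) h

/-- The Koszul formula. -/
theorem koszul_formula (hX : VecNear X x) (hY : VecNear Y x) (hZ : VecNear Z x) :
    2 * g.inner x (g.lc Y x (X x)) (Z x) = g.koszul X Y Z x := by
  rw [g.inner_lc_ext hY, g.koszul_ext hX hY hZ]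
  ring

theorem lc_congr (h : ∀ᶠ y in 𝓝 x, Y' y = Y y) (v : TangentSpace (𝓡 (p + q)) x) :
    g.lc Y' x v = g.lc Y x v := by
  simp only [lc]
  refine Finset.sum_congr rfl fun i _ ↦ Finset.sum_congr rfl fun j _ ↦ ?_
  rw [g.koszul_congr (Eventually.of_forall fun _ ↦ rfl) h (Eventually.of_forall fun _ ↦ rfl)]

theorem lc_add_vec (hY : VecNear Y x) (v w : TangentSpace (𝓡 (p + q)) x) :
    g.lc Y x (v + w) = g.lc Y x v + g.lc Y x w := by
  refine g.eq_of_inner fun z ↦ ?_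
  rw [map_add, add_apply, g.inner_lc_ext hY, g.inner_lc_ext hY, g.inner_lc_ext hY,
    g.koszul_congr (X := ext v + ext w) (Y := Y) (Z := ext z) _
      (.of_forall fun _ ↦ rfl) (.of_forall fun _ ↦ rfl),
    g.koszul_add_left (vecSmoothAt_ext v) (vecSmoothAt_ext w) hY.self (vecSmoothAt_ext z),
    mul_add]
  filter_upwards [ext_eq_extL (p := p) (q := q) x] with y hy
  simp only [Pi.add_apply, hy, map_add]

theorem lc_smul_vec (hY : VecNear Y x) (c : ℝ) (v : TangentSpace (𝓡 (p + q)) x) :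
    g.lc Y x (c • v) = c • g.lc Y x v := by
  refine g.eq_of_inner fun z ↦ ?_
  rw [map_smul, smul_apply, g.inner_lc_ext hY, g.inner_lc_ext hY,
    g.koszul_congr (X := (fun _ : M ↦ c) • ext v) (Y := Y) (Z := ext z) _
      (.of_forall fun _ ↦ rfl) (.of_forall fun _ ↦ rfl),
    g.koszul_smul_left contMDiffAt_const (vecSmoothAt_ext v) hY.self (vecSmoothAt_ext z)]
  · simp only [smul_eq_mul]
    ring
  filter_upwards [ext_eq_extL (p := p) (q := q) x] with y hy
  simp only [Pi.smul_apply', hy, map_smul]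

theorem lc_add (hY : VecNear Y x) (hY' : VecNear Y' x) (v : TangentSpace (𝓡 (p + q)) x) :
    g.lc (Y + Y') x v = g.lc Y x v + g.lc Y' x v := by
  refine g.eq_of_inner fun z ↦ ?_
  rw [map_add, add_apply, g.inner_lc_ext hY, g.inner_lc_ext hY', g.inner_lc_ext (hY.add hY'),
    g.koszul_add_middle hY.self hY'.self (vecSmoothAt_ext v) (vecSmoothAt_ext z), mul_add]

/-- The Leibniz rule for the Levi-Civita connection. -/
theorem lc_smul (hf : FunNear (p := p) (q := q) f x) (hY : VecNear Y x)
    (v : TangentSpace (𝓡 (p + q)) x) :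
    g.lc (f • Y) x v = f x • g.lc Y x v + dd f x v • Y x := by
  refine g.eq_of_inner fun z ↦ ?_
  rw [map_add, add_apply, map_smul, smul_apply, map_smul, smul_apply, g.inner_lc_ext hY,
    g.inner_lc_ext (hY.smul hf),
    g.koszul_smul_middle hf.self hY.self (vecSmoothAt_ext v) (vecSmoothAt_ext z)]
  simp only [ext_self, smul_eq_mul]
  ring

/-- The Levi-Civita connection is metric. -/
theorem dd_inner (hY : VecNear Y x) (hZ : VecNear Z x) (v : TangentSpace (𝓡 (p + q)) x) :
    dd (fun y ↦ g.inner y (Y y) (Z y)) x v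
      = g.inner x (g.lc Y x v) (Z x) + g.inner x (Y x) (g.lc Z x v) := by
  have h1 := g.koszul_formula (vecNear_ext v) hY hZ
  have h2 := g.koszul_formula (vecNear_ext v) hZ hY
  -- Symmetrising in the last two fields cancels all bracket terms and leaves only the derivative
  -- along `v`.
  have h3 : g.koszul (ext v) Y Z x + g.koszul (ext v) Z Y x
      = 2 * dd (fun y ↦ g.inner y (Y y) (Z y)) x v := by
    have hs : ∀ A B : Π y : M, TangentSpace (𝓡 (p + q)) y,
        (fun y ↦ g.inner y (A y) (B y)) = fun y ↦ g.inner y (B y) (A y) :=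
      fun A B ↦ funext fun y ↦ g.symm y _ _
    simp only [koszul, ext_self, hs Z Y, hs Z (ext v), hs Y (ext v), bracket_swap Z Y x, map_neg,
      neg_apply]
    ring
  rw [ext_self] at h1 h2
  rw [g.symm x (Y x)]
  linarith

/-- At each `y` the formula for `lc` uses extensions and coordinate vectors belonging to `y`. The
Koszul formula with fixed fields replaces them and shows that the inner products with a local frame
are smooth functions. -/
theorem vecNear_lc (hX : VecNear X x) (hY : VecNear Y x) :
    VecNear (fun y ↦ g.lc Y y (X y)) x := by
  refine g.vecNear_of_inner fun i ↦ ?_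
  have hE := vecNear_ext (bas (p := p) (q := q) x i)
  have h1 : FunNear (p := p) (q := q) (fun y ↦ 1 / 2 * g.koszul X Y (ext (bas x i)) y) x := by
    have hk : FunNear (p := p) (q := q) (g.koszul X Y (ext (bas x i))) x := by
      filter_upwards [(g.funNear_inner hY hE).dd hX, (g.funNear_inner hE hX).dd hY,
        (g.funNear_inner hX hY).dd hE, g.funNear_inner (hX.bracket hY) hE,
        g.funNear_inner (hX.bracket hE) hY, g.funNear_inner (hY.bracket hE) hX]
        with y h1 h2 h3 h4 h5 h6
      exact ((((h1.add h2).sub h3).add h4).sub h5).sub h6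
    filter_upwards [hk] with y hy using contMDiffAt_const.mul hy
  refine h1.congr ?_
  filter_upwards [hX.eventually_nhds, hY.eventually_nhds, hE.eventually_nhds] with y h1 h2 h3
  rw [← g.koszul_formula h1 h2 h3]
  ring

end Metric

end LeviCivita

/-! ## Curvature -/

section Curvature

variable {p q : ℕ} {M : Type*} [TopologicalSpace M] [ChartedSpace (Model p q) M]
  [IsManifold (𝓡 (p + q)) ∞ M] (g : Metric p q M)

section Commutator

variable {U V W : Π y : M, TangentSpace (𝓡 (p + q)) y} {x : M} {f : M → ℝ}

theorem isManifold_minSmoothness_three : IsManifold (𝓡 (p + q)) (minSmoothness ℝ 3) M := by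
  simpa using (inferInstance : IsManifold (𝓡 (p + q)) 3 M)

theorem VecSmoothAt.of_minSmoothness (hU : VecSmoothAt U x) :
    ContMDiffAt (𝓡 (p + q)) (𝓡 (p + q)).tangent (minSmoothness ℝ 2)
      (fun y ↦ (⟨y, U y⟩ : TangentBundle (𝓡 (p + q)) M)) x := by
  simp only [minSmoothness_of_isRCLikeNormedField]
  exact ContMDiffAt.of_le hU ENat.LEInfty.out

theorem jacobi (hU : VecSmoothAt U x) (hV : VecSmoothAt V x) (hW : VecSmoothAt W x) :
    bracket U (bracket V W) x = bracket (bracket U V) W x + bracket V (bracket U W) x := by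
  have := isManifold_minSmoothness_three (p := p) (q := q) (M := M)
  exact VectorField.leibniz_identity_mlieBracket_apply hU.of_minSmoothness hV.of_minSmoothness
    hW.of_minSmoothness

/-- The Lie bracket acts on functions as the commutator. -/
theorem dd_bracket_smul (hU : VecNear U x) (hV : VecNear V x) (hW : VecNear W x)
    (hf : FunNear (p := p) (q := q) f x) :
    dd f x (bracket U V x) • W x
      = dd (fun y ↦ dd f y (V y)) x (U x) • W x - dd (fun y ↦ dd f y (U y)) x (V x) • W x := by
  -- The commutator formula is extracted from the Jacobi identity: expand it for `U`, `V`, `f • W`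
  -- and subtract `f x` times the identity for `U`, `V`, `W`. This is why everything is multiplied
  -- by `W x`.
  have key : ∀ {U V : Π y : M, TangentSpace (𝓡 (p + q)) y} (_ : VecNear U x) (_ : VecNear V x),
      bracket U (bracket V (f • W)) x
        = dd (fun y ↦ dd f y (V y)) x (U x) • W x + dd f x (V x) • bracket U W x
          + dd f x (U x) • bracket V W x + f x • bracket U (bracket V W) x := by
    intro U V hU hV
    have h1 : ∀ᶠ y in 𝓝 x, bracket V (f • W) y
        = ((fun y ↦ dd f y (V y)) • W + f • bracket V W) y := by
      filter_upwards [hf, hW] with y h2 h3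
      exact bracket_smul_right h2 h3
    rw [bracket_congr (Eventually.of_forall fun _ ↦ rfl) h1,
      bracket_add_right ((hW.self).smul (hf.dd hV).self) ((hV.bracket hW).self.smul hf.self),
      bracket_smul_right (hf.dd hV).self hW.self,
      bracket_smul_right hf.self (hV.bracket hW).self]
    module
  have h1 := jacobi hU.self hV.self (hW.self.smul hf.self)
  rw [key hU hV, key hV hU, bracket_smul_right hf.self hW.self,
    jacobi hU.self hV.self hW.self] at h1
  rw [← sub_eq_zero] at h1 ⊢
  rw [← neg_eq_zero, ← h1]
  module

end Commutator

namespace Metric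

variable {U U' V V' W W' : Π y : M, TangentSpace (𝓡 (p + q)) y} {x : M} {f : M → ℝ}

/-- The Riemann curvature of vector fields. -/
def riemF (U V W : Π y : M, TangentSpace (𝓡 (p + q)) y) (x : M) : TangentSpace (𝓡 (p + q)) x :=
  g.lc (fun y ↦ g.lc W y (V y)) x (U x) - g.lc (fun y ↦ g.lc W y (U y)) x (V x)
    - g.lc W x (bracket U V x)

theorem riem_eq (x : M) (u v w : TangentSpace (𝓡 (p + q)) x) :
    g.riem x u v w = g.riemF (ext u) (ext v) (ext w) x := by
  simp only [riemF, riem, ext_self]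

theorem lc_neg_vec (hW : VecNear W x) (v : TangentSpace (𝓡 (p + q)) x) :
    g.lc W x (-v) = - g.lc W x v := by
  rw [← neg_one_smul ℝ v, g.lc_smul_vec hW, neg_one_smul]

theorem riemF_swap (hW : VecNear W x) : g.riemF U V W x = - g.riemF V U W x := by
  rw [riemF, riemF, bracket_swap, g.lc_neg_vec hW]
  abel

theorem riemF_congr (hU : ∀ᶠ y in 𝓝 x, U' y = U y) (hV : ∀ᶠ y in 𝓝 x, V' y = V y)
    (hW : ∀ᶠ y in 𝓝 x, W' y = W y) : g.riemF U' V' W' x = g.riemF U V W x := by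
  have h1 : ∀ {A' A : Π y : M, TangentSpace (𝓡 (p + q)) y}, (∀ᶠ y in 𝓝 x, A' y = A y) →
      ∀ v, g.lc (fun y ↦ g.lc W' y (A' y)) x v = g.lc (fun y ↦ g.lc W y (A y)) x v := by
    intro A' A hA v
    refine g.lc_congr ?_ v
    filter_upwards [hA, hW.eventually_nhds] with y h1 h2
    rw [h1, g.lc_congr h2]
  rw [riemF, riemF, h1 hU, h1 hV, bracket_congr hU hV, g.lc_congr hW, hU.self_of_nhds,
    hV.self_of_nhds]

theorem riemF_add_left (hU : VecNear U x) (hU' : VecNear U' x) (hV : VecNear V x)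
    (hW : VecNear W x) : g.riemF (U + U') V W x = g.riemF U V W x + g.riemF U' V W x := by
  have h1 : g.lc (fun y ↦ g.lc W y ((U + U') y)) x (V x)
      = g.lc ((fun y ↦ g.lc W y (U y)) + fun y ↦ g.lc W y (U' y)) x (V x) := by
    refine g.lc_congr ?_ _
    filter_upwards [hW.eventually_nhds] with y hy
    exact g.lc_add_vec hy _ _
  rw [riemF, h1, g.lc_add (g.vecNear_lc hU hW) (g.vecNear_lc hU' hW),
    bracket_add_left hU.self hU'.self, g.lc_add_vec hW, Pi.add_apply,
    g.lc_add_vec (g.vecNear_lc hV hW), riemF, riemF]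
  abel

theorem riemF_smul_left (hf : FunNear (p := p) (q := q) f x) (hU : VecNear U x)
    (hV : VecNear V x) (hW : VecNear W x) :
    g.riemF (f • U) V W x = f x • g.riemF U V W x := by
  have h1 : g.lc (fun y ↦ g.lc W y ((f • U) y)) x (V x)
      = g.lc (f • fun y ↦ g.lc W y (U y)) x (V x) := by
    refine g.lc_congr ?_ _
    filter_upwards [hW.eventually_nhds] with y hy
    exact g.lc_smul_vec hy _ _
  rw [riemF, h1, g.lc_smul hf (g.vecNear_lc hU hW),
    bracket_smul_left hf.self hU.self, g.lc_add_vec hW, g.lc_smul_vec hW, g.lc_smul_vec hW,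
    Pi.smul_apply', g.lc_smul_vec (g.vecNear_lc hV hW), riemF]
  module

theorem riemF_add_right (hU : VecNear U x) (hV : VecNear V x) (hW : VecNear W x)
    (hW' : VecNear W' x) : g.riemF U V (W + W') x = g.riemF U V W x + g.riemF U V W' x := by
  have h1 : ∀ {A : Π y : M, TangentSpace (𝓡 (p + q)) y}, VecNear A x →
      ∀ v, g.lc (fun y ↦ g.lc (W + W') y (A y)) x v
        = g.lc (fun y ↦ g.lc W y (A y)) x v + g.lc (fun y ↦ g.lc W' y (A y)) x v := by
    intro A hA v
    rw [← g.lc_add (g.vecNear_lc hA hW) (g.vecNear_lc hA hW')]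
    refine g.lc_congr ?_ v
    filter_upwards [hW.eventually_nhds, hW'.eventually_nhds] with y h1 h2
    exact g.lc_add h1 h2 _
  rw [riemF, h1 hU, h1 hV, g.lc_add hW hW', riemF, riemF]
  abel

/-- The products of first derivatives are symmetric in `U` and `V`, and the commutator of second
derivatives of `f` cancels against the derivative along the bracket (`dd_bracket_smul`). -/
theorem riemF_smul_right (hf : FunNear (p := p) (q := q) f x) (hU : VecNear U x)
    (hV : VecNear V x) (hW : VecNear W x) :
    g.riemF U V (f • W) x = f x • g.riemF U V W x := by
  have h1 : ∀ {A : Π y : M, TangentSpace (𝓡 (p + q)) y}, VecNear A x →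
      ∀ v, g.lc (fun y ↦ g.lc (f • W) y (A y)) x v
        = f x • g.lc (fun y ↦ g.lc W y (A y)) x v + dd f x v • g.lc W x (A x)
          + (dd f x (A x) • g.lc W x v + dd (fun y ↦ dd f y (A y)) x v • W x) := by
    intro A hA v
    rw [← g.lc_smul hf (g.vecNear_lc hA hW), ← g.lc_smul (hf.dd hA) hW,
      ← g.lc_add ((g.vecNear_lc hA hW).smul hf) (hW.smul (hf.dd hA))]
    refine g.lc_congr ?_ v
    filter_upwards [hf.eventually_nhds, hW.eventually_nhds] with y h1 h2
    exact g.lc_smul h1 h2 _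
  rw [riemF, h1 hU, h1 hV, g.lc_smul hf hW, dd_bracket_smul hU hV hW hf, riemF]
  module

/-- Tensoriality slot by slot; the second slot is reduced to the first by antisymmetry. -/
theorem riemF_eq (hU : VecNear U x) (hV : VecNear V x) (hW : VecNear W x) :
    g.riemF U V W x = g.riem x (U x) (V x) (W x) := by
  have rfl' : ∀ {A : Π y : M, TangentSpace (𝓡 (p + q)) y}, ∀ᶠ y in 𝓝 x, A y = A y :=
    Eventually.of_forall fun _ ↦ rfl
  have hleft : ∀ {U V : Π y : M, TangentSpace (𝓡 (p + q)) y}, VecNear U x → VecNear V x →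
      g.riemF U V W x = g.riemF (ext (U x)) V W x := fun {U V} hU hV ↦
    tensorial (x := x) (fun U ↦ g.riemF U V W x)
      (fun A B hA hB ↦ g.riemF_add_left hA hB hV hW)
      (fun f A hf hA ↦ g.riemF_smul_left hf hA hV hW)
      (fun A B _ h ↦ g.riemF_congr h rfl' rfl') hU
  rw [hleft hU hV, g.riemF_swap hW, hleft hV (vecNear_ext _), ← g.riemF_swap hW, riem_eq]
  exact tensorial (x := x) (fun W ↦ g.riemF (ext (U x)) (ext (V x)) W x)
    (fun A B hA hB ↦ g.riemF_add_right (vecNear_ext _) (vecNear_ext _) hA hB)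
    (fun f A hf hA ↦ g.riemF_smul_right hf (vecNear_ext _) (vecNear_ext _) hA)
    (fun A B _ h ↦ g.riemF_congr rfl' rfl' h) hW

theorem vecNear_riem (hU : VecNear U x) (hV : VecNear V x) (hW : VecNear W x) :
    VecNear (fun y ↦ g.riem y (U y) (V y) (W y)) x := by
  have h1 : VecNear (g.riemF U V W) x := by
    filter_upwards [g.vecNear_lc hU (g.vecNear_lc hV hW),
      g.vecNear_lc hV (g.vecNear_lc hU hW), g.vecNear_lc (hU.bracket hV) hW] with y h1 h2 h3
    exact ContMDiffAt.sub_section (ContMDiffAt.sub_section h1 h2) h3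
  refine h1.congr ?_
  filter_upwards [hU.eventually_nhds, hV.eventually_nhds, hW.eventually_nhds] with y h1 h2 h3
  exact (g.riemF_eq h1 h2 h3).symm

theorem riem_add (x : M) (u u' v v' w w' : TangentSpace (𝓡 (p + q)) x) :
    g.riem x (u + u') v w = g.riem x u v w + g.riem x u' v w ∧
    g.riem x u (v + v') w = g.riem x u v w + g.riem x u v' w ∧
    g.riem x u v (w + w') = g.riem x u v w + g.riem x u v w' := by
  have h : ∀ a b : TangentSpace (𝓡 (p + q)) x, (ext a + ext b) x = a + b := fun a b ↦ by
    simp only [Pi.add_apply, ext_self]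
  have hl : ∀ u u' v : TangentSpace (𝓡 (p + q)) x,
      g.riem x (u + u') v w = g.riem x u v w + g.riem x u' v w := fun u u' v ↦ by
    have h1 := g.riemF_add_left (vecNear_ext u) (vecNear_ext u') (vecNear_ext v) (vecNear_ext w)
    rwa [g.riemF_eq ((vecNear_ext u).add (vecNear_ext u')) (vecNear_ext v) (vecNear_ext w), h,
      ← riem_eq, ← riem_eq, ext_self, ext_self] at h1
  have hs : ∀ u v : TangentSpace (𝓡 (p + q)) x, g.riem x u v w = - g.riem x v u w := fun u v ↦ by
    rw [riem_eq, g.riemF_swap (vecNear_ext w), ← riem_eq]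
  refine ⟨hl u u' v, ?_, ?_⟩
  · rw [hs u, hl, hs u v, hs u v']
    abel
  · have h1 := g.riemF_add_right (vecNear_ext u) (vecNear_ext v) (vecNear_ext w) (vecNear_ext w')
    rwa [g.riemF_eq (vecNear_ext u) (vecNear_ext v) ((vecNear_ext w).add (vecNear_ext w')), h,
      ← riem_eq, ← riem_eq, ext_self, ext_self] at h1

theorem riem_smul (x : M) (c : ℝ) (u v w : TangentSpace (𝓡 (p + q)) x) :
    g.riem x (c • u) v w = c • g.riem x u v w ∧ g.riem x u (c • v) w = c • g.riem x u v w ∧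
    g.riem x u v (c • w) = c • g.riem x u v w := by
  have hc : FunNear (p := p) (q := q) (fun _ : M ↦ c) x :=
    Eventually.of_forall fun _ ↦ contMDiffAt_const
  have h : ∀ a : TangentSpace (𝓡 (p + q)) x, ((fun _ : M ↦ c) • ext a) x = c • a := fun a ↦ by
    simp only [Pi.smul_apply', ext_self]
  have hl : ∀ u v : TangentSpace (𝓡 (p + q)) x,
      g.riem x (c • u) v w = c • g.riem x u v w := fun u v ↦ by
    have h1 := g.riemF_smul_left hc (vecNear_ext u) (vecNear_ext v) (vecNear_ext w)
    rwa [g.riemF_eq ((vecNear_ext u).smul hc) (vecNear_ext v) (vecNear_ext w), h,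
      ← riem_eq, ext_self, ext_self] at h1
  have hs : ∀ u v : TangentSpace (𝓡 (p + q)) x, g.riem x u v w = - g.riem x v u w := fun u v ↦ by
    rw [riem_eq, g.riemF_swap (vecNear_ext w), ← riem_eq]
  refine ⟨hl u v, ?_, ?_⟩
  · rw [hs u, hl, hs u v, smul_neg]
  · have h1 := g.riemF_smul_right hc (vecNear_ext u) (vecNear_ext v) (vecNear_ext w)
    rwa [g.riemF_eq (vecNear_ext u) (vecNear_ext v) ((vecNear_ext w).smul hc), h,
      ← riem_eq, ext_self, ext_self] at h1

/-! ### Ricci, scalar and Schouten curvature as smooth tensors -/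

/-- The Ricci curvature as a bilinear map. -/
def ricciL (x : M) :
    TangentSpace (𝓡 (p + q)) x →ₗ[ℝ] TangentSpace (𝓡 (p + q)) x →ₗ[ℝ] ℝ :=
  LinearMap.mk₂ ℝ (g.ricci x)
    (fun v v' w ↦ by
      simp only [ricci, (g.riem_add x _ 0 v v' w 0).2.1, coord_add, Finset.sum_add_distrib])
    (fun c v w ↦ by
      simp only [ricci, (g.riem_smul x c _ v w).2.1, coord_smul, Finset.mul_sum, smul_eq_mul])
    (fun v w w' ↦ by
      simp only [ricci, (g.riem_add x _ 0 v 0 w w').2.2, coord_add, Finset.sum_add_distrib])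
    (fun c v w ↦ by
      simp only [ricci, (g.riem_smul x c _ v w).2.2, coord_smul, Finset.mul_sum, smul_eq_mul])

theorem ricciL_apply (x : M) (v w : TangentSpace (𝓡 (p + q)) x) :
    g.ricciL x v w = g.ricci x v w := rfl

/-- As the trace of an endomorphism the Ricci curvature may be computed in any basis, in particular
in a smooth local frame. -/
theorem ricci_eq_sum (x : M) (v w : TangentSpace (𝓡 (p + q)) x)
    (e : Module.Basis (Fin (p + q)) ℝ (TangentSpace (𝓡 (p + q)) x)) :
    g.ricci x v w = ∑ i, e.repr (g.riem x (e i) v w) i := by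
  let L : TangentSpace (𝓡 (p + q)) x →ₗ[ℝ] TangentSpace (𝓡 (p + q)) x :=
    { toFun := fun u ↦ g.riem x u v w
      map_add' := fun u u' ↦ (g.riem_add x u u' v 0 w 0).1
      map_smul' := fun c u ↦ (g.riem_smul x c u v w).1 }
  have h : ∀ e : Module.Basis (Fin (p + q)) ℝ (TangentSpace (𝓡 (p + q)) x),
      LinearMap.trace ℝ _ L = ∑ i, e.repr (L (e i)) i := fun e ↦ by
    rw [LinearMap.trace_eq_matrix_trace ℝ e, Matrix.trace]
    simp only [Matrix.diag_apply, LinearMap.toMatrix_apply]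
  have h1 := h (basBasis x)
  rw [h e] at h1
  rw [ricci]
  simp only [basBasis_apply, basBasis_repr] at h1
  exact h1.symm

theorem repr_eq_sum {x : M} (e : Module.Basis (Fin (p + q)) ℝ (TangentSpace (𝓡 (p + q)) x))
    (w : TangentSpace (𝓡 (p + q)) x) (i : Fin (p + q)) :
    e.repr w i = ∑ j, (g.gram e)⁻¹ i j * g.inner x w (e j) := by
  conv_lhs => rw [← g.sum_gram_inv_self e w]
  simp [Finsupp.single_apply, g.gram_inv_symm e i]

theorem funNear_ricci (hV : VecNear V x) (hW : VecNear W x) :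
    FunNear (p := p) (q := q) (fun y ↦ g.ricci y (V y) (W y)) x := by
  have h1 : FunNear (p := p) (q := q) (fun y ↦ ∑ i, ∑ j,
      (g.gram (fun k ↦ ext (bas x k) y))⁻¹ i j *
        g.inner y (g.riem y (ext (bas x i) y) (V y) (W y)) (ext (bas x j) y)) x := by
    have h2 : ∀ᶠ y in 𝓝 x, ∀ i j, ContMDiffAt (𝓡 (p + q)) 𝓘(ℝ, ℝ) ∞
        (fun y ↦ (g.gram (fun k ↦ ext (bas x k) y))⁻¹ i j *
          g.inner y (g.riem y (ext (bas x i) y) (V y) (W y)) (ext (bas x j) y)) y := by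
      refine Filter.eventually_all.2 fun i ↦ Filter.eventually_all.2 fun j ↦ ?_
      filter_upwards [g.contMDiffAt_gram_inv x i j,
        g.funNear_inner (g.vecNear_riem (vecNear_ext (bas x i)) hV hW) (vecNear_ext (bas x j))]
        with y h3 h4 using h3.mul h4
    filter_upwards [h2] with y hy
    exact ContMDiffAt.sum fun i _ ↦ ContMDiffAt.sum fun j _ ↦ hy i j
  refine h1.congr ?_
  filter_upwards [eventually_basis (p := p) (q := q) x] with y hy
  obtain ⟨e, he⟩ := hy
  rw [g.ricci_eq_sum y _ _ e]
  simp only [g.repr_eq_sum, ← he]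

theorem scal_eq_sum (x : M) (e : Module.Basis (Fin (p + q)) ℝ (TangentSpace (𝓡 (p + q)) x)) :
    g.scal x = ∑ i, ∑ j, (g.gram e)⁻¹ i j * g.ricci x (e i) (e j) := by
  have h := g.sum_gram_inv_bilin (g.ricciL x) (basBasis x) e
  have hb : ⇑(basBasis (p := p) (q := q) x) = bas x := funext (basBasis_apply x)
  rw [hb] at h
  exact h

theorem funNear_scal (x : M) : FunNear (p := p) (q := q) g.scal x := by
  have h1 : FunNear (p := p) (q := q) (fun y ↦ ∑ i, ∑ j,
      (g.gram (fun k ↦ ext (bas x k) y))⁻¹ i j *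
        g.ricci y (ext (bas x i) y) (ext (bas x j) y)) x := by
    have h2 : ∀ᶠ y in 𝓝 x, ∀ i j, ContMDiffAt (𝓡 (p + q)) 𝓘(ℝ, ℝ) ∞
        (fun y ↦ (g.gram (fun k ↦ ext (bas x k) y))⁻¹ i j *
          g.ricci y (ext (bas x i) y) (ext (bas x j) y)) y := by
      refine Filter.eventually_all.2 fun i ↦ Filter.eventually_all.2 fun j ↦ ?_
      filter_upwards [g.contMDiffAt_gram_inv x i j,
        g.funNear_ricci (vecNear_ext (bas x i)) (vecNear_ext (bas x j))]
        with y h3 h4 using h3.mul h4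
    filter_upwards [h2] with y hy
    exact ContMDiffAt.sum fun i _ ↦ ContMDiffAt.sum fun j _ ↦ hy i j
  refine h1.congr ?_
  filter_upwards [eventually_basis (p := p) (q := q) x] with y hy
  obtain ⟨e, he⟩ := hy
  simp only [g.scal_eq_sum y e, ← he]

/-- The Schouten tensor as a bilinear map. -/
def schoutenL (x : M) :
    TangentSpace (𝓡 (p + q)) x →ₗ[ℝ] TangentSpace (𝓡 (p + q)) x →ₗ[ℝ] ℝ :=
  LinearMap.mk₂ ℝ (g.schouten x)
    (fun v v' w ↦ by
      simp only [schouten, ← ricciL_apply, map_add, add_apply, LinearMap.add_apply]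
      ring)
    (fun c v w ↦ by
      simp only [schouten, ← ricciL_apply, map_smul, smul_apply, LinearMap.smul_apply,
        smul_eq_mul]
      ring)
    (fun v w w' ↦ by
      simp only [schouten, ← ricciL_apply, map_add]
      ring)
    (fun c v w ↦ by
      simp only [schouten, ← ricciL_apply, map_smul, smul_eq_mul]
      ring)

theorem funNear_schouten (hV : VecNear V x) (hW : VecNear W x) :
    FunNear (p := p) (q := q) (fun y ↦ g.schouten y (V y) (W y)) x := by
  filter_upwards [g.funNear_ricci hV hW, g.funNear_scal x, g.funNear_inner hV hW]
    with y h1 h2 h3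
  simp only [schouten, div_eq_mul_inv]
  exact (h1.sub ((h2.mul contMDiffAt_const).mul h3)).mul contMDiffAt_const

theorem inner_schoutenUp (x : M) (v z : TangentSpace (𝓡 (p + q)) x) :
    g.inner x (g.schoutenUp x v) z = g.schouten x v z := by
  have hb : ⇑(basBasis (p := p) (q := q) x) = bas x := funext (basBasis_apply x)
  have h : (g.inner x (g.schoutenUp x v)).toLinearMap = g.schoutenL x v := by
    refine (basBasis x).ext fun k ↦ ?_
    have h1 := g.sum_gram_inv (basBasis x) (fun i ↦ g.schouten x v (bas x i)) k
    rw [hb] at h1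
    rw [basBasis_apply]
    exact h1
  exact congrArg (fun L ↦ L z) h

theorem schoutenUp_add (x : M) (v w : TangentSpace (𝓡 (p + q)) x) :
    g.schoutenUp x (v + w) = g.schoutenUp x v + g.schoutenUp x w := by
  refine g.eq_of_inner fun z ↦ ?_
  rw [map_add, add_apply, inner_schoutenUp, inner_schoutenUp, inner_schoutenUp]
  exact (g.schoutenL x).map_add₂ v w z

theorem schoutenUp_smul (x : M) (c : ℝ) (v : TangentSpace (𝓡 (p + q)) x) :
    g.schoutenUp x (c • v) = c • g.schoutenUp x v := by
  refine g.eq_of_inner fun z ↦ ?_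
  rw [map_smul, smul_apply, inner_schoutenUp, inner_schoutenUp]
  exact (g.schoutenL x).map_smul₂ c v z

theorem vecNear_schoutenUp (hV : VecNear V x) : VecNear (fun y ↦ g.schoutenUp y (V y)) x := by
  refine g.vecNear_of_inner fun i ↦ ?_
  simp only [inner_schoutenUp]
  exact g.funNear_schouten hV (vecNear_ext _)

end Metric

end Curvature

/-! ## The standard tractor bundle -/

section StdBundle

variable {p q : ℕ} {M : Type*} [TopologicalSpace M] [ChartedSpace (Model p q) M]
  [IsManifold (𝓡 (p + q)) ∞ M] (g : Metric p q M)

/-- Smoothness of a standard tractor field near a point. -/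
def StdNear (s : Π y : M, Std (p := p) (q := q) y) (x : M) : Prop :=
  ∀ᶠ y in 𝓝 x, StdSmoothAt s y

variable {s s' : Π y : M, Std (p := p) (q := q) y} {x : M} {f : M → ℝ}

theorem FunNear.const (c : ℝ) (x : M) : FunNear (p := p) (q := q) (fun _ ↦ c) x :=
  Eventually.of_forall fun _ ↦ contMDiffAt_const

theorem FunNear.add {f f' : M → ℝ} (hf : FunNear (p := p) (q := q) f x)
    (hf' : FunNear (p := p) (q := q) f' x) : FunNear (p := p) (q := q) (fun y ↦ f y + f' y) x := by
  filter_upwards [hf, hf'] with y h1 h2 using h1.add h2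

theorem FunNear.mul {f f' : M → ℝ} (hf : FunNear (p := p) (q := q) f x)
    (hf' : FunNear (p := p) (q := q) f' x) : FunNear (p := p) (q := q) (fun y ↦ f y * f' y) x := by
  filter_upwards [hf, hf'] with y h1 h2 using h1.mul h2

theorem FunNear.neg {f : M → ℝ} (hf : FunNear (p := p) (q := q) f x) :
    FunNear (p := p) (q := q) (fun y ↦ - f y) x := by
  filter_upwards [hf] with y h1 using h1.neg

theorem vecNear_zero (x : M) : VecNear (0 : Π y : M, TangentSpace (𝓡 (p + q)) y) x :=
  Eventually.of_forall fun y ↦ VecSmoothAt.zero y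

theorem stdNear_mk {ρ σ : M → ℝ} {μ : Π y : M, TangentSpace (𝓡 (p + q)) y}
    (hρ : FunNear (p := p) (q := q) ρ x) (hμ : VecNear μ x)
    (hσ : FunNear (p := p) (q := q) σ x) : StdNear (fun y ↦ (ρ y, μ y, σ y)) x := by
  filter_upwards [hρ, hμ, hσ] with y h1 h2 h3 using ⟨h1, h2, h3⟩

theorem StdNear.self (h : StdNear s x) : StdSmoothAt s x := h.self_of_nhds

theorem StdNear.fst (h : StdNear s x) : FunNear (p := p) (q := q) (fun y ↦ (s y).1) x :=
  h.mono fun _ hy ↦ hy.1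

theorem StdNear.mid (h : StdNear s x) : VecNear (fun y ↦ (s y).2.1) x := h.mono fun _ hy ↦ hy.2.1

theorem StdNear.snd (h : StdNear s x) : FunNear (p := p) (q := q) (fun y ↦ (s y).2.2) x :=
  h.mono fun _ hy ↦ hy.2.2

theorem StdNear.add (h : StdNear s x) (h' : StdNear s' x) : StdNear (s + s') x :=
  stdNear_mk (h.fst.add h'.fst) (h.mid.add h'.mid) (h.snd.add h'.snd)

theorem StdNear.smul (hf : FunNear (p := p) (q := q) f x) (h : StdNear s x) :
    StdNear (f • s) x :=
  stdNear_mk (hf.mul h.fst) (h.mid.smul hf) (hf.mul h.snd)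

theorem stdNear_stdExt (w : Std (p := p) (q := q) x) : StdNear (stdExt w) x :=
  stdNear_mk (.const _ x) (vecNear_ext _) (.const _ x)

@[simp] theorem stdExt_self (w : Std (p := p) (q := q) x) : stdExt w x = w := by
  simp only [stdExt, ext_self]

/-- The tensoriality criterion for standard tractor fields. -/
theorem stdTensorial {A : Type*} [AddCommGroup A] [Module ℝ A]
    (Φ : (Π y : M, Std (p := p) (q := q) y) → A)
    (hadd : ∀ s s', StdNear s x → StdNear s' x → Φ (s + s') = Φ s + Φ s')
    (hsmul : ∀ (f : M → ℝ) s, FunNear (p := p) (q := q) f x → StdNear s x →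
      Φ (f • s) = f x • Φ s)
    (hcongr : ∀ s s', StdNear s x → (∀ᶠ y in 𝓝 x, s' y = s y) → Φ s' = Φ s)
    (hs : StdNear s x) : Φ s = Φ (stdExt (s x)) := by
  let mid : (Π y : M, TangentSpace (𝓡 (p + q)) y) → Π y : M, Std (p := p) (q := q) y :=
    fun X y ↦ (0, X y, 0)
  have hmid : ∀ {X}, VecNear X x → StdNear (mid X) x := fun hX ↦
    stdNear_mk (.const 0 x) hX (.const 0 x)
  have hc1 : StdNear (p := p) (q := q) (fun _ ↦ (1, 0, 0)) x :=
    stdNear_mk (.const 1 x) (vecNear_zero x) (.const 0 x)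
  have hc2 : StdNear (p := p) (q := q) (fun _ ↦ (0, 0, 1)) x :=
    stdNear_mk (.const 0 x) (vecNear_zero x) (.const 1 x)
  have key : ∀ s, StdNear s x → Φ s = (s x).1 • Φ (fun _ ↦ (1, 0, 0))
      + Φ (mid (ext (s x).2.1)) + (s x).2.2 • Φ (fun _ ↦ (0, 0, 1)) := by
    intro s hs
    have h1 : s = (fun y ↦ (s y).1) • (fun y : M ↦ ((1, 0, 0) : Std (p := p) (q := q) y))
        + mid (fun y ↦ (s y).2.1)
        + (fun y ↦ (s y).2.2) • (fun y : M ↦ ((0, 0, 1) : Std (p := p) (q := q) y)) := by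
      funext y
      refine Prod.ext ?_ (Prod.ext ?_ ?_)
      · simp [mid]
      · simp [mid]
      · simp [mid]
    have h2 := tensorial (x := x) (fun X ↦ Φ (mid X))
      (fun X Y hX hY ↦ by
        rw [← hadd _ _ (hmid hX) (hmid hY)]
        congr 1
        funext y
        simp [mid])
      (fun f X hf hX ↦ by
        rw [← hsmul _ _ hf (hmid hX)]
        congr 1
        funext y
        simp [mid])
      (fun X Y hX hXY ↦ hcongr _ _ (hmid hX) (hXY.mono fun y hy ↦ by simp only [mid, hy]))
      hs.mid
    conv_lhs => rw [h1]
    rw [hadd _ _ ((hc1.smul hs.fst).add (hmid hs.mid)) (hc2.smul hs.snd),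
      hadd _ _ (hc1.smul hs.fst) (hmid hs.mid), hsmul _ _ hs.fst hc1, hsmul _ _ hs.snd hc2]
    rw [h2]
  rw [key s hs, key _ (stdNear_stdExt _), stdExt_self]

namespace Metric

theorem down_add (x : M) (v : TangentSpace (𝓡 (p + q)) x) (a b : Std (p := p) (q := q) x) :
    g.down x v (a + b) = g.down x v a + g.down x v b := by
  simp [down, add_smul, add_comm]

theorem down_smul (x : M) (v : TangentSpace (𝓡 (p + q)) x) (c : ℝ)
    (a : Std (p := p) (q := q) x) : g.down x v (c • a) = c • g.down x v a := by
  simp [down, mul_smul]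

theorem up_add (x : M) (v : TangentSpace (𝓡 (p + q)) x) (a b : Std (p := p) (q := q) x) :
    g.up x v (a + b) = g.up x v a + g.up x v b := by
  simp [up, add_smul, add_comm]

theorem up_smul (x : M) (v : TangentSpace (𝓡 (p + q)) x) (c : ℝ)
    (a : Std (p := p) (q := q) x) : g.up x v (c • a) = c • g.up x v a := by
  simp [up, mul_smul]

theorem down_add_vec (x : M) (v w : TangentSpace (𝓡 (p + q)) x) (a : Std (p := p) (q := q) x) :
    g.down x (v + w) a = g.down x v a + g.down x w a := by
  simp [down, add_comm]

theorem down_smul_vec (x : M) (c : ℝ) (v : TangentSpace (𝓡 (p + q)) x)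
    (a : Std (p := p) (q := q) x) : g.down x (c • v) a = c • g.down x v a := by
  simp [down, smul_comm c]

theorem up_add_vec (x : M) (v w : TangentSpace (𝓡 (p + q)) x) (a : Std (p := p) (q := q) x) :
    g.up x (v + w) a = g.up x v a + g.up x w a := by
  simp [up, add_comm]

theorem up_smul_vec (x : M) (c : ℝ) (v : TangentSpace (𝓡 (p + q)) x)
    (a : Std (p := p) (q := q) x) : g.up x (c • v) a = c • g.up x v a := by
  simp [up, smul_comm c]

/-- The action of a tangent vector as a linear map. -/
def downL (x : M) (v : TangentSpace (𝓡 (p + q)) x) :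
    Std (p := p) (q := q) x →ₗ[ℝ] Std (p := p) (q := q) x where
  toFun := g.down x v
  map_add' := g.down_add x v
  map_smul' := g.down_smul x v

/-- The action of a covector as a linear map. -/
def upL (x : M) (v : TangentSpace (𝓡 (p + q)) x) :
    Std (p := p) (q := q) x →ₗ[ℝ] Std (p := p) (q := q) x where
  toFun := g.up x v
  map_add' := g.up_add x v
  map_smul' := g.up_smul x v

/-- Skewness for the tractor metric. -/
def IsSkew (x : M) (A : Std (p := p) (q := q) x → Std (p := p) (q := q) x) : Prop :=
  ∀ a b, g.form x (A a) b + g.form x a (A b) = 0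

theorem isSkew_down (x : M) (v : TangentSpace (𝓡 (p + q)) x) : g.IsSkew x (g.down x v) := by
  intro a b
  simp only [form, down, map_smul, smul_apply, smul_eq_mul, g.symm x a.2.1 v]
  ring

theorem isSkew_up (x : M) (v : TangentSpace (𝓡 (p + q)) x) : g.IsSkew x (g.up x v) := by
  intro a b
  simp only [form, up, map_smul, smul_apply, smul_eq_mul, g.symm x a.2.1 v]
  ring

theorem form_add_left (x : M) (a a' b : Std (p := p) (q := q) x) :
    g.form x (a + a') b = g.form x a b + g.form x a' b := by
  simp only [form, Prod.fst_add, Prod.snd_add, map_add, add_apply]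
  ring

theorem form_comm (x : M) (a b : Std (p := p) (q := q) x) : g.form x a b = g.form x b a := by
  simp only [form, g.symm x a.2.1]
  ring

theorem form_add_right (x : M) (a b b' : Std (p := p) (q := q) x) :
    g.form x a (b + b') = g.form x a b + g.form x a b' := by
  rw [form_comm, form_add_left, form_comm, form_comm _ _ b']

/-- The part of the standard tractor connection without algebraic terms. -/
def stdD (s : Π y : M, Std (p := p) (q := q) y) (x : M) (v : TangentSpace (𝓡 (p + q)) x) :
    Std (p := p) (q := q) x :=
  (dd (fun y ↦ (s y).1) x v, g.lc (fun y ↦ (s y).2.1) x v, dd (fun y ↦ (s y).2.2) x v)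

theorem stdNabla_eq (s : Π y : M, Std (p := p) (q := q) y) (x : M)
    (v : TangentSpace (𝓡 (p + q)) x) :
    g.stdNabla s x v = g.stdD s x v + g.down x v (s x) + g.up x (g.schoutenUp x v) (s x) := rfl

theorem stdNabla_congr (h : ∀ᶠ y in 𝓝 x, s' y = s y) (v : TangentSpace (𝓡 (p + q)) x) :
    g.stdNabla s' x v = g.stdNabla s x v := by
  have h1 : g.stdD s' x v = g.stdD s x v := by
    rw [stdD, stdD, dd_congr (f' := fun y ↦ (s' y).1) (f := fun y ↦ (s y).1)
        (h.mono fun y hy ↦ by simp only [hy]),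
      g.lc_congr (Y := fun y ↦ (s y).2.1) (h.mono fun y hy ↦ by simp only [hy]),
      dd_congr (f' := fun y ↦ (s' y).2.2) (f := fun y ↦ (s y).2.2)
        (h.mono fun y hy ↦ by simp only [hy])]
  rw [stdNabla_eq, stdNabla_eq, h1, h.self_of_nhds]

theorem stdNabla_add_vec (hs : StdNear s x) (v w : TangentSpace (𝓡 (p + q)) x) :
    g.stdNabla s x (v + w) = g.stdNabla s x v + g.stdNabla s x w := by
  have h1 : g.stdD s x (v + w) = g.stdD s x v + g.stdD s x w := by
    rw [stdD, dd_add_vec, dd_add_vec, g.lc_add_vec hs.mid]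
    rfl
  rw [stdNabla_eq, stdNabla_eq, stdNabla_eq, h1, down_add_vec, schoutenUp_add, up_add_vec]
  abel

theorem stdNabla_smul_vec (hs : StdNear s x) (c : ℝ) (v : TangentSpace (𝓡 (p + q)) x) :
    g.stdNabla s x (c • v) = c • g.stdNabla s x v := by
  have h1 : g.stdD s x (c • v) = c • g.stdD s x v := by
    rw [stdD, dd_smul_vec, dd_smul_vec, g.lc_smul_vec hs.mid]
    rfl
  rw [stdNabla_eq, stdNabla_eq, h1, down_smul_vec, schoutenUp_smul, up_smul_vec, smul_add,
    smul_add]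

theorem stdNabla_add (hs : StdNear s x) (hs' : StdNear s' x) (v : TangentSpace (𝓡 (p + q)) x) :
    g.stdNabla (s + s') x v = g.stdNabla s x v + g.stdNabla s' x v := by
  have h1 : g.stdD (s + s') x v = g.stdD s x v + g.stdD s' x v := by
    have h2 := dd_add hs.fst.self hs'.fst.self v
    have h3 := dd_add hs.snd.self hs'.snd.self v
    have h4 := g.lc_add hs.mid hs'.mid v
    exact Prod.ext h2 (Prod.ext h4 h3)
  rw [stdNabla_eq, stdNabla_eq, stdNabla_eq, h1, Pi.add_apply, down_add, up_add]
  abel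

theorem stdNabla_smul (hf : FunNear (p := p) (q := q) f x) (hs : StdNear s x)
    (v : TangentSpace (𝓡 (p + q)) x) :
    g.stdNabla (f • s) x v = f x • g.stdNabla s x v + dd f x v • s x := by
  have h1 : g.stdD (f • s) x v = f x • g.stdD s x v + dd f x v • s x := by
    have h2 := dd_mul hf.self hs.fst.self v
    have h3 := dd_mul hf.self hs.snd.self v
    have h4 := g.lc_smul hf hs.mid v
    exact Prod.ext h2 (Prod.ext h4 h3)
  rw [stdNabla_eq, stdNabla_eq, h1, Pi.smul_apply', down_smul, up_smul, smul_add, smul_add]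
  abel

/-- The standard tractor connection is compatible with the tractor metric. -/
theorem dd_form (hs : StdNear s x) (hs' : StdNear s' x) (v : TangentSpace (𝓡 (p + q)) x) :
    dd (fun y ↦ g.form y (s y) (s' y)) x v
      = g.form x (g.stdNabla s x v) (s' x) + g.form x (s x) (g.stdNabla s' x v) := by
  have h1 : dd (fun y ↦ g.form y (s y) (s' y)) x v
      = g.form x (g.stdD s x v) (s' x) + g.form x (s x) (g.stdD s' x v) := by
    simp only [form]
    rw [dd_add ((hs.fst.mul hs'.snd).add (hs.snd.mul hs'.fst)).self
        (g.funNear_inner hs.mid hs'.mid).self,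
      dd_add (hs.fst.mul hs'.snd).self (hs.snd.mul hs'.fst).self,
      dd_mul hs.fst.self hs'.snd.self, dd_mul hs.snd.self hs'.fst.self,
      g.dd_inner hs.mid hs'.mid]
    simp only [stdD]
    ring
  -- The differential part already satisfies the product rule; the algebraic parts are skew for the
  -- tractor metric, so their contributions cancel.
  have h2 := g.isSkew_down x v (s x) (s' x)
  have h3 := g.isSkew_up x (g.schoutenUp x v) (s x) (s' x)
  simp only [h1, stdNabla_eq, form_add_left, form_add_right]
  linarith

theorem stdNear_stdNabla {X : Π y : M, TangentSpace (𝓡 (p + q)) y} (hs : StdNear s x)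
    (hX : VecNear X x) : StdNear (fun y ↦ g.stdNabla s y (X y)) x := by
  have h1 : StdNear (fun y ↦ g.stdD s y (X y)) x :=
    stdNear_mk (hs.fst.dd hX) (g.vecNear_lc hX hs.mid) (hs.snd.dd hX)
  have h2 : StdNear (fun y ↦ g.down y (X y) (s y)) x :=
    stdNear_mk (.const 0 x) (hX.smul hs.fst) (g.funNear_inner hX hs.mid).neg
  have h3 : StdNear (fun y ↦ g.up y (g.schoutenUp y (X y)) (s y)) x :=
    stdNear_mk (g.funNear_inner (g.vecNear_schoutenUp hX) hs.mid).neg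
      ((g.vecNear_schoutenUp hX).smul hs.snd) (.const 0 x)
  exact (h1.add h2).add h3

end Metric

/-! ### Adapted frames -/

/-- The frame of the standard tractor bundle given by a family of tangent vectors. -/
def stdVec (x : M) (e : Fin (p + q) → TangentSpace (𝓡 (p + q)) x) :
    StdIdx (p + q) → Std (p := p) (q := q) x
  | none => (1, 0, 0)
  | some none => (0, 0, 1)
  | some (some i) => (0, e i, 0)

/-- The coefficients of a standard tractor in an adapted frame, given those of its middle slot. -/
def stdCoef (ρ σ : ℝ) (c : Fin (p + q) → ℝ) : StdIdx (p + q) → ℝ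
  | none => ρ
  | some none => σ
  | some (some i) => c i

theorem sum_stdCoef (x : M) (e : Fin (p + q) → TangentSpace (𝓡 (p + q)) x)
    (ρ σ : ℝ) (c : Fin (p + q) → ℝ) :
    ∑ b, stdCoef ρ σ c b • stdVec x e b
      = ((ρ, ∑ i, c i • e i, σ) : Std (p := p) (q := q) x) := by
  rw [Fintype.sum_option, Fintype.sum_option]
  simp only [stdCoef, stdVec]
  have h : ∑ i, c i • ((0, e i, 0) : Std (p := p) (q := q) x) = (0, ∑ i, c i • e i, 0) := by
    refine Prod.ext ?_ (Prod.ext ?_ ?_)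
    · simp [Prod.fst_sum]
    · simp [Prod.fst_sum, Prod.snd_sum]
    · simp [Prod.snd_sum]
  rw [h]
  simp

theorem stdNear_stdVec {x : M} (b : StdIdx (p + q)) :
    StdNear (fun y ↦ stdVec y (fun i ↦ ext (bas x i) y) b) x := by
  rcases b with _ | _ | i
  · exact stdNear_mk (.const 1 x) (vecNear_zero x) (.const 0 x)
  · exact stdNear_mk (.const 0 x) (vecNear_zero x) (.const 1 x)
  · exact stdNear_mk (.const 0 x) (vecNear_ext _) (.const 0 x)

end StdBundle

/-! ## Tensor powers of the standard tractor bundle -/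

section Tensors

variable {p q l : ℕ} {M : Type*} [TopologicalSpace M] [ChartedSpace (Model p q) M]

/-- Multilinearity of an element of the type `Tens`. -/
def IsMul {x : M} (t : Tens p q l x) : Prop :=
  ∃ m : MultilinearMap ℝ (fun _ : Fin l ↦ Std (p := p) (q := q) x) ℝ, ⇑m = t

theorem IsMul.update_add {x : M} {t : Tens p q l x} (h : IsMul t)
    (w : Fin l → Std (p := p) (q := q) x) (i : Fin l) (a b : Std (p := p) (q := q) x) :
    t (Function.update w i (a + b)) = t (Function.update w i a) + t (Function.update w i b) := by
  obtain ⟨m, rfl⟩ := h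
  exact m.map_update_add w i a b

theorem IsMul.update_smul {x : M} {t : Tens p q l x} (h : IsMul t)
    (w : Fin l → Std (p := p) (q := q) x) (i : Fin l) (c : ℝ) (a : Std (p := p) (q := q) x) :
    t (Function.update w i (c • a)) = c * t (Function.update w i a) := by
  obtain ⟨m, rfl⟩ := h
  exact m.map_update_smul w i c a

theorem IsMul.of_update {x : M} {t : Tens p q l x}
    (hadd : ∀ w i a b, t (Function.update w i (a + b))
      = t (Function.update w i a) + t (Function.update w i b))
    (hsmul : ∀ w i (c : ℝ) a, t (Function.update w i (c • a)) = c * t (Function.update w i a)) :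
    IsMul t :=
  ⟨MultilinearMap.mk' t hadd hsmul, rfl⟩

/-- Expansion of a derivation-like sum over the slots, with one slot singled out. -/
theorem sum_update_update {l : ℕ} {S A : Type*} [AddCommMonoid A] (m : (Fin l → S) → A)
    (a b : Fin l → S) (i : Fin l) (s₀ s₁ : S) :
    ∑ j, m (Function.update (Function.update a i s₀) j (Function.update b i s₁ j))
      = m (Function.update a i s₁)
        + ∑ j ∈ Finset.univ.erase i, m (Function.update (Function.update a j (b j)) i s₀) := by
  rw [← Finset.add_sum_erase _ _ (Finset.mem_univ i)]
  congr 1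
  · rw [Function.update_self, Function.update_idem]
  · refine Finset.sum_congr rfl fun j hj ↦ ?_
    have hji : j ≠ i := Finset.ne_of_mem_erase hj
    rw [Function.update_of_ne hji, Function.update_comm hji.symm]

variable [IsManifold (𝓡 (p + q)) ∞ M] (g : Metric p q M)

variable {t t' : Π y : M, Tens p q l y} {x : M} {f : M → ℝ}

theorem TensSmoothAt.congr (h : TensSmoothAt t x) (ht : ∀ᶠ y in 𝓝 x, t' y = t y) :
    TensSmoothAt t' x := fun w hw ↦
  (h w hw).congr_of_eventuallyEq (ht.mono fun y hy ↦ by simp only [hy])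

theorem TensSmoothAt.smul_fun (hf : ContMDiffAt (𝓡 (p + q)) 𝓘(ℝ, ℝ) ∞ f x)
    (h : TensSmoothAt t x) : TensSmoothAt (fun y ↦ f y • t y) x :=
  fun w hw ↦ hf.mul (h w hw)

theorem TensSmoothAt.neg (h : TensSmoothAt t x) : TensSmoothAt (fun y ↦ - t y) x :=
  fun w hw ↦ (h w hw).neg

theorem TensSmoothAt.sub (h : TensSmoothAt t x) (h' : TensSmoothAt t' x) :
    TensSmoothAt (fun y ↦ t y - t' y) x :=
  fun w hw ↦ (h w hw).sub (h' w hw)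

theorem TensSmoothAt.sum {ι : Type*} {s : Finset ι} {t : ι → Π y : M, Tens p q l y}
    (h : ∀ i ∈ s, TensSmoothAt (t i) x) : TensSmoothAt (fun y ↦ ∑ i ∈ s, t i y) x := by
  intro w hw
  simp only [Finset.sum_apply]
  exact ContMDiffAt.sum fun i hi ↦ h i hi w hw

/-- A criterion for smoothness in terms of the components in a frame. -/
theorem tensSmoothAt_of_frame (hm : ∀ᶠ y in 𝓝 x, IsMul (t y))
    (h : ∀ J : Fin l → StdIdx (p + q), ContMDiffAt (𝓡 (p + q)) 𝓘(ℝ, ℝ) ∞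
      (fun y ↦ t y (fun j ↦ stdVec y (fun i ↦ ext (bas x i) y) (J j))) x) :
    TensSmoothAt t x := by
  intro w hw
  have h1 : ∀ᶠ y in 𝓝 x, t y (fun j ↦ w j y) = ∑ J : Fin l → StdIdx (p + q),
      (∏ j, stdCoef (w j y).1 (w j y).2.2 (fun i ↦ cf x i (fun z ↦ (w j z).2.1) y) (J j)) *
        t y (fun j ↦ stdVec y (fun i ↦ ext (bas x i) y) (J j)) := by
    filter_upwards [hm, sum_cf (p := p) (q := q) x] with y hy hcf
    obtain ⟨m, hm⟩ := hy
    have h2 : (fun j ↦ w j y) = fun j ↦ ∑ b, stdCoef (w j y).1 (w j y).2.2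
        (fun i ↦ cf x i (fun z ↦ (w j z).2.1) y) b • stdVec y (fun i ↦ ext (bas x i) y) b := by
      funext j
      rw [sum_stdCoef, hcf]
    rw [h2, ← hm, MultilinearMap.map_sum]
    refine Finset.sum_congr rfl fun J _ ↦ ?_
    rw [MultilinearMap.map_smul_univ, smul_eq_mul]
  refine ContMDiffAt.congr_of_eventuallyEq ?_ h1
  refine ContMDiffAt.sum fun J _ ↦ ContMDiffAt.mul (ContMDiffAt.prod fun j _ ↦ ?_) (h J)
  rcases J j with _ | _ | i
  · exact (hw j).1
  · exact (hw j).2.2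
  · exact (contMDiffAt_cf (p := p) (q := q) x i).self_of_nhds _ (hw j).2.1

/-- The formula for the derivative of a tensor field, evaluated on tractor fields. -/
def Metric.nablaF (t : Π y : M, Tens p q l y) (W : Fin l → Π y : M, Std (p := p) (q := q) y)
    (x : M) (v : TangentSpace (𝓡 (p + q)) x) : ℝ :=
  dd (fun y ↦ t y (fun j ↦ W j y)) x v
    - ∑ j, t x (Function.update (fun k ↦ W k x) j (g.stdNabla (W j) x v))

namespace Metric

/-- Isolates slot `i`: the derivative of `s` enters only the first two terms, while the sum over the
other slots involves just `s x`. Tensoriality can thus be tested one slot at a time. -/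
theorem nablaF_update (t : Π y : M, Tens p q l y)
    (W : Fin l → Π y : M, Std (p := p) (q := q) y) (i : Fin l)
    (s : Π y : M, Std (p := p) (q := q) y) (x : M) (v : TangentSpace (𝓡 (p + q)) x) :
    g.nablaF t (Function.update W i s) x v
      = dd (fun y ↦ t y (Function.update (fun j ↦ W j y) i (s y))) x v
        - (t x (Function.update (fun k ↦ W k x) i (g.stdNabla s x v))
          + ∑ j ∈ Finset.univ.erase i, t x (Function.update (Function.update (fun k ↦ W k x) j
              (g.stdNabla (W j) x v)) i (s x))) := by
  have h1 : ∀ y : M, (fun j ↦ Function.update W i s j y)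
      = Function.update (fun j ↦ W j y) i (s y) := by
    intro y
    funext j
    rcases eq_or_ne j i with rfl | h
    · simp
    · simp [h]
  have h2 : (fun j ↦ g.stdNabla (Function.update W i s j) x v)
      = Function.update (fun j ↦ g.stdNabla (W j) x v) i (g.stdNabla s x v) := by
    funext j
    rcases eq_or_ne j i with rfl | h
    · simp
    · simp [h]
  rw [← sum_update_update (t x) (fun k ↦ W k x) (fun j ↦ g.stdNabla (W j) x v) i (s x), ← h2]
  simp only [nablaF, h1]

theorem contMDiffAt_update (ht : TensSmoothAt t x)
    {W : Fin l → Π y : M, Std (p := p) (q := q) y} (hW : ∀ j, StdSmoothAt (W j) x) (i : Fin l)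
    {s : Π y : M, Std (p := p) (q := q) y} (hs : StdSmoothAt s x) :
    ContMDiffAt (𝓡 (p + q)) 𝓘(ℝ, ℝ) ∞
      (fun y ↦ t y (Function.update (fun j ↦ W j y) i (s y))) x := by
  have h := ht (Function.update W i s) fun j ↦ by
    rcases eq_or_ne j i with rfl | h
    · simpa using hs
    · simpa [h] using hW j
  convert h using 3 with y
  funext j
  rcases eq_or_ne j i with rfl | h
  · simp
  · simp [h]

variable {W : Fin l → Π y : M, Std (p := p) (q := q) y}
  {s s' : Π y : M, Std (p := p) (q := q) y}

theorem nablaF_add (hm : ∀ᶠ y in 𝓝 x, IsMul (t y)) (ht : TensSmoothAt t x)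
    (hW : ∀ j, StdNear (W j) x) (i : Fin l) (hs : StdNear s x) (hs' : StdNear s' x)
    (v : TangentSpace (𝓡 (p + q)) x) :
    g.nablaF t (Function.update W i (s + s')) x v
      = g.nablaF t (Function.update W i s) x v + g.nablaF t (Function.update W i s') x v := by
  have h1 := dd_add (contMDiffAt_update ht (fun j ↦ (hW j).self) i hs.self)
    (contMDiffAt_update ht (fun j ↦ (hW j).self) i hs'.self) v
  rw [← dd_congr (hm.mono fun y hy ↦ hy.update_add (fun j ↦ W j y) i (s y) (s' y))] at h1
  simp only [nablaF_update, Pi.add_apply, h1, g.stdNabla_add hs hs', hm.self_of_nhds.update_add,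
    Finset.sum_add_distrib]
  ring

/-- The Leibniz term of the outer derivative cancels the one produced by `stdNabla (f • s)` in slot
`i`. -/
theorem nablaF_smul (hm : ∀ᶠ y in 𝓝 x, IsMul (t y)) (ht : TensSmoothAt t x)
    (hW : ∀ j, StdNear (W j) x) (i : Fin l) (hf : FunNear (p := p) (q := q) f x)
    (hs : StdNear s x) (v : TangentSpace (𝓡 (p + q)) x) :
    g.nablaF t (Function.update W i (f • s)) x v
      = f x * g.nablaF t (Function.update W i s) x v := by
  have h1 := dd_mul hf.self (contMDiffAt_update ht (fun j ↦ (hW j).self) i hs.self) v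
  rw [← dd_congr (hm.mono fun y hy ↦ hy.update_smul (fun j ↦ W j y) i (f y) (s y))] at h1
  simp only [nablaF_update, Pi.smul_apply', h1, g.stdNabla_smul hf hs, hm.self_of_nhds.update_add,
    hm.self_of_nhds.update_smul, ← Finset.mul_sum]
  ring

theorem nablaF_congr {W' : Fin l → Π y : M, Std (p := p) (q := q) y}
    (h : ∀ j, ∀ᶠ y in 𝓝 x, W' j y = W j y) (v : TangentSpace (𝓡 (p + q)) x) :
    g.nablaF t W' x v = g.nablaF t W x v := by
  have h1 : ∀ᶠ y in 𝓝 x, (fun j ↦ W' j y) = fun j ↦ W j y :=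
    (eventually_all.2 h).mono fun y hy ↦ funext hy
  rw [nablaF, nablaF, h1.self_of_nhds,
    dd_congr (f := fun y ↦ t y (fun j ↦ W j y)) (h1.mono fun y hy ↦ by rw [hy])]
  simp only [fun j ↦ g.stdNabla_congr (h j) v]

theorem nablaF_ext (hm : ∀ᶠ y in 𝓝 x, IsMul (t y)) (ht : TensSmoothAt t x)
    (hW : ∀ j, StdNear (W j) x) (i : Fin l) (hs : StdNear s x)
    (v : TangentSpace (𝓡 (p + q)) x) :
    g.nablaF t (Function.update W i s) x v
      = g.nablaF t (Function.update W i (stdExt (s x))) x v := by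
  refine stdTensorial (fun s ↦ g.nablaF t (Function.update W i s) x v)
    (fun s s' hs hs' ↦ g.nablaF_add hm ht hW i hs hs' v)
    (fun f s hf hs ↦ g.nablaF_smul hm ht hW i hf hs v) (fun s s' hs h ↦ ?_) hs
  refine g.nablaF_congr (fun j ↦ ?_) v
  rcases eq_or_ne j i with rfl | hj
  · simpa using h
  · simp [hj]

theorem nabla_eq_nablaF_stdExt (w : Fin l → Std (p := p) (q := q) x)
    (v : TangentSpace (𝓡 (p + q)) x) :
    g.nabla t x v w = g.nablaF t (fun j ↦ stdExt (w j)) x v := by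
  simp only [nabla, nablaF, stdExt_self]

/-- The derivative of a tensor field may be computed with arbitrary extensions. -/
theorem nablaF_eq_nabla (hm : ∀ᶠ y in 𝓝 x, IsMul (t y)) (ht : TensSmoothAt t x)
    (hW : ∀ j, StdNear (W j) x) (v : TangentSpace (𝓡 (p + q)) x) :
    g.nablaF t W x v = g.nabla t x v (fun j ↦ W j x) := by
  -- The slots are exchanged one after another; `S` collects those where `W j` has been replaced by
  -- the canonical extension.
  have key : ∀ S : Finset (Fin l), g.nablaF t W x v
      = g.nablaF t (fun j ↦ if j ∈ S then stdExt (W j x) else W j) x v := by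
    intro S
    induction S using Finset.induction_on with
    | empty => simp
    | insert i S hi ih =>
      rw [ih]
      have hW' : ∀ j, StdNear (if j ∈ S then stdExt (W j x) else W j) x := by
        intro j
        split_ifs
        · exact stdNear_stdExt _
        · exact hW j
      have h := g.nablaF_ext hm ht hW' i (hW i) v
      convert h using 2
      · funext j
        rcases eq_or_ne j i with rfl | hj
        · simp [hi]
        · simp [hj]
      · funext j
        rcases eq_or_ne j i with rfl | hj
        · simp
        · simp [hj]
  rw [key Finset.univ, nabla_eq_nablaF_stdExt]
  simp

/-- Since any extensions may be used, `a + b` can be extended by `stdExt a + stdExt b`, and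
linearity in a slot reduces to that of `nablaF`. -/
theorem isMul_nabla (hm : ∀ᶠ y in 𝓝 x, IsMul (t y)) (ht : TensSmoothAt t x)
    (v : TangentSpace (𝓡 (p + q)) x) : IsMul (g.nabla t x v) := by
  have key : ∀ (w : Fin l → Std (p := p) (q := q) x) (i : Fin l)
      (s : Π y : M, Std (p := p) (q := q) y), StdNear s x →
      g.nabla t x v (Function.update w i (s x))
        = g.nablaF t (Function.update (fun j ↦ stdExt (w j)) i s) x v := by
    intro w i s hs
    rw [nablaF_eq_nabla g hm ht]
    · congr 1
      funext j
      rcases eq_or_ne j i with rfl | hj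
      · simp
      · simp [hj]
    · intro j
      rcases eq_or_ne j i with rfl | hj
      · simpa using hs
      · simpa [hj] using stdNear_stdExt _
  refine IsMul.of_update (fun w i a b ↦ ?_) fun w i c a ↦ ?_
  · have h1 := key w i _ (stdNear_stdExt a)
    have h2 := key w i _ (stdNear_stdExt b)
    have h3 := key w i _ ((stdNear_stdExt a).add (stdNear_stdExt b))
    rw [g.nablaF_add hm ht (fun j ↦ stdNear_stdExt _) i (stdNear_stdExt a) (stdNear_stdExt b),
      ← h1, ← h2] at h3
    simpa using h3
  · have h1 := key w i _ (stdNear_stdExt a)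
    have h3 := key w i _ ((stdNear_stdExt a).smul (.const c x))
    rw [g.nablaF_smul hm ht (fun j ↦ stdNear_stdExt _) i (.const c x) (stdNear_stdExt a),
      ← h1] at h3
    simpa using h3

theorem nabla_congr (h : ∀ᶠ y in 𝓝 x, t' y = t y) (v : TangentSpace (𝓡 (p + q)) x) :
    g.nabla t' x v = g.nabla t x v := by
  funext w
  rw [nabla, nabla, h.self_of_nhds, dd_congr (f := fun y ↦ t y (fun j ↦ stdExt (w j) y))
    (h.mono fun y hy ↦ by rw [hy])]

theorem nabla_add (h : TensSmoothAt t x) (h' : TensSmoothAt t' x)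
    (v : TangentSpace (𝓡 (p + q)) x) :
    g.nabla (fun y ↦ t y + t' y) x v = g.nabla t x v + g.nabla t' x v := by
  funext w
  have hw : ∀ j, StdSmoothAt (stdExt (w j)) x := fun j ↦ (stdNear_stdExt _).self
  simp only [nabla, Pi.add_apply, dd_add (h _ hw) (h' _ hw), Finset.sum_add_distrib]
  ring

theorem nabla_smul (hf : ContMDiffAt (𝓡 (p + q)) 𝓘(ℝ, ℝ) ∞ f x) (h : TensSmoothAt t x)
    (v : TangentSpace (𝓡 (p + q)) x) :
    g.nabla (fun y ↦ f y • t y) x v = f x • g.nabla t x v + dd f x v • t x := by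
  funext w
  have hw : ∀ j, StdSmoothAt (stdExt (w j)) x := fun j ↦ (stdNear_stdExt _).self
  simp only [nabla, Pi.add_apply, Pi.smul_apply, smul_eq_mul, dd_mul hf (h _ hw),
    ← Finset.mul_sum, stdExt_self]
  ring

theorem nabla_add_vec (hm : IsMul (t x)) (v v' : TangentSpace (𝓡 (p + q)) x) :
    g.nabla t x (v + v') = g.nabla t x v + g.nabla t x v' := by
  funext w
  simp only [nabla, Pi.add_apply, dd_add_vec, g.stdNabla_add_vec (stdNear_stdExt _),
    hm.update_add, Finset.sum_add_distrib]
  ring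

theorem nabla_smul_vec (hm : IsMul (t x)) (c : ℝ) (v : TangentSpace (𝓡 (p + q)) x) :
    g.nabla t x (c • v) = c • g.nabla t x v := by
  funext w
  simp only [nabla, Pi.smul_apply, smul_eq_mul, dd_smul_vec,
    g.stdNabla_smul_vec (stdNear_stdExt _), hm.update_smul, ← Finset.mul_sum]
  ring

theorem tensSmoothAt_nabla (hm : ∀ᶠ y in 𝓝 x, IsMul (t y)) (ht : ∀ᶠ y in 𝓝 x, TensSmoothAt t y)
    {X : Π y : M, TangentSpace (𝓡 (p + q)) y} (hX : VecNear X x) :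
    TensSmoothAt (fun y ↦ g.nabla t y (X y)) x := by
  refine tensSmoothAt_of_frame ?_ fun J ↦ ?_
  · filter_upwards [hm.eventually_nhds, ht] with y h1 h2 using g.isMul_nabla h1 h2 _
  · set W : Fin l → Π y : M, Std (p := p) (q := q) y :=
      fun j y ↦ stdVec y (fun i ↦ ext (bas x i) y) (J j) with hW
    have hWn : ∀ j, StdNear (W j) x := fun j ↦ stdNear_stdVec (J j)
    have h1 : ∀ᶠ y in 𝓝 x, g.nabla t y (X y) (fun j ↦ W j y) = g.nablaF t W y (X y) := by
      filter_upwards [hm.eventually_nhds, ht,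
        eventually_all.2 fun j ↦ (hWn j).eventually_nhds] with y h1 h2 h3
      exact (g.nablaF_eq_nabla h1 h2 h3 _).symm
    refine ContMDiffAt.congr_of_eventuallyEq ?_ h1
    refine ContMDiffAt.sub ?_ (ContMDiffAt.sum fun j _ ↦ ?_)
    · have h2 : FunNear (p := p) (q := q) (fun y ↦ t y (fun j ↦ W j y)) x := by
        filter_upwards [ht, eventually_all.2 hWn] with y h3 h4 using h3 W h4
      exact (h2.dd hX).self
    · exact contMDiffAt_update ht.self_of_nhds (fun j ↦ (hWn j).self) j
        (g.stdNear_stdNabla (hWn j) hX).self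

end Metric

end Tensors

/-! ## One-parameter groups of isometries -/

section Isometries

variable {E : Type*} [NormedAddCommGroup E] [NormedSpace ℝ E] [FiniteDimensional ℝ E]

/-- Compare determinants in `Fᵀ G F = G`, where the Gram matrix `G` is invertible. -/
theorem det_sq_of_isometry {B : LinearMap.BilinForm ℝ E} (hB : B.Nondegenerate) (f : E →ₗ[ℝ] E)
    (hf : ∀ a b, B (f a) (f b) = B a b) : LinearMap.det f * LinearMap.det f = 1 := by
  classical
  set b := Module.finBasis ℝ E
  have h1 : B.comp f f = B := by
    ext x y
    exact hf x y
  have h2 := LinearMap.BilinForm.toMatrix_comp b b B f f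
  have h3 := congrArg Matrix.det h2
  rw [h1, Matrix.det_mul, Matrix.det_mul, Matrix.det_transpose, LinearMap.det_toMatrix] at h3
  have h4 : (LinearMap.BilinForm.toMatrix b B).det ≠ 0 :=
    Matrix.nondegenerate_iff_det_ne_zero.1 (hB.toMatrix b)
  have h5 : (LinearMap.BilinForm.toMatrix b B).det * (LinearMap.det f * LinearMap.det f - 1)
      = 0 := by
    linear_combination -h3
  linarith [(mul_eq_zero.1 h5).resolve_left h4]

/-- A skew endomorphism is the velocity of a curve of isometries of determinant one. -/
theorem exists_isometry_curve {B : LinearMap.BilinForm ℝ E} (hB : B.Nondegenerate)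
    (A : E →ₗ[ℝ] E) (hA : ∀ a b, B (A a) b + B a (A b) = 0) :
    ∃ e : ℝ → E →ₗ[ℝ] E, (∀ s a b, B (e s a) (e s b) = B a b) ∧ (∀ s, LinearMap.det (e s) = 1) ∧
      e 0 = LinearMap.id ∧ ∀ a, HasDerivAt (fun s ↦ e s a) (A a) 0 := by
  have : CompleteSpace E := FiniteDimensional.complete ℝ E
  set A' : E →L[ℝ] E := LinearMap.toContinuousLinearMap A with hA'
  set c : ℝ → E →L[ℝ] E := fun s ↦ NormedSpace.exp (s • A') with hc
  have hd : ∀ s, HasDerivAt c (A' * c s) s := fun s ↦ hasDerivAt_exp_smul_const' A' s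
  have hda : ∀ a s, HasDerivAt (fun s ↦ c s a) (A (c s a)) s := fun a s ↦ by
    have := (hd s).clm_apply (hasDerivAt_const s a)
    simpa [hA'] using this
  have h0 : c 0 = 1 := by simp [hc]
  have hpres : ∀ s a b, B (c s a) (c s b) = B a b := by
    intro s a b
    have h1 : ∀ s, HasDerivAt (fun s ↦ B (c s a) (c s b)) 0 s := by
      intro s
      have h2 := (LinearMap.toContinuousBilinearMap B).hasDerivAt_of_bilinear
        (fun _ ↦ hda a s) (fun _ ↦ hda b s)
      have h3 := hA (c s a) (c s b)
      have h4 : LinearMap.toContinuousBilinearMap B (c s a) (A (c s b))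
          + LinearMap.toContinuousBilinearMap B (A (c s a)) (c s b) = 0 := by
        rw [← h3, add_comm]
        rfl
      rw [h4] at h2
      exact h2
    have h4 := is_const_of_deriv_eq_zero (fun s ↦ (h1 s).differentiableAt)
      (fun s ↦ (h1 s).deriv) s 0
    simpa [h0] using h4
  refine ⟨fun s ↦ c s, hpres, fun s ↦ ?_, ?_, fun a ↦ ?_⟩
  -- The exponential is the square of an isometry, whose determinant squares to one; no
  -- connectedness argument is needed.
  · have h1 : c s = c (s / 2) * c (s / 2) := by
      let : NormedAlgebra ℚ (E →L[ℝ] E) := NormedAlgebra.restrictScalars ℚ ℝ _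
      simp only [hc]
      rw [← NormedSpace.exp_add_of_commute (Commute.refl _), ← add_smul, add_halves]
    have h2 : ((c s : E →L[ℝ] E) : E →ₗ[ℝ] E)
        = (c (s / 2) : E →ₗ[ℝ] E) * (c (s / 2) : E →ₗ[ℝ] E) := by
      rw [h1]
      rfl
    change LinearMap.det ((c s : E →L[ℝ] E) : E →ₗ[ℝ] E) = 1
    rw [h2, map_mul]
    exact det_sq_of_isometry hB _ (hpres _)
  · change ((c 0 : E →L[ℝ] E) : E →ₗ[ℝ] E) = LinearMap.id
    rw [h0]
    rfl
  · simpa [h0] using hda a 0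

/-- The derivative of a multilinear form along curves. -/
theorem hasDerivAt_multilinear {l : ℕ} (m : MultilinearMap ℝ (fun _ : Fin l ↦ E) ℝ)
    {W : Fin l → ℝ → E} {W' : Fin l → E} {s : ℝ} (h : ∀ j, HasDerivAt (W j) (W' j) s) :
    HasDerivAt (fun s ↦ m (fun j ↦ W j s))
      (∑ j, m (Function.update (fun k ↦ W k s) j (W' j))) s := by
  have hcont : Continuous m := by
    set b := Module.finBasis ℝ E
    have h1 : (m : (Fin l → E) → ℝ) = fun w ↦ ∑ J : Fin l → Fin (Module.finrank ℝ E),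
        (∏ j, b.coord (J j) (w j)) * m (fun j ↦ b (J j)) := by
      funext w
      have h2 : w = fun j ↦ ∑ i, b.coord i (w j) • b i := by
        funext j
        exact (b.sum_repr (w j)).symm
      conv_lhs => rw [h2, MultilinearMap.map_sum]
      refine Finset.sum_congr rfl fun J _ ↦ ?_
      rw [MultilinearMap.map_smul_univ, smul_eq_mul]
    rw [h1]
    refine continuous_finsetSum _ fun J _ ↦ (continuous_finsetProd _ fun j _ ↦ ?_).mul
      continuous_const
    exact (LinearMap.continuous_of_finiteDimensional _).comp (continuous_apply j)
  let m' : ContinuousMultilinearMap ℝ (fun _ : Fin l ↦ E) ℝ := ⟨m, hcont⟩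
  have h1 := HasFDerivAt.multilinear_comp m' (fun j ↦ (h j).hasFDerivAt)
  have h2 := h1.hasDerivAt
  have h3 : (∑ j, m'.toContinuousLinearMap (fun j ↦ W j s) j ∘L
      ContinuousLinearMap.toSpanSingleton ℝ (W' j)) 1
      = ∑ j, m (Function.update (fun k ↦ W k s) j (W' j)) := by
    rw [sum_apply]
    refine Finset.sum_congr rfl fun j _ ↦ ?_
    simp [m']
    rfl
  rw [← h3]
  exact h2

/-- A space of multilinear forms has a dual family given by evaluation at finitely many points. -/
theorem exists_evaluation_frame {l : ℕ} (V : Submodule ℝ ((Fin l → E) → ℝ))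
    (hV : ∀ t ∈ V, ∃ m : MultilinearMap ℝ (fun _ : Fin l ↦ E) ℝ, ⇑m = t) :
    ∃ (N : ℕ) (w : (Fin l → Fin N) → Fin l → E) (r : (Fin l → Fin N) → (Fin l → E) → ℝ),
      (∀ J, r J ∈ V) ∧ ∀ t ∈ V, ∀ a, t a = ∑ J, t (w J) * r J a := by
  set b := Module.finBasis ℝ E
  -- A multilinear form is determined by its values on tuples of basis vectors, so a left inverse of
  -- `ev` recovers `t` as a fixed finite combination of these values. Derivatives of curves in `V`
  -- then stay in `V` without any topology on the function space.
  let ev : V →ₗ[ℝ] ((Fin l → Fin (Module.finrank ℝ E)) → ℝ) :=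
    { toFun := fun t J ↦ (t : (Fin l → E) → ℝ) fun j ↦ b (J j)
      map_add' := fun _ _ ↦ rfl
      map_smul' := fun _ _ ↦ rfl }
  have hev : LinearMap.ker ev = ⊥ := by
    rw [LinearMap.ker_eq_bot']
    rintro ⟨t, ht⟩ h
    obtain ⟨m, rfl⟩ := hV t ht
    have h1 : m = 0 := Module.Basis.ext_multilinear (fun _ ↦ b) fun J ↦ congrFun h J
    ext a
    simp [h1]
  obtain ⟨R, hR⟩ := LinearMap.exists_leftInverse_of_injective ev hev
  refine ⟨_, fun J j ↦ b (J j), fun J ↦ R (Pi.single J 1), fun J ↦ (R _).2, fun t ht a ↦ ?_⟩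
  have h1 : R (ev ⟨t, ht⟩) = ⟨t, ht⟩ := congrArg (fun f ↦ f ⟨t, ht⟩) hR
  have h2 := LinearMap.pi_apply_eq_sum_univ R (ev ⟨t, ht⟩)
  rw [h1] at h2
  have h3 := congrFun (congrArg Subtype.val h2) a
  simp only [Submodule.coe_sum, Submodule.coe_smul, Finset.sum_apply, Pi.smul_apply,
    smul_eq_mul] at h3
  rw [h3]
  refine Finset.sum_congr rfl fun J _ ↦ ?_
  have h4 : (fun K ↦ if J = K then (1 : ℝ) else 0) = Pi.single J 1 := by
    funext K
    simp [Pi.single_apply, eq_comm]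
  rw [h4]
  rfl

/-- A space of multilinear forms that is invariant under isometries of determinant one is
invariant under skew endomorphisms. -/
theorem mem_of_isSkew {B : LinearMap.BilinForm ℝ E} (hB : B.Nondegenerate) {l : ℕ}
    {V : Submodule ℝ ((Fin l → E) → ℝ)}
    (hV : ∀ t ∈ V, ∃ m : MultilinearMap ℝ (fun _ : Fin l ↦ E) ℝ, ⇑m = t)
    (hinv : ∀ f : E →ₗ[ℝ] E, (∀ a b, B (f a) (f b) = B a b) → LinearMap.det f = 1 →
      ∀ t ∈ V, (fun w : Fin l → E ↦ t (fun j ↦ f (w j))) ∈ V)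
    (A : E →ₗ[ℝ] E) (hA : ∀ a b, B (A a) b + B a (A b) = 0) {t : (Fin l → E) → ℝ} (ht : t ∈ V) :
    (fun w ↦ ∑ j, t (Function.update w j (A (w j)))) ∈ V := by
  obtain ⟨e, he1, he2, he3, he4⟩ := exists_isometry_curve hB A hA
  obtain ⟨N, w, r, hr, hsum⟩ := exists_evaluation_frame V hV
  obtain ⟨m, hm⟩ := hV t ht
  have hd : ∀ a : Fin l → E, HasDerivAt (fun s ↦ t (fun j ↦ e s (a j)))
      (∑ j, t (Function.update a j (A (a j)))) 0 := by
    intro a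
    have h := hasDerivAt_multilinear m fun j ↦ he4 (a j)
    simp only [he3, LinearMap.id_apply] at h
    rwa [hm] at h
  -- The left side is the velocity of the curve `t ∘ e s` in `V`; differentiating its finite
  -- expansion differentiates only the coefficients.
  have h1 : (fun w ↦ ∑ j, t (Function.update w j (A (w j))))
      = ∑ J, (∑ j, t (Function.update (w J) j (A (w J j)))) • r J := by
    funext a
    have h2 : (fun s ↦ t (fun j ↦ e s (a j)))
        = fun s ↦ ∑ J, t (fun j ↦ e s (w J j)) * r J a := by
      funext s
      exact hsum _ (hinv (e s) (he1 s) (he2 s) t ht) a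
    have h3 := HasDerivAt.fun_sum (u := Finset.univ)
      fun J (_ : J ∈ Finset.univ) ↦ (hd (w J)).mul_const (r J a)
    rw [← h2] at h3
    rw [(hd a).unique h3, Finset.sum_apply]
    rfl
  rw [h1]
  exact V.sum_mem fun J _ ↦ V.smul_mem _ (hr J)

end Isometries

/-! ## Tractor bundles -/

section TractorBundle

variable {p q l : ℕ}

/-- The standard inner product on the typical fibre as a bilinear form. -/
def stdBilin (p q : ℕ) : LinearMap.BilinForm ℝ (StdModel p q) :=
  LinearMap.mk₂ ℝ stdForm
    (fun a a' b ↦ by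
      simp only [stdForm, Prod.fst_add, Prod.snd_add, PiLp.add_apply, add_mul, mul_add,
        Finset.sum_add_distrib]
      ring)
    (fun c a b ↦ by
      simp only [stdForm, Prod.smul_fst, Prod.smul_snd, PiLp.smul_apply, smul_eq_mul, mul_add,
        Finset.mul_sum]
      congr 1
      · ring
      · exact Finset.sum_congr rfl fun i _ ↦ by ring)
    (fun a b b' ↦ by
      simp only [stdForm, Prod.fst_add, Prod.snd_add, PiLp.add_apply, mul_add,
        Finset.sum_add_distrib]
      ring)
    (fun c a b ↦ by
      simp only [stdForm, Prod.smul_fst, Prod.smul_snd, PiLp.smul_apply, smul_eq_mul, mul_add,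
        Finset.mul_sum]
      congr 1
      · ring
      · exact Finset.sum_congr rfl fun i _ ↦ by ring)

theorem eq_zero_of_stdForm {a : StdModel p q} (h : ∀ b, stdForm a b = 0) : a = 0 := by
  refine Prod.ext ?_ (Prod.ext ?_ ?_)
  · simpa [stdForm] using h (0, 0, 1)
  · ext i
    have := h (0, EuclideanSpace.single i 1, 0)
    simpa [stdForm, sign_ne_zero, PiLp.single_apply] using this
  · simpa [stdForm] using h (1, 0, 0)

theorem stdForm_comm (a b : StdModel p q) : stdForm a b = stdForm b a := by
  simp only [stdForm, mul_comm (a.2.1 _)]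
  ring

theorem stdBilin_nondegenerate : (stdBilin p q).Nondegenerate := by
  constructor
  · exact fun a h ↦ eq_zero_of_stdForm h
  · exact fun b h ↦ eq_zero_of_stdForm fun a ↦ by rw [stdForm_comm]; exact h a

variable {M : Type*} [TopologicalSpace M] [ChartedSpace (Model p q) M]
  [IsManifold (𝓡 (p + q)) ∞ M] (g : Metric p q M)

theorem isometry_bijective {x : M} (u : StdModel p q →ₗ[ℝ] Std (p := p) (q := q) x)
    (hu : ∀ a b, g.form x (u a) (u b) = stdForm a b) : Function.Bijective u := by
  have hinj : Function.Injective u := by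
    rw [injective_iff_map_eq_zero]
    intro a ha
    refine eq_zero_of_stdForm fun b ↦ ?_
    rw [← hu, ha]
    simp [Metric.form]
  exact ⟨hinj, (LinearMap.injective_iff_surjective_of_finrank_eq_finrank rfl).1 hinj⟩

/-- The properties of a tractor bundle that are used below. -/
structure IsInvariant (T : Π x : M, Submodule ℝ (Tens p q l x)) : Prop where
  isMul (x : M) : ∀ t ∈ T x, IsMul t
  act (x : M) (A : Std (p := p) (q := q) x →ₗ[ℝ] Std (p := p) (q := q) x) :
    g.IsSkew x A → ∀ t ∈ T x, tensAct A t ∈ T x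
  nabla (x : M) (s : Π y : M, Tens p q l y) (v : TangentSpace (𝓡 (p + q)) x) :
    (∀ᶠ y in 𝓝 x, s y ∈ T y) → TensSmoothAt s x → g.nabla s x v ∈ T x

variable {T : Π x : M, Submodule ℝ (Tens p q l x)}

/-- In an isometric frame `u` the bundle is the constant subspace `V`, and a skew endomorphism of
the fibre becomes one of the model. The tractor connection becomes the derivative of components plus
the action of a skew connection matrix. -/
theorem IsTractorBundle.isInvariant (hT : IsTractorBundle g T) : IsInvariant g T := by
  obtain ⟨V, hV, hinv, hloc⟩ := hT
  have hskew : ∀ A : StdModel p q →ₗ[ℝ] StdModel p q,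
      (∀ a b, stdForm (A a) b + stdForm a (A b) = 0) → ∀ t ∈ V,
      (fun w : Fin l → StdModel p q ↦ ∑ j, t (Function.update w j (A (w j)))) ∈ V :=
    fun A hA t ht ↦ mem_of_isSkew stdBilin_nondegenerate hV
      (fun f h1 h2 t ht ↦ hinv f ⟨h1, h2⟩ t ht) A hA ht
  have hup : ∀ {x : M} (u : StdModel p q →ₗ[ℝ] Std (p := p) (q := q) x) (w : Fin l → StdModel p q)
      (j : Fin l) (b : StdModel p q), Function.update (fun k ↦ u (w k)) j (u b)
        = fun k ↦ u (Function.update w j b k) := by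
    intro x u w j b
    funext k
    rcases eq_or_ne k j with rfl | h
    · simp
    · simp [h]
  have hmul : ∀ (x : M), ∀ t ∈ T x, IsMul t := by
    intro x t ht
    obtain ⟨u, hu⟩ := hloc x
    obtain ⟨-, hu2, hu3⟩ := hu.self_of_nhds
    obtain ⟨m, hm⟩ := hV _ ((hu3 t).1 ht)
    let e := LinearEquiv.ofBijective (u x) (isometry_bijective g (u x) hu2)
    refine ⟨m.compLinearMap fun _ ↦ (e.symm : Std (p := p) (q := q) x →ₗ[ℝ] StdModel p q), ?_⟩
    funext w
    rw [MultilinearMap.compLinearMap_apply, hm]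
    exact congrArg t (funext fun j ↦ e.apply_symm_apply (w j))
  refine ⟨hmul, fun x A hA t ht ↦ ?_, fun x s v hs hsm ↦ ?_⟩
  · obtain ⟨u, hu⟩ := hloc x
    obtain ⟨-, hu2, hu3⟩ := hu.self_of_nhds
    let e := LinearEquiv.ofBijective (u x) (isometry_bijective g (u x) hu2)
    let A' : StdModel p q →ₗ[ℝ] StdModel p q := e.symm ∘ₗ A ∘ₗ u x
    have hA' : ∀ a, u x (A' a) = A (u x a) := fun a ↦ e.apply_symm_apply (A (u x a))
    have h1 := hskew A' (fun a b ↦ by rw [← hu2, ← hu2, hA', hA']; exact hA _ _) _ ((hu3 t).1 ht)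
    refine (hu3 _).2 ?_
    convert V.neg_mem h1 using 1
    funext w
    simp only [tensAct, Pi.neg_apply, ← hA', hup]
  · obtain ⟨u, hu⟩ := hloc x
    obtain ⟨-, hu2, hu3⟩ := hu.self_of_nhds
    let e := LinearEquiv.ofBijective (u x) (isometry_bijective g (u x) hu2)
    set U : StdModel p q → Π y : M, Std (p := p) (q := q) y := fun a y ↦ u y a with hU
    have hUn : ∀ a, StdNear (U a) x := fun a ↦ hu.mono fun y hy ↦ hy.1 a
    -- `C` is the connection matrix in the frame `U`. It is skew because the connection is metric
    -- and the products of the frame fields are constant near `x`.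
    let C : StdModel p q →ₗ[ℝ] StdModel p q := e.symm ∘ₗ
      { toFun := fun a ↦ g.stdNabla (U a) x v
        map_add' := fun a b ↦ by
          rw [← g.stdNabla_add (hUn a) (hUn b)]
          congr 1
          funext y
          simp [hU]
        map_smul' := fun c a ↦ by
          have h := g.stdNabla_smul (.const c x) (hUn a) v
          rw [dd_const, zero_smul, add_zero] at h
          rw [RingHom.id_apply, ← h]
          congr 1
          funext y
          simp [hU] }
    have hC : ∀ a, u x (C a) = g.stdNabla (U a) x v := fun a ↦ e.apply_symm_apply _
    have hCs : ∀ a b, stdForm (C a) b + stdForm a (C b) = 0 := by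
      intro a b
      rw [← hu2, ← hu2, hC, hC, ← g.dd_form (hUn a) (hUn b) v,
        dd_congr (f := fun _ ↦ stdForm a b) (hu.mono fun y hy ↦ hy.2.1 a b), dd_const]
    have h1 := hskew C hCs _ ((hu3 (s x)).1 hs.self_of_nhds)
    have hmem : ∀ᶠ y in 𝓝 x, (fun w : Fin l → StdModel p q ↦ s y (fun j ↦ u y (w j))) ∈ V := by
      filter_upwards [hu, hs] with y hy hsy using (hy.2.2 _).1 hsy
    have hsmooth : ∀ w : Fin l → StdModel p q, ContMDiffAt (𝓡 (p + q)) 𝓘(ℝ, ℝ) ∞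
        (fun y ↦ s y (fun j ↦ u y (w j))) x := fun w ↦ hsm (fun j ↦ U (w j)) fun j ↦ (hUn _).self
    have h2 : (fun w : Fin l → StdModel p q ↦ dd (fun y ↦ s y (fun j ↦ u y (w j))) x v) ∈ V := by
      obtain ⟨N, a, r, hr, hsum⟩ := exists_evaluation_frame V hV
      have h3 : (fun w : Fin l → StdModel p q ↦ dd (fun y ↦ s y (fun j ↦ u y (w j))) x v)
          = ∑ J, dd (fun y ↦ s y (fun j ↦ u y (a J j))) x v • r J := by
        funext w
        rw [dd_congr (f := fun y ↦ ∑ J, r J w * s y (fun j ↦ u y (a J j)))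
          (hmem.mono fun y hy ↦ by simpa only [mul_comm] using hsum _ hy w),
          dd_sum (f := fun J y ↦ r J w * s y (fun j ↦ u y (a J j)))
            fun J _ ↦ contMDiffAt_const.mul (hsmooth _), Finset.sum_apply]
        refine Finset.sum_congr rfl fun J _ ↦ ?_
        rw [dd_const_mul _ (hsmooth _), mul_comm]
        rfl
      rw [h3]
      exact V.sum_mem fun J _ ↦ V.smul_mem _ (hr J)
    refine (hu3 _).2 ?_
    convert V.sub_mem h2 h1 using 1
    funext w
    have h4 := g.nablaF_eq_nabla (hs.mono fun y hy ↦ hmul y _ hy) hsm (fun j ↦ hUn (w j)) v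
    simp only [Pi.sub_apply]
    rw [← h4]
    simp only [Metric.nablaF, hU, ← hup, hC]

end TractorBundle

/-! ## Tractor-valued forms -/

section Forms

variable {p q l : ℕ} {M : Type*} [TopologicalSpace M] [ChartedSpace (Model p q) M]
  [IsManifold (𝓡 (p + q)) ∞ M] (g : Metric p q M)

variable {x : M} {t t' : Tens p q l x}

theorem tensAct_add_right (A : Std (p := p) (q := q) x → Std (p := p) (q := q) x)
    (t t' : Tens p q l x) : tensAct A (t + t') = tensAct A t + tensAct A t' := by
  funext w
  simp only [tensAct, Pi.add_apply, Finset.sum_add_distrib, neg_add]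

theorem tensAct_smul_right (A : Std (p := p) (q := q) x → Std (p := p) (q := q) x) (c : ℝ)
    (t : Tens p q l x) : tensAct A (c • t) = c • tensAct A t := by
  funext w
  simp only [tensAct, Pi.smul_apply, smul_eq_mul, ← Finset.mul_sum, mul_neg]

theorem tensAct_add_left (ht : IsMul t)
    (A B : Std (p := p) (q := q) x → Std (p := p) (q := q) x) :
    tensAct (fun a ↦ A a + B a) t = tensAct A t + tensAct B t := by
  funext w
  simp only [tensAct, Pi.add_apply, ht.update_add, Finset.sum_add_distrib, neg_add]

theorem tensAct_smul_left (ht : IsMul t) (c : ℝ)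
    (A : Std (p := p) (q := q) x → Std (p := p) (q := q) x) :
    tensAct (fun a ↦ c • A a) t = c • tensAct A t := by
  funext w
  simp only [tensAct, Pi.smul_apply, smul_eq_mul, ht.update_smul, ← Finset.mul_sum, mul_neg]

namespace Metric

theorem tensAct_up_add (ht : IsMul t) (v w : TangentSpace (𝓡 (p + q)) x) :
    tensAct (g.up x (v + w)) t = tensAct (g.up x v) t + tensAct (g.up x w) t := by
  rw [← tensAct_add_left ht]
  congr 1
  funext a
  exact g.up_add_vec x v w a

theorem tensAct_up_smul (ht : IsMul t) (c : ℝ) (v : TangentSpace (𝓡 (p + q)) x) :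
    tensAct (g.up x (c • v)) t = c • tensAct (g.up x v) t := by
  rw [← tensAct_smul_left ht]
  congr 1
  funext a
  exact g.up_smul_vec x c v a

theorem tensAct_down_add (ht : IsMul t) (v w : TangentSpace (𝓡 (p + q)) x) :
    tensAct (g.down x (v + w)) t = tensAct (g.down x v) t + tensAct (g.down x w) t := by
  rw [← tensAct_add_left ht]
  congr 1
  funext a
  exact g.down_add_vec x v w a

theorem tensAct_down_smul (ht : IsMul t) (c : ℝ) (v : TangentSpace (𝓡 (p + q)) x) :
    tensAct (g.down x (c • v)) t = c • tensAct (g.down x v) t := by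
  rw [← tensAct_smul_left ht]
  congr 1
  funext a
  exact g.down_smul_vec x c v a

theorem tensSmoothAt_up {t : Π y : M, Tens p q l y} {X : Π y : M, TangentSpace (𝓡 (p + q)) y}
    (ht : TensSmoothAt t x) (hX : VecSmoothAt X x) :
    TensSmoothAt (fun y ↦ tensAct (g.up y (X y)) (t y)) x := fun w hw ↦
  ContMDiffAt.neg <| ContMDiffAt.sum fun j _ ↦ contMDiffAt_update ht hw j
    (s := fun y ↦ g.up y (X y) (w j y))
    ⟨(g.contMDiffAt_inner hX (hw j).2.1).neg, hX.smul (hw j).2.2, contMDiffAt_const⟩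

theorem tensSmoothAt_down {t : Π y : M, Tens p q l y} {X : Π y : M, TangentSpace (𝓡 (p + q)) y}
    (ht : TensSmoothAt t x) (hX : VecSmoothAt X x) :
    TensSmoothAt (fun y ↦ tensAct (g.down y (X y)) (t y)) x := fun w hw ↦
  ContMDiffAt.neg <| ContMDiffAt.sum fun j _ ↦ contMDiffAt_update ht hw j
    (s := fun y ↦ g.down y (X y) (w j y))
    ⟨contMDiffAt_const, hX.smul (hw j).1, (g.contMDiffAt_inner hX (hw j).2.1).neg⟩

end Metric

/-- The contraction `∂^*` may be computed in any basis. -/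
theorem contr_eq {φ : TangentSpace (𝓡 (p + q)) x → Tens p q l x} (hφ : IsLinearMap ℝ φ)
    (hm : ∀ v, IsMul (φ v)) (e : Module.Basis (Fin (p + q)) ℝ (TangentSpace (𝓡 (p + q)) x)) :
    contr g x φ = - ∑ i, ∑ j, (g.gram e)⁻¹ i j • tensAct (g.up x (e i)) (φ (e j)) := by
  let B : TangentSpace (𝓡 (p + q)) x →ₗ[ℝ] TangentSpace (𝓡 (p + q)) x →ₗ[ℝ] Tens p q l x :=
    LinearMap.mk₂ ℝ (fun v w ↦ tensAct (g.up x v) (φ w))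
      (fun v v' w ↦ g.tensAct_up_add (hm w) v v') (fun c v w ↦ g.tensAct_up_smul (hm w) c v)
      (fun v w w' ↦ by rw [hφ.map_add, tensAct_add_right])
      (fun c v w ↦ by rw [hφ.map_smul, tensAct_smul_right])
  have h := g.sum_gram_inv_bilin B (basBasis x) e
  have h2 : g.gram (basBasis x) = g.gram (bas x) := by
    congr 1
    funext i
    exact basBasis_apply x i
  rw [h2] at h
  simp only [basBasis_apply] at h
  exact congrArg Neg.neg h

/-- A one-form is smooth if its components in a frame are. -/
theorem tensSmoothAt_oneForm {φ : Raw1 p q l M} (hφ : ∀ y, IsLinearMap ℝ (φ y))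
    (h : ∀ i, TensSmoothAt (fun y ↦ φ y (ext (bas x i) y)) x)
    {X : Π y : M, TangentSpace (𝓡 (p + q)) y} (hX : VecSmoothAt X x) :
    TensSmoothAt (fun y ↦ φ y (X y)) x := by
  have h1 : TensSmoothAt (fun y ↦ ∑ i, cf x i X y • φ y (ext (bas x i) y)) x :=
    TensSmoothAt.sum fun i _ ↦
      ((contMDiffAt_cf (p := p) (q := q) x i).self_of_nhds X hX |> fun hc ↦ (h i).smul_fun hc)
  refine h1.congr ?_
  filter_upwards [sum_cf (p := p) (q := q) x] with y hy
  conv_lhs => rw [← hy X]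
  let L := (hφ y).mk' (φ y)
  change L _ = ∑ i, _ • L _
  simp

variable {T : Π x : M, Submodule ℝ (Tens p q l x)}

theorem delStar1_mem (hI : IsInvariant g T) {φ : Raw1 p q l M} (hφ : φ ∈ C1 T) :
    delStar1 g φ ∈ C0 T := by
  refine ⟨fun x ↦ (T x).neg_mem <| (T x).sum_mem fun i _ ↦ (T x).sum_mem fun j _ ↦
    (T x).smul_mem _ (hI.act x (g.upL x (bas x i)) (g.isSkew_up x _) _ (hφ.2.1 x _)), fun x ↦ ?_⟩
  have h1 : TensSmoothAt (fun y ↦ - ∑ i, ∑ j, (g.gram (fun k ↦ ext (bas x k) y))⁻¹ i j •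
      tensAct (g.up y (ext (bas x i) y)) (φ y (ext (bas x j) y))) x :=
    TensSmoothAt.neg <| .sum fun i _ ↦ .sum fun j _ ↦ TensSmoothAt.smul_fun
      (g.contMDiffAt_gram_inv x i j).self_of_nhds
      (g.tensSmoothAt_up (hφ.2.2 x _ (vecSmoothAt_ext _)) (vecSmoothAt_ext _))
  refine h1.congr ?_
  filter_upwards [Metric.eventually_basis (p := p) (q := q) x] with y ⟨e, he⟩
  have h2 := contr_eq g (hφ.1 y) (fun v ↦ hI.isMul y _ (hφ.2.1 y v)) e
  have h3 : (e : Fin (p + q) → TangentSpace (𝓡 (p + q)) y) = fun k ↦ ext (bas x k) y :=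
    funext he
  rw [h3] at h2
  exact h2

/-- Contraction of a two-form with a vector field, as a linear one-form at each point. -/
theorem C2.isLinearMap_right {φ : Raw2 p q l M} (hφ : φ ∈ C2 T) (x : M)
    (v : TangentSpace (𝓡 (p + q)) x) : IsLinearMap ℝ (φ x v) where
  map_add a b := by
    rw [hφ.2.1 x v (a + b), (hφ.1 x v).map_add, neg_add, ← hφ.2.1, ← hφ.2.1]
  map_smul c a := by
    rw [hφ.2.1 x v (c • a), (hφ.1 x v).map_smul, ← smul_neg, ← hφ.2.1]

theorem delStar2_mem (hI : IsInvariant g T) {φ : Raw2 p q l M} (hφ : φ ∈ C2 T) :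
    delStar2 g φ ∈ C1 T := by
  refine ⟨fun x ↦ ⟨fun v w ↦ ?_, fun c v ↦ ?_⟩, fun x v ↦ (T x).neg_mem <|
    (T x).sum_mem fun i _ ↦ (T x).sum_mem fun j _ ↦ (T x).smul_mem _
      (hI.act x (g.upL x (bas x i)) (g.isSkew_up x _) _ (hφ.2.2.1 x _ _)), fun x X hX ↦ ?_⟩
  · exact (congrArg (contr g x)
      (funext fun a ↦ (C2.isLinearMap_right hφ x a).map_add v w)).trans (map_add (contr g x) _ _)
  · exact (congrArg (contr g x)
      (funext fun a ↦ (C2.isLinearMap_right hφ x a).map_smul c v)).trans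
      (map_smul (contr g x) c (fun a ↦ φ x a v))
  · have h1 : TensSmoothAt (fun y ↦ - ∑ i, ∑ j, (g.gram (fun k ↦ ext (bas x k) y))⁻¹ i j •
        tensAct (g.up y (ext (bas x i) y)) (φ y (ext (bas x j) y) (X y))) x :=
      TensSmoothAt.neg <| .sum fun i _ ↦ .sum fun j _ ↦ TensSmoothAt.smul_fun
        (g.contMDiffAt_gram_inv x i j).self_of_nhds
        (g.tensSmoothAt_up (hφ.2.2.2 x _ _ (vecSmoothAt_ext _) hX) (vecSmoothAt_ext _))
    refine h1.congr ?_
    filter_upwards [Metric.eventually_basis (p := p) (q := q) x] with y ⟨e, he⟩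
    have h2 := contr_eq g (hφ.1 y (X y)) (fun v ↦ hI.isMul y _ (hφ.2.2.1 y v _)) e
    have h3 : (e : Fin (p + q) → TangentSpace (𝓡 (p + q)) y) = fun k ↦ ext (bas x k) y :=
      funext he
    rw [h3] at h2
    exact h2

/-- The Kostant differential `∂` on tensors. -/
def bdZero : Raw0 p q l M →ₗ[ℝ] Raw1 p q l M where
  toFun t x v := tensAct (g.down x v) (t x)
  map_add' a b := funext fun x ↦ funext fun _ ↦ tensAct_add_right _ (a x) (b x)
  map_smul' c a := funext fun x ↦ funext fun _ ↦ tensAct_smul_right _ c (a x)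

/-- The Kostant differential `∂` on one-forms. -/
def bdOne : Raw1 p q l M →ₗ[ℝ] Raw2 p q l M where
  toFun φ x v w := tensAct (g.down x v) (φ x w) - tensAct (g.down x w) (φ x v)
  map_add' a b := funext fun x ↦ funext fun v ↦ funext fun w ↦ by
    simp only [Pi.add_apply, tensAct_add_right]
    abel
  map_smul' c a := funext fun x ↦ funext fun v ↦ funext fun w ↦ by
    simp only [Pi.smul_apply, tensAct_smul_right, RingHom.id_apply, smul_sub]

theorem bdZero_mem (hI : IsInvariant g T) {t : Raw0 p q l M} (ht : t ∈ C0 T) :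
    bdZero g t ∈ C1 T :=
  ⟨fun x ↦ ⟨g.tensAct_down_add (hI.isMul x _ (ht.1 x)),
    g.tensAct_down_smul (hI.isMul x _ (ht.1 x))⟩,
    fun x v ↦ hI.act x (g.downL x v) (g.isSkew_down x v) _ (ht.1 x),
    fun x _ hX ↦ g.tensSmoothAt_down (ht.2 x) hX⟩

theorem bdOne_mem (hI : IsInvariant g T) {φ : Raw1 p q l M} (hφ : φ ∈ C1 T) :
    bdOne g φ ∈ C2 T := by
  have hm := fun x v ↦ hI.isMul x _ (hφ.2.1 x v)
  refine ⟨fun x w ↦ ⟨fun v v' ↦ ?_, fun c v ↦ ?_⟩, fun x v w ↦ (neg_sub _ _).symm,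
    fun x v w ↦ (T x).sub_mem (hI.act x (g.downL x v) (g.isSkew_down x v) _ (hφ.2.1 x w))
      (hI.act x (g.downL x w) (g.isSkew_down x w) _ (hφ.2.1 x v)),
    fun x X Y hX hY ↦ (g.tensSmoothAt_down (hφ.2.2 x Y hY) hX).sub
      (g.tensSmoothAt_down (hφ.2.2 x X hX) hY)⟩
  · simp only [bdOne, LinearMap.coe_mk, AddHom.coe_mk, g.tensAct_down_add (hm x w),
      (hφ.1 x).map_add, tensAct_add_right]
    abel
  · simp only [bdOne, LinearMap.coe_mk, AddHom.coe_mk, g.tensAct_down_smul (hm x w),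
      (hφ.1 x).map_smul, tensAct_smul_right, smul_sub]

/-- The actions of covectors commute. -/
theorem tensAct_up_comm (t : Tens p q l x) (v w : TangentSpace (𝓡 (p + q)) x) :
    tensAct (g.up x v) (tensAct (g.up x w) t) = tensAct (g.up x w) (tensAct (g.up x v) t) := by
  have h0 : ∀ a, g.up x v (g.up x w a) = g.up x w (g.up x v a) := by
    intro a
    simp [Metric.up, g.symm x v w]
  -- Terms with both actions in one slot are separated from those in two different slots. The former
  -- agree because covectors commute on `S`, the latter by exchanging the two slots.
  have key : ∀ (A B : Std (p := p) (q := q) x → Std (p := p) (q := q) x) (a),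
      tensAct A (tensAct B t) a
      = ∑ j, (t (Function.update a j (B (A (a j))))
        + ∑ k ∈ Finset.univ.erase j,
            t (Function.update (Function.update a k (B (a k))) j (A (a j)))) := by
    intro A B a
    simp only [tensAct, Finset.sum_neg_distrib, neg_neg]
    refine Finset.sum_congr rfl fun j _ ↦ ?_
    rw [← sum_update_update t a (fun k ↦ B (a k)) j (A (a j)) (B (A (a j)))]
    refine Finset.sum_congr rfl fun k _ ↦ ?_
    congr 2
    rcases eq_or_ne k j with rfl | h
    · simp
    · simp [h]
  have hsum : ∀ f : Fin l → Fin l → ℝ, ∑ j, ∑ k ∈ Finset.univ.erase j, f j k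
      = ∑ j, ∑ k ∈ Finset.univ.erase j, f k j := by
    intro f
    refine Finset.sum_comm' fun j k ↦ ?_
    simp [eq_comm]
  funext a
  rw [key, key, Finset.sum_add_distrib, Finset.sum_add_distrib]
  simp only [h0]
  congr 1
  rw [hsum]
  refine Finset.sum_congr rfl fun j _ ↦ Finset.sum_congr rfl fun k hk ↦ ?_
  rw [Function.update_comm (Finset.ne_of_mem_erase hk)]

/-- The actions of covectors commute while `φ` is antisymmetric, so in an orthonormal basis the
double contraction equals its own negative. -/
theorem delStar1_delStar2 (hI : IsInvariant g T) {φ : Raw2 p q l M} (hφ : φ ∈ C2 T) :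
    delStar1 g (delStar2 g φ) = 0 := by
  funext x
  obtain ⟨e, he⟩ := g.exists_orthonormal x
  have hψ := delStar2_mem g hI hφ
  change contr g x (delStar2 g φ x) = 0
  rw [contr_eq g (hψ.1 x) (fun v ↦ hI.isMul x _ (hψ.2.1 x v)) e, Metric.gram_of_orthonormal g he]
  have h1 : ∀ v, delStar2 g φ x v = - ∑ k, sign p q k • tensAct (g.up x (e k)) (φ x (e k) v) := by
    intro v
    change contr g x (fun w ↦ φ x w v) = _
    rw [contr_eq g (hφ.1 x v) (fun w ↦ hI.isMul x _ (hφ.2.2.1 x w v)) e,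
      Metric.gram_of_orthonormal g he]
    simp [Matrix.diagonal_apply]
  let A : Fin (p + q) → Tens p q l x →ₗ[ℝ] Tens p q l x := fun i ↦
    { toFun := tensAct (g.up x (e i))
      map_add' := tensAct_add_right _
      map_smul' := tensAct_smul_right _ }
  have h2 : ∑ i, ∑ j, Matrix.diagonal (sign p q) i j • tensAct (g.up x (e i)) (delStar2 g φ x (e j))
      = - ∑ i, ∑ k, (sign p q i * sign p q k) • A i (A k (φ x (e k) (e i))) := by
    rw [← Finset.sum_neg_distrib]
    refine Finset.sum_congr rfl fun i _ ↦ ?_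
    rw [Finset.sum_eq_single i (fun j _ h ↦ by rw [Matrix.diagonal_apply_ne' _ h, zero_smul])
      (by simp), Matrix.diagonal_apply_eq, h1]
    change sign p q i • A i (- ∑ k, sign p q k • A k (φ x (e k) (e i))) = _
    simp only [map_neg, map_sum, map_smul, smul_neg, Finset.smul_sum, smul_smul]
  rw [h2, neg_neg]
  set S := ∑ i, ∑ k, (sign p q i * sign p q k) • A i (A k (φ x (e k) (e i))) with hS
  have h3 : S = - S := by
    conv_lhs => rw [hS, Finset.sum_comm]
    rw [hS, ← Finset.sum_neg_distrib]
    refine Finset.sum_congr rfl fun k _ ↦ ?_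
    rw [← Finset.sum_neg_distrib]
    refine Finset.sum_congr rfl fun i _ ↦ ?_
    have h4 : A i (A k (φ x (e k) (e i))) = A k (A i (φ x (e k) (e i))) :=
      tensAct_up_comm g _ _ _
    rw [h4, hφ.2.1 x (e k) (e i), map_neg, map_neg, smul_neg, mul_comm]
  exact self_eq_neg.1 h3

end Forms

/-! ## Deformed tractor connections -/

section Connections

variable {p q l : ℕ} {M : Type*} [TopologicalSpace M] [ChartedSpace (Model p q) M]
  [IsManifold (𝓡 (p + q)) ∞ M] (g : Metric p q M)
  {T : Π x : M, Submodule ℝ (Tens p q l x)}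
  {Ψ : Π x : M, TangentSpace (𝓡 (p + q)) x →ₗ[ℝ] Module.End ℝ (T x)}
  {x : M} {s s' : Raw0 p q l M} {f : M → ℝ}

theorem psiApply_mem (x : M) (v : TangentSpace (𝓡 (p + q)) x) (t : Tens p q l x) :
    psiApply Ψ x v t ∈ T x := by
  unfold psiApply
  split_ifs
  · exact Subtype.prop _
  · exact (T x).zero_mem

theorem psiApply_of_mem (v : TangentSpace (𝓡 (p + q)) x) {t : Tens p q l x} (ht : t ∈ T x) :
    psiApply Ψ x v t = (Ψ x v ⟨t, ht⟩ : T x) := dif_pos ht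

theorem psiApply_add (v : TangentSpace (𝓡 (p + q)) x) {t t' : Tens p q l x} (ht : t ∈ T x)
    (ht' : t' ∈ T x) : psiApply Ψ x v (t + t') = psiApply Ψ x v t + psiApply Ψ x v t' := by
  rw [psiApply_of_mem v ht, psiApply_of_mem v ht', psiApply_of_mem v ((T x).add_mem ht ht'),
    ← Submodule.coe_add, ← map_add]
  rfl

theorem psiApply_smul (v : TangentSpace (𝓡 (p + q)) x) (c : ℝ) {t : Tens p q l x} (ht : t ∈ T x) :
    psiApply Ψ x v (c • t) = c • psiApply Ψ x v t := by
  rw [psiApply_of_mem v ht, psiApply_of_mem v ((T x).smul_mem c ht), ← Submodule.coe_smul,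
    ← map_smul]
  rfl

theorem psiApply_add_vec (v w : TangentSpace (𝓡 (p + q)) x) {t : Tens p q l x} (ht : t ∈ T x) :
    psiApply Ψ x (v + w) t = psiApply Ψ x v t + psiApply Ψ x w t := by
  rw [psiApply_of_mem _ ht, psiApply_of_mem _ ht, psiApply_of_mem _ ht, map_add]
  rfl

theorem psiApply_smul_vec (c : ℝ) (v : TangentSpace (𝓡 (p + q)) x) {t : Tens p q l x}
    (ht : t ∈ T x) : psiApply Ψ x (c • v) t = c • psiApply Ψ x v t := by
  rw [psiApply_of_mem _ ht, psiApply_of_mem _ ht, map_smul]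
  rfl

theorem psiApply_zero (v : TangentSpace (𝓡 (p + q)) x) (t : Tens p q l x) :
    psiApply (T := T) 0 x v t = 0 := by
  unfold psiApply
  split_ifs <;> rfl

theorem conn_congr (h : ∀ᶠ y in 𝓝 x, s' y = s y) (v : TangentSpace (𝓡 (p + q)) x) :
    conn g Ψ s' x v = conn g Ψ s x v := by
  rw [conn, conn, g.nabla_congr h, h.self_of_nhds]

theorem conn_add (hs : TensSmoothAt s x) (hs' : TensSmoothAt s' x) (hT : s x ∈ T x)
    (hT' : s' x ∈ T x) (v : TangentSpace (𝓡 (p + q)) x) :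
    conn g Ψ (fun y ↦ s y + s' y) x v = conn g Ψ s x v + conn g Ψ s' x v := by
  rw [conn, conn, conn, g.nabla_add hs hs', psiApply_add v hT hT']
  abel

theorem conn_smul (hf : ContMDiffAt (𝓡 (p + q)) 𝓘(ℝ, ℝ) ∞ f x) (hs : TensSmoothAt s x)
    (hT : s x ∈ T x) (v : TangentSpace (𝓡 (p + q)) x) :
    conn g Ψ (fun y ↦ f y • s y) x v = f x • conn g Ψ s x v + dd f x v • s x := by
  rw [conn, conn, g.nabla_smul hf hs, psiApply_smul v _ hT, smul_add]
  abel

theorem conn_isLinearMap (hI : IsInvariant g T) (hT : s x ∈ T x) :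
    IsLinearMap ℝ (conn g Ψ s x) where
  map_add v w := by
    rw [conn, conn, conn, g.nabla_add_vec (hI.isMul x _ hT), psiApply_add_vec v w hT]
    abel
  map_smul c v := by
    rw [conn, conn, g.nabla_smul_vec (hI.isMul x _ hT), psiApply_smul_vec c v hT, smul_add]

theorem conn_mem_fiber (hI : IsInvariant g T) (hT : ∀ y, s y ∈ T y) (hs : TensSmoothAt s x)
    (v : TangentSpace (𝓡 (p + q)) x) : conn g Ψ s x v ∈ T x :=
  (T x).add_mem (hI.nabla x s v (Eventually.of_forall hT) hs) (psiApply_mem x v _)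

theorem tensSmoothAt_conn (hI : IsInvariant g T) (hΨ : IsGlOne Ψ) (hT : ∀ y, s y ∈ T y)
    (hs : ∀ᶠ y in 𝓝 x, TensSmoothAt s y) {X : Π y : M, TangentSpace (𝓡 (p + q)) y}
    (hX : VecNear X x) : TensSmoothAt (fun y ↦ conn g Ψ s y (X y)) x :=
  (g.tensSmoothAt_nabla (Eventually.of_forall fun y ↦ hI.isMul y _ (hT y)) hs hX).add
    (hΨ.1 x X s hX.self hT hs.self_of_nhds)

theorem conn_mem (hI : IsInvariant g T) (hΨ : IsGlOne Ψ) (hs : s ∈ C0 T) :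
    conn g Ψ s ∈ C1 T :=
  ⟨fun x ↦ conn_isLinearMap g hI (hs.1 x), fun x v ↦ conn_mem_fiber g hI hs.1 (hs.2 x) v,
    fun _ _ hX ↦ tensSmoothAt_oneForm (fun y ↦ conn_isLinearMap g hI (hs.1 y))
      (fun _ ↦ tensSmoothAt_conn g hI hΨ hs.1 (Eventually.of_forall hs.2) (vecNear_ext _)) hX⟩

/-! ### The covariant exterior derivative of one-forms -/

variable {φ : Raw1 p q l M} {X Y Z : Π y : M, TangentSpace (𝓡 (p + q)) y}

variable (Ψ) in
/-- The covariant exterior derivative of a one-form, evaluated on vector fields. -/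
def dOneF (φ : Raw1 p q l M) (X Y : Π y : M, TangentSpace (𝓡 (p + q)) y) (x : M) : Tens p q l x :=
  conn g Ψ (fun y ↦ φ y (Y y)) x (X x) - conn g Ψ (fun y ↦ φ y (X y)) x (Y x)
    - φ x (bracket X Y x)

theorem dOneF_swap (hφ : φ ∈ C1 T) : dOneF g Ψ φ X Y x = - dOneF g Ψ φ Y X x := by
  have h := (hφ.1 x).map_neg (bracket Y X x)
  rw [dOneF, dOneF, bracket_swap, h]
  abel

theorem dOneF_add (hI : IsInvariant g T) (hφ : φ ∈ C1 T) (hX : VecNear X x) (hZ : VecNear Z x) :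
    dOneF g Ψ φ (X + Z) Y x = dOneF g Ψ φ X Y x + dOneF g Ψ φ Z Y x := by
  have h1 : conn g Ψ (fun y ↦ φ y ((X + Z) y)) x (Y x)
      = conn g Ψ (fun y ↦ φ y (X y)) x (Y x) + conn g Ψ (fun y ↦ φ y (Z y)) x (Y x) := by
    rw [← conn_add g (hφ.2.2 x X hX.self) (hφ.2.2 x Z hZ.self) (hφ.2.1 _ _) (hφ.2.1 _ _)]
    congr 1
    funext y
    exact (hφ.1 y).map_add _ _
  rw [dOneF, dOneF, dOneF, h1, bracket_add_left hX.self hZ.self, (hφ.1 x).map_add, Pi.add_apply,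
    (conn_isLinearMap g hI (hφ.2.1 x (Y x))).map_add]
  abel

theorem dOneF_smul (hI : IsInvariant g T) (hφ : φ ∈ C1 T) (hf : FunNear (p := p) (q := q) f x)
    (hX : VecNear X x) : dOneF g Ψ φ (f • X) Y x = f x • dOneF g Ψ φ X Y x := by
  have h1 : conn g Ψ (fun y ↦ φ y ((f • X) y)) x (Y x)
      = f x • conn g Ψ (fun y ↦ φ y (X y)) x (Y x) + dd f x (Y x) • φ x (X x) := by
    rw [← conn_smul g hf.self (hφ.2.2 x X hX.self) (hφ.2.1 _ _)]
    congr 1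
    funext y
    exact (hφ.1 y).map_smul _ _
  rw [dOneF, dOneF, h1, bracket_smul_left hf.self hX.self, (hφ.1 x).map_add, (hφ.1 x).map_smul,
    (hφ.1 x).map_smul, Pi.smul_apply', (conn_isLinearMap g hI (hφ.2.1 x (Y x))).map_smul]
  module

theorem dOneF_congr (h : ∀ᶠ y in 𝓝 x, Z y = X y) :
    dOneF g Ψ φ Z Y x = dOneF g Ψ φ X Y x := by
  rw [dOneF, dOneF, bracket_congr h (Eventually.of_forall fun _ ↦ rfl), h.self_of_nhds,
    conn_congr g (s' := fun y ↦ φ y (Z y)) (s := fun y ↦ φ y (X y)) (h.mono fun y hy ↦ by rw [hy])]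

theorem dOneF_eq (hI : IsInvariant g T) (hφ : φ ∈ C1 T) (hX : VecNear X x) (hY : VecNear Y x) :
    dOneF g Ψ φ X Y x = dOne g Ψ φ x (X x) (Y x) := by
  have key : ∀ {X Y : Π y : M, TangentSpace (𝓡 (p + q)) y}, VecNear X x →
      dOneF g Ψ φ X Y x = dOneF g Ψ φ (ext (X x)) Y x := fun hX ↦
    tensorial (x := x) (fun X ↦ dOneF g Ψ φ X _ x) (fun _ _ hX hZ ↦ dOneF_add g hI hφ hX hZ)
      (fun _ _ hf hX ↦ dOneF_smul g hI hφ hf hX) (fun _ _ _ h ↦ dOneF_congr g h) hX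
  rw [key hX, dOneF_swap g hφ, key hY, ← dOneF_swap g hφ, dOneF, dOne, ext_self, ext_self]

theorem dOne_isLinearMap (hI : IsInvariant g T) (hφ : φ ∈ C1 T)
    (w : TangentSpace (𝓡 (p + q)) x) : IsLinearMap ℝ (fun v ↦ dOne g Ψ φ x v w) where
  map_add v v' := by
    have h := dOneF_add g (Ψ := Ψ) (Y := ext w) hI hφ (vecNear_ext v) (vecNear_ext v')
    rw [dOneF_eq g hI hφ ((vecNear_ext v).add (vecNear_ext v')) (vecNear_ext w),
      dOneF_eq g hI hφ (vecNear_ext v) (vecNear_ext w),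
      dOneF_eq g hI hφ (vecNear_ext v') (vecNear_ext w)] at h
    simpa only [Pi.add_apply, ext_self] using h
  map_smul c v := by
    have h := dOneF_smul g (Ψ := Ψ) (Y := ext w) hI hφ (.const c x) (vecNear_ext v)
    rw [dOneF_eq g hI hφ ((vecNear_ext v).smul (.const c x)) (vecNear_ext w),
      dOneF_eq g hI hφ (vecNear_ext v) (vecNear_ext w)] at h
    simpa only [Pi.smul_apply', ext_self] using h

theorem dOne_swap (hφ : φ ∈ C1 T) (v w : TangentSpace (𝓡 (p + q)) x) :
    dOne g Ψ φ x v w = - dOne g Ψ φ x w v := by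
  have h := dOneF_swap g (Ψ := Ψ) (X := ext v) (Y := ext w) (x := x) hφ
  simpa only [dOneF, dOne, ext_self] using h

theorem tensSmoothAt_dOneF (hI : IsInvariant g T) (hΨ : IsGlOne Ψ) (hφ : φ ∈ C1 T)
    (hX : VecNear X x) (hY : VecNear Y x) : TensSmoothAt (dOneF g Ψ φ X Y) x :=
  ((tensSmoothAt_conn g hI hΨ (fun y ↦ hφ.2.1 y _) (hY.mono fun y hy ↦ hφ.2.2 y Y hy) hX).sub
    (tensSmoothAt_conn g hI hΨ (fun y ↦ hφ.2.1 y _) (hX.mono fun y hy ↦ hφ.2.2 y X hy) hY)).sub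
    (hφ.2.2 x _ (hX.bracket hY).self)

theorem dOne_mem (hI : IsInvariant g T) (hΨ : IsGlOne Ψ) (hφ : φ ∈ C1 T) :
    dOne g Ψ φ ∈ C2 T := by
  refine ⟨fun x w ↦ dOne_isLinearMap g hI hφ w, fun x v w ↦ dOne_swap g hφ v w,
    fun x v w ↦ (T x).sub_mem ((T x).sub_mem
      (conn_mem_fiber g hI (fun y ↦ hφ.2.1 y _) (hφ.2.2 x _ (vecSmoothAt_ext w)) v)
      (conn_mem_fiber g hI (fun y ↦ hφ.2.1 y _) (hφ.2.2 x _ (vecSmoothAt_ext v)) w))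
      (hφ.2.1 x _), fun x X Y hX hY ↦ ?_⟩
  -- The fields `X` and `Y` are smooth only at `x`, which is too little for derivatives of `φ(X)`
  -- and `φ(Y)`. The components on frame fields are treated first, and linearity then handles the
  -- two arguments in turn.
  have h1 : ∀ i k, TensSmoothAt (fun y ↦ dOne g Ψ φ y (ext (bas x i) y) (ext (bas x k) y)) x := by
    intro i k
    have hi := vecNear_ext (bas (p := p) (q := q) x i)
    have hk := vecNear_ext (bas (p := p) (q := q) x k)
    refine (tensSmoothAt_dOneF g hI hΨ hφ hi hk).congr ?_
    filter_upwards [hi.eventually_nhds, hk.eventually_nhds] with y h3 h4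
    exact (dOneF_eq g hI hφ h3 h4).symm
  have h2 : ∀ k, TensSmoothAt (fun y ↦ dOne g Ψ φ y (X y) (ext (bas x k) y)) x := fun k ↦
    tensSmoothAt_oneForm (φ := fun y v ↦ dOne g Ψ φ y v (ext (bas x k) y))
      (fun y ↦ dOne_isLinearMap g hI hφ _) (fun i ↦ h1 i k) hX
  have h3 : TensSmoothAt (fun y ↦ dOne g Ψ φ y (Y y) (X y)) x := by
    refine tensSmoothAt_oneForm (φ := fun y v ↦ dOne g Ψ φ y v (X y))
      (fun y ↦ dOne_isLinearMap g hI hφ _) (fun k ↦ ?_) hY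
    simp only [dOne_swap g hφ _ (X _)]
    exact (h2 k).neg
  refine h3.neg.congr (Eventually.of_forall fun y ↦ dOne_swap g hφ _ _)

/-! ### Chains as vector spaces -/

/-- The deformed tractor connection on sections. -/
def connL (hI : IsInvariant g T) (hΨ : IsGlOne Ψ) : C0 T →ₗ[ℝ] C1 T where
  toFun s := ⟨conn g Ψ s, conn_mem g hI hΨ s.2⟩
  map_add' s s' := Subtype.ext <| funext fun x ↦ funext fun v ↦
    conn_add g (s.2.2 x) (s'.2.2 x) (s.2.1 x) (s'.2.1 x) v
  map_smul' c s := Subtype.ext <| funext fun x ↦ funext fun v ↦ by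
    have h := conn_smul g (Ψ := Ψ) (f := fun _ ↦ c) contMDiffAt_const (s.2.2 x) (s.2.1 x) v
    rw [dd_const, zero_smul, add_zero] at h
    exact h

/-- The covariant exterior derivative on one-forms. -/
def dOneL (hI : IsInvariant g T) (hΨ : IsGlOne Ψ) : C1 T →ₗ[ℝ] C2 T where
  toFun φ := ⟨dOne g Ψ φ, dOne_mem g hI hΨ φ.2⟩
  map_add' φ ψ := Subtype.ext <| funext fun x ↦ funext fun v ↦ funext fun w ↦ by
    have h := fun v w ↦ conn_add g (Ψ := Ψ) (φ.2.2.2 x _ (vecSmoothAt_ext w))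
      (ψ.2.2.2 x _ (vecSmoothAt_ext w)) (φ.2.2.1 x _) (ψ.2.2.1 x _) v
    change conn g Ψ (fun y ↦ φ.1 y (ext w y) + ψ.1 y (ext w y)) x v
      - conn g Ψ (fun y ↦ φ.1 y (ext v y) + ψ.1 y (ext v y)) x w
      - (φ.1 x (bracket (ext v) (ext w) x) + ψ.1 x (bracket (ext v) (ext w) x))
      = dOne g Ψ φ.1 x v w + dOne g Ψ ψ.1 x v w
    rw [h, h, dOne, dOne]
    abel
  map_smul' c φ := Subtype.ext <| funext fun x ↦ funext fun v ↦ funext fun w ↦ by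
    have h := fun v w ↦ conn_smul g (Ψ := Ψ) (f := fun _ ↦ c) contMDiffAt_const
      (φ.2.2.2 x _ (vecSmoothAt_ext w)) (φ.2.2.1 x _) v
    simp only [dd_const, zero_smul, add_zero] at h
    change conn g Ψ (fun y ↦ c • φ.1 y (ext w y)) x v - conn g Ψ (fun y ↦ c • φ.1 y (ext v y)) x w
      - c • φ.1 x (bracket (ext v) (ext w) x) = c • dOne g Ψ φ.1 x v w
    rw [h, h, dOne, smul_sub, smul_sub]

/-- `∂^*` on one-forms. -/
def delOneL (hI : IsInvariant g T) : C1 T →ₗ[ℝ] C0 T :=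
  (delStar1 g).restrict fun _ h ↦ delStar1_mem g hI h

/-- `∂^*` on two-forms. -/
def delTwoL (hI : IsInvariant g T) : C2 T →ₗ[ℝ] C1 T :=
  (delStar2 g).restrict fun _ h ↦ delStar2_mem g hI h

/-- `∂` on sections. -/
def bdZeroL (hI : IsInvariant g T) : C0 T →ₗ[ℝ] C1 T :=
  (bdZero g).restrict fun _ h ↦ bdZero_mem g hI h

/-- `∂` on one-forms. -/
def bdOneL (hI : IsInvariant g T) : C1 T →ₗ[ℝ] C2 T :=
  (bdOne g).restrict fun _ h ↦ bdOne_mem g hI h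

end Connections

/-! ## The filtration -/

section Filtration

variable {p q l : ℕ} {M : Type*} [TopologicalSpace M] [ChartedSpace (Model p q) M]
  [IsManifold (𝓡 (p + q)) ∞ M] (g : Metric p q M) {x : M}
  {t t' : Tens p q l x} {i i' : ℤ}

theorem stdFil.eq_zero {k : ℤ} {w : Std (p := p) (q := q) x} (h : stdFil k w) (hk : 2 ≤ k) :
    w = 0 :=
  Prod.ext (h.2.2 hk) (Prod.ext (h.2.1 (by omega)) (h.1 (by omega)))

theorem stdFil_of_le {k : ℤ} (w : Std (p := p) (q := q) x) (hk : k ≤ -1) : stdFil k w :=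
  ⟨by omega, by omega, by omega⟩

theorem tensFil.mono (h : tensFil i t) (hi : i' ≤ i) : tensFil i' t :=
  fun k w hw hk ↦ h k w hw (by omega)

theorem tensFil_zero (i : ℤ) : tensFil i (0 : Tens p q l x) := fun _ _ _ _ ↦ rfl

theorem tensFil.add (h : tensFil i t) (h' : tensFil i t') : tensFil i (t + t') :=
  fun k w hw hk ↦ by rw [Pi.add_apply, h k w hw hk, h' k w hw hk, add_zero]

theorem tensFil.smul (c : ℝ) (h : tensFil i t) : tensFil i (c • t) :=
  fun k w hw hk ↦ by rw [Pi.smul_apply, h k w hw hk, smul_zero]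

theorem tensFil.neg (h : tensFil i t) : tensFil i (-t) :=
  fun k w hw hk ↦ by rw [Pi.neg_apply, h k w hw hk, neg_zero]

theorem tensFil.sub (h : tensFil i t) (h' : tensFil i t') : tensFil i (t - t') :=
  sub_eq_add_neg t t' ▸ h.add h'.neg

theorem tensFil.sum {ι : Type*} {S : Finset ι} {t : ι → Tens p q l x}
    (h : ∀ j ∈ S, tensFil i (t j)) : tensFil i (∑ j ∈ S, t j) :=
  fun k w hw hk ↦ by
    rw [Finset.sum_apply]
    exact Finset.sum_eq_zero fun j hj ↦ h j hj k w hw hk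

/-- Tensors have degree at least `-l`. -/
theorem tensFil_neg (ht : IsMul t) : tensFil (-l) t := by
  intro k w hw hk
  -- If every `k j` were at most `1`, the total degree could not exceed `l`. An argument of degree
  -- `2` is zero.
  obtain ⟨j, hj⟩ : ∃ j, 2 ≤ k j := by
    by_contra! h
    have h1 : ∑ j, k j ≤ ∑ _j : Fin l, (1 : ℤ) := Finset.sum_le_sum fun j _ ↦ by
      have := h j
      omega
    simp at h1
    omega
  have h1 := ht.update_smul w j 0 0
  rw [smul_zero, zero_mul, ← (hw j).eq_zero hj, Function.update_eq_self] at h1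
  exact h1

/-- Tensors of degree greater than `l` vanish. -/
theorem tensFil.eq_zero (h : tensFil (l + 1) t) : t = 0 := by
  funext w
  -- Every tractor has degree at least `-1`, and the total `-l` already exceeds `-(l + 1)`.
  refine h (fun _ ↦ -1) w (fun j ↦ stdFil_of_le _ le_rfl) ?_
  simp

theorem tensFil.update_add (h : tensFil i t) {k : Fin l → ℤ} {w : Fin l → Std (p := p) (q := q) x}
    (hw : ∀ j, stdFil (k j) (w j)) (j : Fin l) (r : ℤ) {a : Std (p := p) (q := q) x}
    (ha : stdFil (k j + r) a) (hk : -(i + r) < ∑ j, k j) : t (Function.update w j a) = 0 := by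
  refine h (fun j' ↦ k j' + if j' = j then r else 0) _ (fun j' ↦ ?_) ?_
  · rcases eq_or_ne j' j with rfl | hj
    · simpa using ha
    · simpa [hj] using hw j'
  · rw [Finset.sum_add_distrib, Finset.sum_ite_eq' Finset.univ j, if_pos (Finset.mem_univ j)]
    omega

theorem tensFil.act {A : Std (p := p) (q := q) x → Std (p := p) (q := q) x} (r : ℤ)
    (hA : ∀ k w, stdFil k w → stdFil (k + r) (A w)) (h : tensFil i t) :
    tensFil (i + r) (tensAct A t) := by
  intro k w hw hk
  rw [tensAct, neg_eq_zero]
  exact Finset.sum_eq_zero fun j _ ↦ h.update_add hw j r (hA _ _ (hw j)) hk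

namespace Metric

theorem stdFil_up (v : TangentSpace (𝓡 (p + q)) x) (k : ℤ) (w : Std (p := p) (q := q) x)
    (h : stdFil k w) : stdFil (k + 1) (g.up x v w) := by
  refine ⟨fun _ ↦ rfl, fun hk ↦ ?_, fun hk ↦ ?_⟩
  · simp only [up]
    rw [h.1 (by omega), zero_smul]
  · simp only [up]
    rw [h.2.1 (by omega), map_zero, neg_zero]

theorem stdFil_down (v : TangentSpace (𝓡 (p + q)) x) (k : ℤ) (w : Std (p := p) (q := q) x)
    (h : stdFil k w) : stdFil (k + -1) (g.down x v w) := by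
  refine ⟨fun hk ↦ ?_, fun hk ↦ ?_, fun _ ↦ rfl⟩
  · simp only [down]
    rw [h.2.1 (by omega), map_zero, neg_zero]
  · simp only [down]
    rw [h.2.2 (by omega), zero_smul]

end Metric

theorem ext_zero_eventually (x : M) :
    ∀ᶠ y in 𝓝 x, ext (0 : TangentSpace (𝓡 (p + q)) x) y = 0 := by
  filter_upwards [ext_eq_extL (p := p) (q := q) x] with y hy
  rw [hy, map_zero]

theorem stdFil_stdExt {k : ℤ} {w : Std (p := p) (q := q) x} (h : stdFil k w) :
    ∀ᶠ y in 𝓝 x, stdFil k (stdExt w y) := by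
  filter_upwards [ext_zero_eventually (p := p) (q := q) x] with y hy
  exact ⟨h.1, fun hk ↦ by simp only [stdExt, h.2.1 hk, hy], h.2.2⟩

theorem Metric.stdFil_stdD {k : ℤ} {w : Std (p := p) (q := q) x} (h : stdFil k w)
    (v : TangentSpace (𝓡 (p + q)) x) : stdFil k (g.stdD (stdExt w) x v) := by
  refine ⟨fun _ ↦ dd_const _ x v, fun hk ↦ ?_, fun _ ↦ dd_const _ x v⟩
  have h1 := g.lc_add (vecNear_zero x) (vecNear_zero x) v
  rw [add_zero, left_eq_add] at h1
  change g.lc (ext w.2.1) x v = 0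
  rw [h.2.1 hk]
  exact (g.lc_congr (Y := 0) (ext_zero_eventually x) v).trans h1

/-- The tractor connection differs from the algebraic action of vectors by terms that preserve the
filtration. -/
theorem Metric.tensFil_nabla_sub {s : Π y : M, Tens p q l y} (hm : IsMul (s x))
    (h : ∀ y, tensFil i (s y)) (v : TangentSpace (𝓡 (p + q)) x) :
    tensFil i (g.nabla s x v - tensAct (g.down x v) (s x)) := by
  intro k w hw hk
  -- The canonical extensions keep their degrees near `x`, so the differentiated function vanishes
  -- identically there. In what remains the Levi-Civita part preserves degrees, the Schouten part
  -- raises them by one, and the action of `v` is the term subtracted.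
  have h1 : dd (fun y ↦ s y (fun j ↦ stdExt (w j) y)) x v = 0 := by
    rw [dd_congr (f := fun _ ↦ 0) _ v, dd_const]
    filter_upwards [eventually_all.2 fun j ↦ stdFil_stdExt (hw j)] with y hy
    exact h y k _ hy hk
  simp only [Pi.sub_apply, nabla, tensAct, stdNabla_eq, stdExt_self, hm.update_add,
    Finset.sum_add_distrib, h1]
  have h2 : ∑ j, s x (Function.update w j (g.stdD (stdExt (w j)) x v)) = 0 :=
    Finset.sum_eq_zero fun j _ ↦ (h x).update_add hw j 0
      (by rw [add_zero]; exact g.stdFil_stdD (hw j) v) (by omega)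
  have h3 : ∑ j, s x (Function.update w j (g.up x (g.schoutenUp x v) (w j))) = 0 :=
    Finset.sum_eq_zero fun j _ ↦ (h x).update_add hw j 1 (g.stdFil_up _ _ _ (hw j)) (by omega)
  rw [h2, h3]
  ring

theorem tensFil_contr {φ : TangentSpace (𝓡 (p + q)) x → Tens p q l x} (h : ∀ v, tensFil i (φ v)) :
    tensFil (i + 1) (contr g x φ) :=
  tensFil.neg <| .sum fun a _ ↦ .sum fun b _ ↦ .smul _ <|
    tensFil.act 1 (g.stdFil_up (bas x a)) (h (bas x b))

variable {T : Π x : M, Submodule ℝ (Tens p q l x)}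
  {Ψ : Π x : M, TangentSpace (𝓡 (p + q)) x →ₗ[ℝ] Module.End ℝ (T x)}

theorem tensFil_conn_sub (hI : IsInvariant g T) (hΨ : IsGlOne Ψ) {s : Raw0 p q l M}
    (hs : s x ∈ T x) (h : ∀ y, tensFil i (s y)) (v : TangentSpace (𝓡 (p + q)) x) :
    tensFil i (conn g Ψ s x v - tensAct (g.down x v) (s x)) := by
  have h1 := g.tensFil_nabla_sub (hI.isMul x _ hs) h v
  have h2 : tensFil i (psiApply Ψ x v (s x)) := by
    rw [psiApply_of_mem v hs]
    exact (hΨ.2 x v i ⟨s x, hs⟩ (h x)).mono (by omega)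
  have h3 := h1.add h2
  rwa [sub_add_eq_add_sub] at h3

variable (T) in
/-- The filtration of the space of sections. -/
def filZero (i : ℕ) : Submodule ℝ (C0 T) where
  carrier := {s | ∀ x, tensFil ((i : ℤ) - l) ((s : Raw0 p q l M) x)}
  zero_mem' := fun _ ↦ tensFil_zero _
  add_mem' ha hb x := (ha x).add (hb x)
  smul_mem' c _ ha x := (ha x).smul c

variable (T) in
/-- The filtration of the space of one-forms. -/
def filOne (i : ℕ) : Submodule ℝ (C1 T) where
  carrier := {φ | ∀ x v, tensFil ((i : ℤ) - l) ((φ : Raw1 p q l M) x v)}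
  zero_mem' := fun _ _ ↦ tensFil_zero _
  add_mem' ha hb x v := (ha x v).add (hb x v)
  smul_mem' c _ ha x v := (ha x v).smul c

theorem filZero_zero (hI : IsInvariant g T) : filZero T 0 = ⊤ := by
  rw [eq_top_iff]
  intro s _ x
  rw [Nat.cast_zero, zero_sub]
  exact tensFil_neg (hI.isMul x _ (s.2.1 x))

theorem filOne_zero (hI : IsInvariant g T) : filOne T 0 = ⊤ := by
  rw [eq_top_iff]
  intro φ _ x v
  rw [Nat.cast_zero, zero_sub]
  exact tensFil_neg (hI.isMul x _ (φ.2.2.1 x v))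

/-- The index `i` stands for degree `i - l`; the last possible degree is `l`, reached at `i = 2 *
l`. -/
theorem filZero_top : filZero T (2 * l + 1) = ⊥ := by
  rw [eq_bot_iff]
  intro s hs
  exact Subtype.ext <| funext fun x ↦ tensFil.eq_zero ((hs x).mono (by push_cast; omega))

theorem filOne_top : filOne T (2 * l + 1) = ⊥ := by
  rw [eq_bot_iff]
  intro φ hφ
  exact Subtype.ext <| funext fun x ↦ funext fun v ↦
    tensFil.eq_zero ((hφ x v).mono (by push_cast; omega))

/-- The difference `∇̃ - ∂` keeps the degree and `∂*` raises it by one. In `filZero_box`, by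
contrast, the degrees of `∂` and `∂*` cancel. -/
theorem filZero_step (hI : IsInvariant g T) (hΨ : IsGlOne Ψ) (i : ℕ) (s : C0 T)
    (hs : s ∈ filZero T i) :
    delOneL g hI (connL g hI hΨ s - bdZeroL g hI s) ∈ filZero T (i + 1) := fun x ↦
  (tensFil_contr g fun v ↦ tensFil_conn_sub g hI hΨ (s.2.1 x) hs v).mono (by push_cast; omega)

theorem filZero_box (hI : IsInvariant g T) (i : ℕ) (s : C0 T) (hs : s ∈ filZero T i) :
    delOneL g hI (bdZeroL g hI s) ∈ filZero T i := fun x ↦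
  (tensFil_contr g fun v ↦ (hs x).act (-1) (g.stdFil_down v)).mono (by omega)

theorem filOne_step (hI : IsInvariant g T) (hΨ : IsGlOne Ψ) (i : ℕ) (φ : C1 T)
    (hφ : φ ∈ filOne T i) :
    delTwoL g hI (dOneL g hI hΨ φ - bdOneL g hI φ) ∈ filOne T (i + 1) := fun x w ↦ by
  have h : ∀ v w, tensFil ((i : ℤ) - l) (conn g Ψ (fun y ↦ φ.1 y (ext w y)) x v
      - tensAct (g.down x v) (φ.1 x w)) := by
    intro v w
    have := tensFil_conn_sub (x := x) g hI hΨ (s := fun y ↦ φ.1 y (ext w y))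
      (φ.2.2.1 x _) (fun y ↦ hφ y _) v
    simpa only [ext_self] using this
  have h1 : ∀ v, tensFil ((i : ℤ) - l) (dOne g Ψ φ.1 x v w - bdOne g φ.1 x v w) := by
    intro v
    -- The bracket term is a value of `φ` itself and so keeps the degree as well.
    have h2 := ((h v w).sub (h w v)).sub (hφ x (bracket (ext v) (ext w) x))
    convert h2 using 1
    simp only [dOne, bdOne, LinearMap.coe_mk, AddHom.coe_mk]
    abel
  exact (tensFil_contr g h1).mono (by push_cast; omega)

theorem filOne_box (hI : IsInvariant g T) (i : ℕ) (φ : C1 T) (hφ : φ ∈ filOne T i) :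
    delTwoL g hI (bdOneL g hI φ) ∈ filOne T i := fun x w ↦ by
  have h1 : ∀ v, tensFil ((i : ℤ) - l + -1) (bdOne g φ.1 x v w) := fun v ↦
    ((hφ x w).act (-1) (g.stdFil_down v)).sub ((hφ x v).act (-1) (g.stdFil_down w))
  exact (tensFil_contr g h1).mono (by omega)

end Filtration

/-! ## Coordinates with respect to an orthonormal basis -/

section Transport

variable {p q l : ℕ} {M : Type*} [TopologicalSpace M] [ChartedSpace (Model p q) M]
  [IsManifold (𝓡 (p + q)) ∞ M] (g : Metric p q M) {x : M}

/-- The coordinates of a tensor. -/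
def tensCoord (e : Fin (p + q) → TangentSpace (𝓡 (p + q)) x) :
    Tens p q l x →ₗ[ℝ] Coords (p + q) l where
  toFun t J := t fun j ↦ stdVec x e (J j)
  map_add' _ _ := rfl
  map_smul' _ _ := rfl

theorem eq_of_tensCoord (e : Module.Basis (Fin (p + q)) ℝ (TangentSpace (𝓡 (p + q)) x))
    {t t' : Tens p q l x} (ht : IsMul t) (ht' : IsMul t')
    (h : tensCoord e t = tensCoord e t') : t = t' := by
  obtain ⟨m, rfl⟩ := ht
  obtain ⟨m', rfl⟩ := ht'
  funext w
  have h2 : w = fun j ↦ ∑ b, stdCoef (w j).1 (w j).2.2 (fun i ↦ e.repr (w j).2.1 i) b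
      • stdVec x e b := by
    funext j
    rw [sum_stdCoef, e.sum_repr]
  rw [h2, MultilinearMap.map_sum, MultilinearMap.map_sum]
  refine Finset.sum_congr rfl fun J _ ↦ ?_
  rw [MultilinearMap.map_smul_univ, MultilinearMap.map_smul_univ]
  exact congrArg _ (congrFun h J)

theorem tensCoord_act (e : Fin (p + q) → TangentSpace (𝓡 (p + q)) x) {t : Tens p q l x}
    (ht : IsMul t) {A : Std (p := p) (q := q) x → Std (p := p) (q := q) x}
    {B : Matrix (StdIdx (p + q)) (StdIdx (p + q)) ℝ}
    (hA : ∀ a, A (stdVec x e a) = ∑ b, B b a • stdVec x e b) :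
    tensCoord e (tensAct A t) = coordAct B (tensCoord e t) := by
  obtain ⟨m, rfl⟩ := ht
  funext J
  change - ∑ j, m (Function.update (fun k ↦ stdVec x e (J k)) j (A (stdVec x e (J j))))
    = - ∑ j, ∑ b, B b (J j) * m (fun k ↦ stdVec x e (Function.update J j b k))
  congr 1
  refine Finset.sum_congr rfl fun j _ ↦ ?_
  rw [hA, MultilinearMap.map_update_sum]
  refine Finset.sum_congr rfl fun b _ ↦ ?_
  rw [MultilinearMap.map_update_smul, smul_eq_mul]
  congr 2
  funext k
  rcases eq_or_ne k j with rfl | h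
  · simp
  · simp [h]

variable {e : Module.Basis (Fin (p + q)) ℝ (TangentSpace (𝓡 (p + q)) x)}

theorem up_stdVec (he : ∀ i j, g.inner x (e i) (e j) = if i = j then sign p q i else 0)
    (i : Fin (p + q)) (a : StdIdx (p + q)) :
    g.up x (e i) (stdVec x e a) = ∑ b, upMat (sign p q) i b a • stdVec x e b := by
  rw [Fintype.sum_option, Fintype.sum_option]
  rcases a with _ | _ | k
  · simp [Metric.up, stdVec, upMat]
  · simp [Metric.up, stdVec, upMat]
  · rcases eq_or_ne k i with rfl | h
    · simp [Metric.up, stdVec, upMat, he]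
    · simp [Metric.up, stdVec, upMat, he, h, h.symm]

theorem down_stdVec (he : ∀ i j, g.inner x (e i) (e j) = if i = j then sign p q i else 0)
    (i : Fin (p + q)) (a : StdIdx (p + q)) :
    g.down x (e i) (stdVec x e a) = ∑ b, downMat (sign p q) i b a • stdVec x e b := by
  rw [Fintype.sum_option, Fintype.sum_option]
  rcases a with _ | _ | k
  · simp [Metric.down, stdVec, downMat]
  · simp [Metric.down, stdVec, downMat]
  · rcases eq_or_ne k i with rfl | h
    · simp [Metric.down, stdVec, downMat, he]
    · simp [Metric.down, stdVec, downMat, he, h, h.symm]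

theorem tensCoord_contr (he : ∀ i j, g.inner x (e i) (e j) = if i = j then sign p q i else 0)
    {φ : TangentSpace (𝓡 (p + q)) x → Tens p q l x} (hφ : IsLinearMap ℝ φ)
    (hm : ∀ v, IsMul (φ v)) :
    tensCoord e (contr g x φ) = coordDel1 (sign p q) fun i ↦ tensCoord e (φ (e i)) := by
  rw [contr_eq g hφ hm e, Metric.gram_of_orthonormal g he, coordDel1_apply, map_neg, map_sum]
  congr 1
  refine Finset.sum_congr rfl fun i _ ↦ ?_
  rw [Finset.sum_eq_single i (fun j _ h ↦ by rw [Matrix.diagonal_apply_ne' _ h, zero_smul])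
    (by simp), Matrix.diagonal_apply_eq, map_smul, tensCoord_act e (hm _) (up_stdVec g he i)]

variable {T : Π x : M, Submodule ℝ (Tens p q l x)}

/-- The coordinates at `x` of a section. -/
def coordZero (T : Π x : M, Submodule ℝ (Tens p q l x))
    (e : Fin (p + q) → TangentSpace (𝓡 (p + q)) x) : C0 T →ₗ[ℝ] Coords (p + q) l where
  toFun s := tensCoord e ((s : Raw0 p q l M) x)
  map_add' _ _ := rfl
  map_smul' _ _ := rfl

/-- The coordinates at `x` of a one-form. -/
def coordOne (T : Π x : M, Submodule ℝ (Tens p q l x))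
    (e : Fin (p + q) → TangentSpace (𝓡 (p + q)) x) :
    C1 T →ₗ[ℝ] (Fin (p + q) → Coords (p + q) l) where
  toFun φ i := tensCoord e ((φ : Raw1 p q l M) x (e i))
  map_add' _ _ := rfl
  map_smul' _ _ := rfl

/-- The coordinates at `x` of a two-form. -/
def coordTwo (T : Π x : M, Submodule ℝ (Tens p q l x))
    (e : Fin (p + q) → TangentSpace (𝓡 (p + q)) x) : C2 T →ₗ[ℝ] coordAlt (p + q) l where
  toFun φ := ⟨fun i k ↦ tensCoord e ((φ : Raw2 p q l M) x (e i) (e k)), fun i k ↦ by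
    rw [← map_neg, ← φ.2.2.1 x (e i) (e k)]⟩
  map_add' _ _ := rfl
  map_smul' _ _ := rfl

/-- Since `∂` and `∂*` are algebraic, taking components at a single point intertwines them with
their coordinate versions. -/
theorem coordZero_del (hI : IsInvariant g T)
    (he : ∀ i j, g.inner x (e i) (e j) = if i = j then sign p q i else 0) (φ : C1 T) :
    coordZero T e (delOneL g hI φ) = coordDel1 (sign p q) (coordOne T e φ) :=
  tensCoord_contr g he (φ.2.1 x) fun v ↦ hI.isMul x _ (φ.2.2.1 x v)

theorem coordOne_bd (hI : IsInvariant g T)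
    (he : ∀ i j, g.inner x (e i) (e j) = if i = j then sign p q i else 0) (s : C0 T) :
    coordOne T e (bdZeroL g hI s) = coordBd0 (sign p q) (coordZero T e s) :=
  funext fun i ↦ tensCoord_act e (hI.isMul x _ (s.2.1 x)) (down_stdVec g he i)

theorem coordOne_del (hI : IsInvariant g T)
    (he : ∀ i j, g.inner x (e i) (e j) = if i = j then sign p q i else 0) (φ : C2 T) :
    coordOne T e (delTwoL g hI φ) = coordDel2 (sign p q) (coordTwo T e φ) :=
  funext fun k ↦ by
    have h := tensCoord_contr g he (φ := fun v ↦ φ.1 x v (e k)) (φ.2.1 x (e k))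
      fun v ↦ hI.isMul x _ (φ.2.2.2.1 x v _)
    exact h

theorem coordTwo_bd (hI : IsInvariant g T)
    (he : ∀ i j, g.inner x (e i) (e j) = if i = j then sign p q i else 0) (φ : C1 T) :
    coordTwo T e (bdOneL g hI φ) = coordBd1 (sign p q) (coordOne T e φ) := by
  refine Subtype.ext <| funext fun i ↦ funext fun k ↦ ?_
  change tensCoord e (tensAct (g.down x (e i)) (φ.1 x (e k))
    - tensAct (g.down x (e k)) (φ.1 x (e i))) = _
  rw [map_sub, tensCoord_act e (hI.isMul x _ (φ.2.2.1 x _)) (down_stdVec g he i),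
    tensCoord_act e (hI.isMul x _ (φ.2.2.1 x _)) (down_stdVec g he k)]
  rfl

theorem eq_of_coordZero (hI : IsInvariant g T) {s s' : C0 T}
    (h : ∀ (x : M) (e : Module.Basis (Fin (p + q)) ℝ (TangentSpace (𝓡 (p + q)) x)),
      (∀ i j, g.inner x (e i) (e j) = if i = j then sign p q i else 0) →
        coordZero T e s = coordZero T e s') : s = s' := by
  refine Subtype.ext <| funext fun x ↦ ?_
  obtain ⟨e, he⟩ := g.exists_orthonormal x
  exact eq_of_tensCoord e (hI.isMul x _ (s.2.1 x)) (hI.isMul x _ (s'.2.1 x)) (h x e he)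

theorem eq_of_coordOne (hI : IsInvariant g T) {φ φ' : C1 T}
    (h : ∀ (x : M) (e : Module.Basis (Fin (p + q)) ℝ (TangentSpace (𝓡 (p + q)) x)),
      (∀ i j, g.inner x (e i) (e j) = if i = j then sign p q i else 0) →
        coordOne T e φ = coordOne T e φ') : φ = φ' := by
  refine Subtype.ext <| funext fun x ↦ ?_
  obtain ⟨e, he⟩ := g.exists_orthonormal x
  have h1 : (φ.2.1 x).mk' _ = (φ'.2.1 x).mk' _ := e.ext fun i ↦
    eq_of_tensCoord e (hI.isMul x _ (φ.2.2.1 x _)) (hI.isMul x _ (φ'.2.2.1 x _))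
      (congrFun (h x e he) i)
  exact congrArg DFunLike.coe h1

/-- One polynomial works at all points, so the pointwise identities assemble to an identity of
smooth sections; smoothness and membership in `T` of the inverse come for free. -/
theorem exists_polynomial_zero (hI : IsInvariant g T) : ∃ Q : Polynomial ℝ, ∀ φ : C1 T,
    Polynomial.aeval (delOneL g hI ∘ₗ bdZeroL g hI : Module.End ℝ (C0 T)) Q
      (delOneL g hI (bdZeroL g hI (delOneL g hI φ))) = delOneL g hI φ := by
  obtain ⟨Q, hQ⟩ := exists_polynomial_coord0 (n := p + q) (l := l) (sign_mul_self (p := p) (q := q))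
  refine ⟨Q, fun φ ↦ eq_of_coordZero g hI fun x e he ↦ ?_⟩
  rw [aeval_intertwine (B := coordDel1 (sign p q) ∘ₗ coordBd0 (sign p q)) (coordZero T e)
    fun s ↦ (coordZero_del g hI he _).trans (congrArg _ (coordOne_bd g hI he s)),
    coordZero_del g hI he, coordOne_bd g hI he, coordZero_del g hI he, hQ]

theorem exists_polynomial_one (hI : IsInvariant g T) : ∃ Q : Polynomial ℝ, ∀ φ : C2 T,
    Polynomial.aeval (delTwoL g hI ∘ₗ bdOneL g hI : Module.End ℝ (C1 T)) Q
      (delTwoL g hI (bdOneL g hI (delTwoL g hI φ))) = delTwoL g hI φ := by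
  obtain ⟨Q, hQ⟩ := exists_polynomial_coord1 (n := p + q) (l := l) (sign_mul_self (p := p) (q := q))
  refine ⟨Q, fun φ ↦ eq_of_coordOne g hI fun x e he ↦ ?_⟩
  rw [aeval_intertwine (B := coordDel2 (sign p q) ∘ₗ coordBd1 (sign p q)) (coordOne T e)
    fun s ↦ (coordOne_del g hI he _).trans (congrArg _ (coordTwo_bd g hI he s)),
    coordOne_del g hI he, coordTwo_bd g hI he, coordOne_del g hI he, hQ]

variable {Ψ : Π x : M, TangentSpace (𝓡 (p + q)) x →ₗ[ℝ] Module.End ℝ (T x)}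

theorem bijective_delOne_conn (hI : IsInvariant g T) (hΨ : IsGlOne Ψ) :
    (∀ φ, ∃ ψ, delOneL g hI (connL g hI hΨ (delOneL g hI ψ)) = delOneL g hI φ) ∧
      ∀ ψ, delOneL g hI (connL g hI hΨ (delOneL g hI ψ)) = 0 → delOneL g hI ψ = 0 := by
  obtain ⟨Q, hQ⟩ := exists_polynomial_zero g hI
  exact bijective_of_filtration _ (bdZeroL g hI) _ Q hQ (filZero T) (filZero_zero g hI) _
    filZero_top (filZero_step g hI hΨ) (filZero_box g hI)

theorem bijective_delTwo_dOne (hI : IsInvariant g T) (hΨ : IsGlOne Ψ) :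
    (∀ φ, ∃ ψ, delTwoL g hI (dOneL g hI hΨ (delTwoL g hI ψ)) = delTwoL g hI φ) ∧
      ∀ ψ, delTwoL g hI (dOneL g hI hΨ (delTwoL g hI ψ)) = 0 → delTwoL g hI ψ = 0 := by
  obtain ⟨Q, hQ⟩ := exists_polynomial_one g hI
  exact bijective_of_filtration _ (bdOneL g hI) _ Q hQ (filOne T) (filOne_zero g hI) _
    filOne_top (filOne_step g hI hΨ) (filOne_box g hI)

end Transport

/-! ## BGG operators -/

section Splitting

variable {p q l : ℕ} {M : Type*} [TopologicalSpace M] [ChartedSpace (Model p q) M]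
  [IsManifold (𝓡 (p + q)) ∞ M] (g : Metric p q M)
  {T : Π x : M, Submodule ℝ (Tens p q l x)}
  {Ψ : Π x : M, TangentSpace (𝓡 (p + q)) x →ₗ[ℝ] Module.End ℝ (T x)}

theorem Pi0_eq_iff (hI : IsInvariant g T) (s s' : C0 T) :
    Pi0 T g s = Pi0 T g s' ↔ ∃ ψ, delOneL g hI ψ = s - s' := by
  rw [Pi0, Submodule.mkQ_apply, Submodule.mkQ_apply, Submodule.Quotient.eq]
  change ((s - s' : C0 T) : Raw0 p q l M) ∈ (C1 T).map (delStar1 g) ↔ _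
  rw [Submodule.mem_map]
  constructor
  · rintro ⟨ψ, hψ, h⟩
    exact ⟨⟨ψ, hψ⟩, Subtype.ext h⟩
  · rintro ⟨ψ, h⟩
    exact ⟨ψ, ψ.2, congrArg Subtype.val h⟩

theorem Pi1_eq_iff (φ φ' : Z1 T g) :
    Pi1 T g φ = Pi1 T g φ' ↔ (φ - φ' : Raw1 p q l M) ∈ B1 T g := by
  rw [Pi1, Submodule.mkQ_apply, Submodule.mkQ_apply, Submodule.Quotient.eq]
  rfl

theorem B1_le_Z1 (hI : IsInvariant g T) : B1 T g ≤ Z1 T g := by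
  rintro _ ⟨φ, hφ, rfl⟩
  exact ⟨delStar2_mem g hI hφ, delStar1_delStar2 g hI hφ⟩

theorem conn_mem_Z1_iff (hI : IsInvariant g T) (hΨ : IsGlOne Ψ) (s : C0 T) :
    conn g Ψ (s : Raw0 p q l M) ∈ Z1 T g ↔ delOneL g hI (connL g hI hΨ s) = 0 :=
  ⟨fun h ↦ Subtype.ext h.2, fun h ↦ ⟨conn_mem g hI hΨ s.2, congrArg Subtype.val h⟩⟩

theorem dOne_mem_Z2_iff (hI : IsInvariant g T) (hΨ : IsGlOne Ψ) (φ : C1 T) :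
    dOne g Ψ (φ : Raw1 p q l M) ∈ Z2 T g ↔ delTwoL g hI (dOneL g hI hΨ φ) = 0 :=
  ⟨fun h ↦ Subtype.ext h.2, fun h ↦ ⟨dOne_mem g hI hΨ φ.2, congrArg Subtype.val h⟩⟩

/-- Candidates are `s₀ - ∂*ψ`, and the condition reads `∂*∇̃(∂*ψ) = ∂*∇̃ s₀`: solvable and uniquely
so by bijectivity on the image of `∂*`. -/
theorem existsUnique_lift0 (hI : IsInvariant g T) (hΨ : IsGlOne Ψ) (σ : H0 T g) :
    ∃! s, IsLift0 (T := T) g Ψ σ s := by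
  obtain ⟨hex, huniq⟩ := bijective_delOne_conn g hI hΨ
  obtain ⟨s₀, rfl⟩ := Submodule.mkQ_surjective _ σ
  obtain ⟨ψ, hψ⟩ := hex (connL g hI hΨ s₀)
  refine ⟨s₀ - delOneL g hI ψ, ⟨?_, ?_⟩, fun s hs ↦ ?_⟩
  · exact (Pi0_eq_iff g hI _ _).2 ⟨-ψ, by rw [map_neg]; abel⟩
  · rw [conn_mem_Z1_iff g hI hΨ, map_sub, map_sub, hψ, sub_self]
  · obtain ⟨ψ', hψ'⟩ := (Pi0_eq_iff g hI _ _).1 hs.1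
    have h1 := (conn_mem_Z1_iff g hI hΨ s).1 hs.2
    have h2 : delOneL g hI (ψ' + ψ) = s - (s₀ - delOneL g hI ψ) := by
      rw [map_add, hψ']
      abel
    have h3 := huniq (ψ' + ψ) (by
      rw [h2, map_sub, map_sub, map_sub, map_sub, h1, hψ, sub_self, sub_self])
    rw [h2] at h3
    exact sub_eq_zero.1 h3

/-- The same argument one degree higher; in addition the correction `∂*ψ` has to stay in `Z_1`,
which is `∂*∂* = 0`. -/
theorem existsUnique_lift1 (hI : IsInvariant g T) (hΨ : IsGlOne Ψ) (τ : H1 T g) :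
    ∃! φ, IsLift1 (T := T) g Ψ τ φ := by
  obtain ⟨hex, huniq⟩ := bijective_delTwo_dOne g hI hΨ
  obtain ⟨φ₀, rfl⟩ := Submodule.mkQ_surjective _ τ
  obtain ⟨ψ, hψ⟩ := hex (dOneL g hI hΨ ⟨φ₀, φ₀.2.1⟩)
  have hB : ∀ ψ : C2 T, (delTwoL g hI ψ : Raw1 p q l M) ∈ B1 T g := fun ψ ↦ ⟨ψ, ψ.2, rfl⟩
  refine ⟨φ₀ - ⟨delTwoL g hI ψ, B1_le_Z1 g hI (hB ψ)⟩, ⟨?_, ?_⟩, fun φ hφ ↦ ?_⟩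
  · refine (Pi1_eq_iff g _ _).2 ?_
    rw [Submodule.coe_sub, sub_sub_cancel_left]
    exact (B1 T g).neg_mem (hB ψ)
  · have h1 := (dOne_mem_Z2_iff g hI hΨ (⟨φ₀, φ₀.2.1⟩ - delTwoL g hI ψ)).2
      (by rw [map_sub, map_sub, hψ, sub_self])
    rw [Submodule.coe_sub] at h1 ⊢
    exact h1
  · obtain ⟨ψ', hψ', h'⟩ := (Pi1_eq_iff g _ _).1 hφ.1
    have h1 := (dOne_mem_Z2_iff g hI hΨ ⟨φ, φ.2.1⟩).1 hφ.2
    have h2 : delTwoL g hI (⟨ψ', hψ'⟩ + ψ)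
        = ⟨φ, φ.2.1⟩ - (⟨φ₀, φ₀.2.1⟩ - delTwoL g hI ψ) := by
      have h4 : delTwoL g hI ⟨ψ', hψ'⟩ = ⟨φ, φ.2.1⟩ - ⟨φ₀, φ₀.2.1⟩ := Subtype.ext h'
      rw [map_add, h4]
      abel
    have h3 := huniq (⟨ψ', hψ'⟩ + ψ) (by
      rw [h2, map_sub, map_sub, map_sub, map_sub, h1, hψ, sub_self, sub_self])
    rw [h2] at h3
    have h4 := congrArg Subtype.val (sub_eq_zero.1 h3)
    exact Subtype.ext h4

theorem isLift0_L0 (hI : IsInvariant g T) (hΨ : IsGlOne Ψ) (σ : H0 T g) :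
    IsLift0 g Ψ σ (L0 g Ψ σ) :=
  Classical.epsilon_spec (existsUnique_lift0 g hI hΨ σ).exists

theorem eq_L0 (hI : IsInvariant g T) (hΨ : IsGlOne Ψ) {σ : H0 T g} {s : C0 T}
    (hs : IsLift0 g Ψ σ s) : s = L0 g Ψ σ :=
  (existsUnique_lift0 g hI hΨ σ).unique hs (isLift0_L0 g hI hΨ σ)

theorem isLift1_L1 (hI : IsInvariant g T) (hΨ : IsGlOne Ψ) (τ : H1 T g) :
    IsLift1 g Ψ τ (L1 g Ψ τ) :=
  Classical.epsilon_spec (existsUnique_lift1 g hI hΨ τ).exists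

theorem eq_L1 (hI : IsInvariant g T) (hΨ : IsGlOne Ψ) {τ : H1 T g} {φ : Z1 T g}
    (hφ : IsLift1 g Ψ τ φ) : φ = L1 g Ψ τ :=
  (existsUnique_lift1 g hI hΨ τ).unique hφ (isLift1_L1 g hI hΨ τ)

/-- The default value in `Theta0` never occurs, because `L0` really produces a lift. -/
theorem Theta0_eq (hI : IsInvariant g T) (hΨ : IsGlOne Ψ) (σ : H0 T g) :
    Theta0 g Ψ σ = Pi1 T g ⟨conn g Ψ (L0 g Ψ σ : Raw0 p q l M), (isLift0_L0 g hI hΨ σ).2⟩ :=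
  dif_pos (isLift0_L0 g hI hΨ σ).2

theorem isGlOne_zero : IsGlOne (T := T) 0 :=
  ⟨fun x X s _ _ _ ↦ by
    simp only [psiApply_zero]
    exact .zero x, fun _ _ i t _ ↦ tensFil_zero (i + 1)⟩

theorem conn_sub_conn_zero (s : Raw0 p q l M) :
    conn g Ψ s - conn (T := T) g 0 s = fun x v ↦ psiApply Ψ x v (s x) := by
  funext x v
  simp only [Pi.sub_apply, conn, psiApply_zero]
  abel

/-- The connections differ by `Ψ s ∈ B_1 ⊂ Z_1`, so a lift for one is a lift for the other, and
lifts are unique. -/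
theorem L0_eq_of_psi (hI : IsInvariant g T) (hΨ : IsGlOne Ψ)
    (hB : ∀ s ∈ C0 T, (fun x v ↦ psiApply Ψ x v (s x)) ∈ B1 T g) (σ : H0 T g) :
    L0 g Ψ σ = L0 g 0 σ := by
  have h := isLift0_L0 g hI hΨ σ
  refine eq_L0 g hI isGlOne_zero ⟨h.1, ?_⟩
  have h1 := B1_le_Z1 g hI (hB _ (L0 g Ψ σ).2)
  rw [← conn_sub_conn_zero g] at h1
  simpa using (Z1 T g).sub_mem h.2 h1

theorem Theta0_eq_of_psi (hI : IsInvariant g T) (hΨ : IsGlOne Ψ)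
    (hB : ∀ s ∈ C0 T, (fun x v ↦ psiApply Ψ x v (s x)) ∈ B1 T g) (σ : H0 T g) :
    Theta0 g Ψ σ = Theta0 g 0 σ := by
  rw [Theta0_eq g hI hΨ, Theta0_eq g hI isGlOne_zero, Pi1_eq_iff]
  simp only [L0_eq_of_psi g hI hΨ hB]
  rw [conn_sub_conn_zero]
  exact hB _ (L0 g 0 σ).2

/-- `dOne g Ψ (conn g Ψ s)` unfolds to `curv g Ψ s`, so the curvature hypothesis is exactly the
condition on `∂*`. -/
theorem conn_conn_mem_Z2 (hI : IsInvariant g T) (hΨ : IsGlOne Ψ)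
    (hR : ∀ s ∈ C0 T, delStar2 g (curv g Ψ s) = 0) {s : Raw0 p q l M} (hs : s ∈ C0 T) :
    dOne g Ψ (conn g Ψ s) ∈ Z2 T g :=
  ⟨dOne_mem g hI hΨ (conn_mem g hI hΨ hs), hR s hs⟩

/-- The section `∇̃ L̃_0 σ` lies in `Z_1`, projects to `Θ̃_0 σ` and has exterior derivative in
`Z_2`; uniqueness of the lift identifies it. -/
theorem conn_L0 (hI : IsInvariant g T) (hΨ : IsGlOne Ψ)
    (hR : ∀ s ∈ C0 T, delStar2 g (curv g Ψ s) = 0) (σ : H0 T g) :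
    conn g Ψ (L0 g Ψ σ : Raw0 p q l M) = L1 g Ψ (Theta0 g Ψ σ) :=
  congrArg Subtype.val (eq_L1 g hI hΨ (φ := ⟨_, (isLift0_L0 g hI hΨ σ).2⟩)
    ⟨(Theta0_eq g hI hΨ σ).symm, conn_conn_mem_Z2 g hI hΨ hR (L0 g Ψ σ).2⟩)

theorem L1_zero (hI : IsInvariant g T) (hΨ : IsGlOne Ψ) : L1 g Ψ (0 : H1 T g) = 0 := by
  refine (eq_L1 g hI hΨ ⟨map_zero _, ?_⟩).symm
  refine (dOne_mem_Z2_iff g hI hΨ 0).2 ?_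
  rw [map_zero, map_zero]

theorem isGeometricProlongation (hI : IsInvariant g T) (hΨ : IsGlOne Ψ)
    (hR : ∀ s ∈ C0 T, delStar2 g (curv g Ψ s) = 0) :
    IsGeometricProlongation g (conn g Ψ) (Pi0 T g) (L0 g Ψ) (Theta0 g Ψ) := by
  let par : Submodule ℝ (C0 T) := LinearMap.ker (connL g hI hΨ)
  have hpar : ∀ s : C0 T, s ∈ par ↔ conn g Ψ (s : Raw0 p q l M) = 0 := fun s ↦
    ⟨fun h ↦ congrArg Subtype.val h, fun h ↦ Subtype.ext h⟩
  -- A parallel section satisfies the lifting condition trivially, since `0 ∈ Z_1`.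
  have hL : ∀ s ∈ par, s = L0 g Ψ (Pi0 T g s) := fun s hs ↦ eq_L0 g hI hΨ
    ⟨rfl, by rw [(hpar s).1 hs]; exact (Z1 T g).zero_mem⟩
  have hmem : ∀ σ, Theta0 g Ψ σ = 0 → L0 g Ψ σ ∈ par := by
    intro σ hσ
    rw [hpar, conn_L0 g hI hΨ hR, hσ, L1_zero g hI hΨ]
    rfl
  -- `Theta0` is built by choice and is not known to be linear; describing its kernel as the image
  -- of the parallel sections makes it a subspace.
  let sol : Submodule ℝ (H0 T g) := par.map (Pi0 T g)
  have hsol : ∀ σ, σ ∈ sol ↔ Theta0 g Ψ σ = 0 := by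
    refine fun σ ↦ ⟨?_, fun h ↦ ⟨L0 g Ψ σ, hmem σ h, (isLift0_L0 g hI hΨ σ).1⟩⟩
    rintro ⟨s, hs, rfl⟩
    rw [Theta0_eq g hI hΨ, ← map_zero (Pi1 T g)]
    congr 1
    refine Subtype.ext ?_
    change conn g Ψ (L0 g Ψ (Pi0 T g s) : Raw0 p q l M) = 0
    rw [← hL s hs]
    exact (hpar s).1 hs
  let f : par →ₗ[ℝ] sol := (Pi0 T g).restrict fun s hs ↦ Submodule.mem_map_of_mem hs
  have hf : Function.Bijective f := by
    refine ⟨fun s s' h ↦ Subtype.ext ?_, fun ⟨σ, s, hs, h⟩ ↦ ⟨⟨s, hs⟩, Subtype.ext h⟩⟩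
    have h1 : Pi0 T g s = Pi0 T g s' := congrArg Subtype.val h
    rw [hL s s.2, hL s' s'.2, h1]
  refine ⟨par, sol, LinearEquiv.ofBijective f hf, hpar, hsol, fun s ↦ rfl, fun σ ↦ ?_⟩
  have h1 : (LinearEquiv.ofBijective f hf).symm σ = ⟨L0 g Ψ σ, hmem σ ((hsol σ).1 σ.2)⟩ := by
    rw [LinearEquiv.symm_apply_eq]
    exact Subtype.ext (isLift0_L0 g hI hΨ σ).1.symm
  rw [h1]

end Splitting

end ConfTractor

/-! ### The main theorem -/

theorem mainTheorem1 {p q l : ℕ} (hn : 3 ≤ p + q) {M : Type*} [TopologicalSpace M] [T2Space M]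
    [SigmaCompactSpace M] [ChartedSpace (ConfTractor.Model p q) M] [IsManifold (𝓡 (p + q)) ∞ M]
    (g : ConfTractor.Metric p q M)
    (T : Π x : M, Submodule ℝ (ConfTractor.Tens p q l x)) (hT : ConfTractor.IsTractorBundle g T)
    (Ψ : Π x : M, TangentSpace (𝓡 (p + q)) x →ₗ[ℝ] Module.End ℝ (T x))
    (hΨ : ConfTractor.IsGlOne Ψ)
    (hB : ∀ s ∈ ConfTractor.C0 T,
      (fun x v ↦ ConfTractor.psiApply Ψ x v (s x)) ∈ ConfTractor.B1 T g)
    (hR : ∀ s ∈ ConfTractor.C0 T, ConfTractor.delStar2 g (ConfTractor.curv g Ψ s) = 0) :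
    -- the splitting operators of the tractor connection and of its deformation are well defined
    (∀ σ, ∃! s, ConfTractor.IsLift0 (T := T) g 0 σ s) ∧
    (∀ σ, ∃! s, ConfTractor.IsLift0 (T := T) g Ψ σ s) ∧
    (∀ τ, ∃! φ, ConfTractor.IsLift1 (T := T) g Ψ τ φ) ∧
    -- the deformation changes neither the first splitting operator nor the first BGG operator
    (∀ σ, ConfTractor.L0 g Ψ σ = ConfTractor.L0 g 0 σ) ∧
    (∀ σ, ConfTractor.Theta0 g Ψ σ = ConfTractor.Theta0 g 0 σ) ∧
    -- the deformed connection intertwines the splitting operators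
    (∀ s ∈ ConfTractor.C0 T,
      ConfTractor.dOne g Ψ (ConfTractor.conn g Ψ s) ∈ ConfTractor.Z2 T g) ∧
    (∀ σ : ConfTractor.H0 T g, ConfTractor.conn g Ψ (ConfTractor.L0 g 0 σ : ConfTractor.Raw0 p q l M)
      = ConfTractor.L1 g Ψ (ConfTractor.Theta0 g 0 σ)) ∧
    (∀ s : ConfTractor.C0 T,
      ConfTractor.conn g Ψ (s : ConfTractor.Raw0 p q l M)
          = ConfTractor.L1 g Ψ (ConfTractor.Theta0 g 0 (ConfTractor.Pi0 T g s)) ↔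
        ConfTractor.delStar1 g (ConfTractor.conn g Ψ (s : ConfTractor.Raw0 p q l M)) = 0) ∧
    -- the deformed connection prolongs the first BGG operator of the tractor connection
    ConfTractor.IsGeometricProlongation (T := T) g (ConfTractor.conn g Ψ) (ConfTractor.Pi0 T g)
      (ConfTractor.L0 g 0) (ConfTractor.Theta0 g 0) := by
  have hI := hT.isInvariant g
  have hL := ConfTractor.L0_eq_of_psi g hI hΨ hB
  have hΘ := ConfTractor.Theta0_eq_of_psi g hI hΨ hB
  have hconn : ∀ σ : ConfTractor.H0 T g,
      ConfTractor.conn g Ψ (ConfTractor.L0 g 0 σ : ConfTractor.Raw0 p q l M)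
        = ConfTractor.L1 g Ψ (ConfTractor.Theta0 g 0 σ) := fun σ ↦ by
    rw [← hL, ← hΘ]
    exact ConfTractor.conn_L0 g hI hΨ hR σ
  refine ⟨ConfTractor.existsUnique_lift0 g hI ConfTractor.isGlOne_zero,
    ConfTractor.existsUnique_lift0 g hI hΨ, ConfTractor.existsUnique_lift1 g hI hΨ, hL, hΘ,
    fun s hs ↦ ConfTractor.conn_conn_mem_Z2 g hI hΨ hR hs, hconn, fun s ↦ ⟨fun h ↦ ?_, fun h ↦ ?_⟩,
    ?_⟩
  -- Values of `L1` lie in `Z_1` by construction.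
  · rw [h]
    exact (Subtype.prop (ConfTractor.L1 g Ψ _)).2
  -- The condition `∂*(∇̃ s) = 0` says that `s` is itself the lift of `Π_0 s`, so the intertwining
  -- relation applies with `s = L_0 Π_0 s`.
  · rw [← hconn, ← hL]
    congr 2
    exact ConfTractor.eq_L0 g hI hΨ ⟨rfl, ConfTractor.conn_mem g hI hΨ s.2, h⟩
  · rw [← funext hL, ← funext hΘ]
    exact ConfTractor.isGeometricProlongation g hI hΨ hR
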